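/- Let $f,g\in C^\infty(\mathbb R,\mathbb R)$ with $g(0)=0$, and let $\bar u\in H^1(\mathbb R)$. Let $\bar x:\mathbb R\to\mathbb R$ be the inverse of the increasing bijection $x\mapsto\int_0^x(1+\bar u_x^2(y))\,dy$. For $(u,w,v)$ in the Banach space $$X:=H^1(\mathbb R)\times\left(L^2(\mathbb R)\cap L^\infty(\mathbb R)\right)\times L^\infty(\mathbb R),\qquad \|(u,w,v)\|_X=\|u\|_{H^1}+\|w\|_{L^2}+\|w\|_{L^\infty}+\|v\|_{L^\infty},$$ put $$K(Z,Z')=e^{-\left|\int_Z^{Z'}v\cos^2\frac w2\,ds\right|}\left(g(u(Z'))\cos^2\tfrac{w(Z')}2+\tfrac{f''(u(Z'))}2\sin^2\tfrac{w(Z')}2\right)v(Z'),$$ $$P(Z)=\frac12\int_{\mathbb R}K(Z,Z')\,dZ',\qquad P_x(Z)=\frac12\left(\int_Z^{+\infty}-\int_{-\infty}^Z\right)K(Z,Z')\,dZ'.$$ Consider the Cauchy problem $$u_T=-P_x,\qquad w_T=2(g(u)-P)\cos^2\tfrac w2-f''(u)\sin^2\tfrac w2,\qquad v_T=\left(g(u)-P+\tfrac{f''(u)}2\right)v\sin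 w,$$ $$u(0,Z)=\bar u(\bar x(Z)),\qquad w(0,Z)=2\arctan\bar u_x(\bar x(Z)),\qquad v(0,Z)=1.$$ A solution on an interval $I\subseteq[0,\infty)$ with $0\in I$ is a map $T\mapsto(u,w,v)(T)$ from $I$ to $X$ that satisfies the initial conditions (almost everywhere in $Z$) and that, at every $T\in I$, is differentiable in the norm of $X$ (one-sidedly at end points of $I$) with derivative equal to the right-hand side, the integrals that define $P(Z)$ and $P_x(Z)$ being absolutely convergent for every $Z$. Then the Cauchy problem has a solution defined on $[0,\infty)$, and it is unique: every solution on any such interval $I$ coincides with it on $I$. -/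

import Mathlib

open MeasureTheory Set
open scoped ContDiff ENNReal

noncomputable section

namespace DispersiveWave

/-- `p` is the weak derivative of `u` on the real line, tested against `C_c^∞(ℝ)`. -/
def IsWeakDeriv (u p : ℝ → ℝ) : Prop :=
  ∀ φ : ℝ → ℝ, ContDiff ℝ ∞ φ → HasCompactSupport φ →
    ∫ x, u x * deriv φ x = -∫ x, p x * φ x

theorem integrable_mul_test (u : Lp ℝ 2 (volume : Measure ℝ)) {φ : ℝ → ℝ}
    (hφ : Continuous φ) (hc : HasCompactSupport φ) : Integrable (fun x => u x * φ x) := by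
  have hu : LocallyIntegrable (u : ℝ → ℝ) volume :=
    (Lp.memLp u).locallyIntegrable (by norm_num)
  have h := hu.integrable_smul_left_of_hasCompactSupport hφ hc
  simpa [smul_eq_mul, mul_comm] using h

/-- The Sobolev space `H¹(ℝ)`: pairs `(u, u')` in `L² × L²` such that `u'` is the weak derivative
of `u` (so `u'` is determined by `u`). It is a linear subspace of `L² × L²` and carries the norm
`max (‖u‖_{L²}) (‖u'‖_{L²})`, which is equivalent to the usual Hilbert norm of `H¹`. -/
def H1 : Submodule ℝ (Lp ℝ 2 (volume : Measure ℝ) × Lp ℝ 2 (volume : Measure ℝ)) where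
  carrier := {q | IsWeakDeriv q.1 q.2}
  zero_mem' := by
    intro φ _ _
    simp
  add_mem' := by
    intro a b ha hb φ hφ hc
    have hd : Continuous (deriv φ) := hφ.continuous_deriv (by simp)
    have key : ∀ (s t : Lp ℝ 2 (volume : Measure ℝ)) (ψ : ℝ → ℝ), Continuous ψ →
        HasCompactSupport ψ →
        ∫ x, (s + t : Lp ℝ 2 (volume : Measure ℝ)) x * ψ x
          = (∫ x, s x * ψ x) + ∫ x, t x * ψ x := by
      intro s t ψ h1 h2
      rw [← integral_add (integrable_mul_test s h1 h2) (integrable_mul_test t h1 h2)]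
      refine integral_congr_ae ?_
      filter_upwards [Lp.coeFn_add s t] with x hx
      rw [hx, Pi.add_apply, add_mul]
    have e1 := ha φ hφ hc
    have e2 := hb φ hφ hc
    simp only [Prod.fst_add, Prod.snd_add]
    rw [key _ _ _ hd hc.deriv, key _ _ _ hφ.continuous hc, e1, e2, neg_add]
  smul_mem' := by
    intro c a ha φ hφ hc
    have key : ∀ (s : Lp ℝ 2 (volume : Measure ℝ)) (ψ : ℝ → ℝ),
        ∫ x, (c • s : Lp ℝ 2 (volume : Measure ℝ)) x * ψ x = c * ∫ x, s x * ψ x := by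
      intro s ψ
      rw [← integral_const_mul]
      refine integral_congr_ae ?_
      filter_upwards [Lp.coeFn_smul c s] with x hx
      rw [hx, Pi.smul_apply, smul_eq_mul, mul_assoc]
    have e1 := ha φ hφ hc
    simp only [Prod.smul_fst, Prod.smul_snd]
    rw [key, key, e1, mul_neg]

/-- The space `L²(ℝ) ∩ L^∞(ℝ)`: pairs of an `L²` class and an `L^∞` class that agree almost
everywhere, with the norm `max (‖w‖_{L²}) (‖w‖_{L^∞})`, equivalent to the sum of the two. -/
def L2Linf : Submodule ℝ (Lp ℝ 2 (volume : Measure ℝ) × Lp ℝ ∞ (volume : Measure ℝ)) where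
  carrier := {q | (q.1 : ℝ → ℝ) =ᵐ[volume] (q.2 : ℝ → ℝ)}
  zero_mem' := by
    filter_upwards [Lp.coeFn_zero ℝ 2 (volume : Measure ℝ),
      Lp.coeFn_zero ℝ ∞ (volume : Measure ℝ)] with x h1 h2
    simp only [Prod.fst_zero, Prod.snd_zero]
    rw [h1, h2]
  add_mem' := by
    intro a b ha hb
    filter_upwards [ha, hb, Lp.coeFn_add a.1 b.1, Lp.coeFn_add a.2 b.2] with x h1 h2 h3 h4
    simp only [Prod.fst_add, Prod.snd_add]
    rw [h3, h4, Pi.add_apply, Pi.add_apply, h1, h2]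
  smul_mem' := by
    intro c a ha
    filter_upwards [ha, Lp.coeFn_smul c a.1, Lp.coeFn_smul c a.2] with x h1 h3 h4
    simp only [Prod.smul_fst, Prod.smul_snd]
    rw [h3, h4, Pi.smul_apply, Pi.smul_apply, h1]

/-- The Banach space `X = H¹ × (L² ∩ L^∞) × L^∞` of triples `(u, w, v)`. Its norm is the maximum of
the norms of the components, equivalent to their sum. -/
abbrev X : Type := H1 × L2Linf × Lp ℝ ∞ (volume : Measure ℝ)

/-- The function underlying an element of `H¹(ℝ)`. -/
def H1.fn (u : H1) : ℝ → ℝ := (u.1.1 : ℝ → ℝ)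

/-- The weak derivative of an element of `H¹(ℝ)`. -/
def H1.weakDeriv (u : H1) : ℝ → ℝ := (u.1.2 : ℝ → ℝ)

/-- The function underlying an element of `L² ∩ L^∞`. -/
def L2Linf.fn (w : L2Linf) : ℝ → ℝ := (w.1.2 : ℝ → ℝ)

/-- The component `u` of a point of `X`, as a function of `Z`. -/
def X.u (q : X) : ℝ → ℝ := H1.fn q.1

/-- The component `w` of a point of `X`, as a function of `Z`. -/
def X.w (q : X) : ℝ → ℝ := L2Linf.fn q.2.1

/-- The component `v` of a point of `X`, as a function of `Z`. -/
def X.v (q : X) : ℝ → ℝ := (q.2.2 : ℝ → ℝ)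

/-- The integrand, at the point `Z'`, of the nonlocal terms `P(Z)` and `P_x(Z)`:
`exp(-|∫_Z^{Z'} v cos²(w/2) ds|) (g(u) cos²(w/2) + (f''(u)/2) sin²(w/2)) v`. -/
def kernelIntegrand (f g : ℝ → ℝ) (q : X) (Z Z' : ℝ) : ℝ :=
  Real.exp (-|∫ s in Z..Z', q.v s * Real.cos (q.w s / 2) ^ 2|) *
    (g (q.u Z') * Real.cos (q.w Z' / 2) ^ 2
      + deriv (deriv f) (q.u Z') / 2 * Real.sin (q.w Z' / 2) ^ 2) * q.v Z'

/-- The nonlocal term `P`. -/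
def nonlocalP (f g : ℝ → ℝ) (q : X) (Z : ℝ) : ℝ :=
  1 / 2 * ∫ Z', kernelIntegrand f g q Z Z'

/-- The nonlocal term `P_x`. -/
def nonlocalPx (f g : ℝ → ℝ) (q : X) (Z : ℝ) : ℝ :=
  1 / 2 * ((∫ Z' in Ioi Z, kernelIntegrand f g q Z Z')
    - ∫ Z' in Iic Z, kernelIntegrand f g q Z Z')

/-- `d ∈ X` is the value at `q = (u, w, v) ∈ X` of the right-hand side of the semi-linear system.
The first clause says that the integrals defining `P` and `P_x` converge absolutely. -/
structure IsRHS (f g : ℝ → ℝ) (q d : X) : Prop where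
  integrable : ∀ Z, Integrable (kernelIntegrand f g q Z)
  u_eq : ∀ᵐ Z, d.u Z = -nonlocalPx f g q Z
  w_eq : ∀ᵐ Z, d.w Z =
    2 * (g (q.u Z) - nonlocalP f g q Z) * Real.cos (q.w Z / 2) ^ 2
      - deriv (deriv f) (q.u Z) * Real.sin (q.w Z / 2) ^ 2
  v_eq : ∀ᵐ Z, d.v Z =
    (g (q.u Z) - nonlocalP f g q Z + deriv (deriv f) (q.u Z) / 2) * q.v Z * Real.sin (q.w Z)

/-- The energy coordinate `x ↦ ∫_0^x (1 + ū_x²)` of the initial datum. -/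
def energyCoord (ubar : H1) (x : ℝ) : ℝ := ∫ y in (0 : ℝ)..x, (1 + H1.weakDeriv ubar y ^ 2)

theorem intervalIntegrable_energy (ubar : H1) (a b : ℝ) :
    IntervalIntegrable (fun y => 1 + H1.weakDeriv ubar y ^ 2) volume a b :=
  intervalIntegrable_const.add (Lp.memLp ubar.1.2).integrable_sq.intervalIntegrable

theorem energyCoord_sub (ubar : H1) {x y : ℝ} (h : x ≤ y) :
    y - x ≤ energyCoord ubar y - energyCoord ubar x := by
  unfold energyCoord
  rw [intervalIntegral.integral_interval_sub_left (intervalIntegrable_energy ubar 0 y)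
    (intervalIntegrable_energy ubar 0 x)]
  have := intervalIntegral.integral_mono_on (μ := volume) (f := fun _ => (1 : ℝ)) h
    intervalIntegrable_const (intervalIntegrable_energy ubar x y)
    (fun z _ => by nlinarith [sq_nonneg (H1.weakDeriv ubar z)])
  simpa using this

theorem energyCoord_bijective (ubar : H1) : Function.Bijective (energyCoord ubar) := by
  have h0 : energyCoord ubar 0 = 0 := by simp [energyCoord]
  refine ⟨StrictMono.injective fun x y h => ?_, ?_⟩
  · linarith [energyCoord_sub ubar h.le]
  · have hc : Continuous (energyCoord ubar) :=
      intervalIntegral.continuous_primitive (fun a b => intervalIntegrable_energy ubar a b) 0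
    refine hc.surjective ?_ ?_
    · refine Filter.tendsto_atTop_mono' _ ?_ Filter.tendsto_id
      filter_upwards [Filter.eventually_ge_atTop (0 : ℝ)] with x hx
      have := energyCoord_sub ubar hx
      simp only [id]
      linarith
    · refine Filter.tendsto_atBot_mono' _ ?_ Filter.tendsto_id
      filter_upwards [Filter.eventually_le_atBot (0 : ℝ)] with x hx
      have := energyCoord_sub ubar hx
      simp only [id]
      linarith

/-- The inverse `x̄` of the energy coordinate: `x̄(Z)` is the only `x` with
`∫_0^x (1 + ū_x²) = Z`. -/
def xbar (ubar : H1) : ℝ → ℝ := (Equiv.ofBijective _ (energyCoord_bijective ubar)).symm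

/-- `q = (u, w, v)` is the initial datum in the energy coordinate:
`u = ū ∘ x̄`, `w = 2 arctan (ū_x ∘ x̄)`, `v = 1`. -/
structure IsInitialDatum (ubar : H1) (q : X) : Prop where
  u_eq : ∀ᵐ Z, q.u Z = H1.fn ubar (xbar ubar Z)
  w_eq : ∀ᵐ Z, q.w Z = 2 * Real.arctan (H1.weakDeriv ubar (xbar ubar Z))
  v_eq : ∀ᵐ Z, q.v Z = 1

/-- `U` solves the Cauchy problem on the time set `I` (an interval `I ⊆ [0, ∞)` containing `0`), as
an ordinary differential equation in the Banach space `X`: at each `T ∈ I` it is differentiable for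
the norm of `X`, one-sidedly at the end points of `I`, and its derivative is the right-hand side. -/
structure IsSolutionOn (f g : ℝ → ℝ) (ubar : H1) (I : Set ℝ) (U : ℝ → X) : Prop where
  initial : IsInitialDatum ubar (U 0)
  ode : ∀ T ∈ I, ∃ d : X, IsRHS f g (U T) d ∧ HasDerivWithinAt U d I T

end DispersiveWave

end

/-!
# Global well-posedness of the semi-linear system in the energy coordinate

The system is an ordinary differential equation `q' = F(q)` in the Banach space `X`. Three facts
make it globally well posed.

*The vector field is locally Lipschitz where `v` is bounded below.* If `v ≥ c > 0` and `w ∈ L²`,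
then `∫_Z^{Z'} v cos² (w / 2) ≥ c |Z' - Z| - M`, since `sin² (w / 2) v` is integrable. The kernel of
the nonlocal terms is therefore dominated by `exp(M) exp(-c |Z' - Z|)`, and convolution with this
exponential maps `L²` into `L² ∩ L^∞`. Splitting `P` and `P_x` into the parts to the left and to the
right of `Z` shows that they are locally absolutely continuous, with
`P_Z = v cos² (w / 2) P_x` and `(P_x)_Z = v cos² (w / 2) P - h`, where `h` is the density in the
kernel. So `F` takes values in `X` (`Good.exists_isRHS`), and it is Lipschitz on the sets
`‖q‖ ≤ R`, `v ≥ c` (`exists_lipschitz`). The Picard-Lindelöf theorem gives a local solution, on a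
time interval whose length depends on `c` and `R` only, and local uniqueness.

*Two quantities are conserved.* The relation `u_Z = (v sin w) / 2` holds for the initial datum, and
the time derivative of its defect vanishes (`IsWeight.ae_defect_deriv_eq_zero`). When it holds, the
time derivative of the energy density `(u² cos² (w / 2) + sin² (w / 2)) v` is the `Z`-derivative of
an integrable flux, so the energy `E` is constant (`IsWeight.integral_energy_deriv_eq_zero`).

*The conserved quantities prevent blow-up.* From `(u²)_Z = u v sin w`, which is at most the energy
density in absolute value, `u² ≤ E`. The energy also bounds `P` independently of the bounds on `v`
(`Tame.partsSum_le`), because the kernel has mass at most one on each side of `Z` for the measure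
`v cos² (w / 2) dZ'`. Hence `|v_T| ≤ C v` with `C` depending on `E` only, so
`exp(-C T) ≤ v ≤ exp(C T)`, and then `‖F‖`, and with it `‖q‖`, stays bounded on bounded
time intervals (`exists_a_priori_bound`). Local solutions therefore extend by a fixed time step up
to any given time. Uniqueness among all solutions follows because the set of times at which another
solution agrees with this one is closed and, by local uniqueness, open to the right.
-/

namespace DispersiveWave

open Filter Topology

/-! ### Locally absolutely continuous functions -/

/-- `u` is locally absolutely continuous on the line with derivative `p`: `p` is locally integrable
and `u` is one of its primitives. -/
structure IsPrimitive (u p : ℝ → ℝ) : Prop where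
  locallyIntegrable : LocallyIntegrable p volume
  sub_eq : ∀ a b, u b - u a = ∫ x in a..b, p x

theorem _root_.MeasureTheory.LocallyIntegrable.intervalIntegrable {p : ℝ → ℝ}
    (h : LocallyIntegrable p volume) (a b : ℝ) : IntervalIntegrable p volume a b :=
  (h.integrableOn_isCompact isCompact_uIcc).intervalIntegrable

theorem _root_.AbsolutelyContinuousOnInterval.comp_lipschitzOnWith {u H : ℝ → ℝ} {a b : ℝ}
    {K : NNReal} {s : Set ℝ} (hu : AbsolutelyContinuousOnInterval u a b)
    (hH : LipschitzOnWith K H s) (hs : MapsTo u (uIcc a b) s) :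
    AbsolutelyContinuousOnInterval (fun x => H (u x)) a b := by
  rw [absolutelyContinuousOnInterval_iff] at hu ⊢
  intro ε hε
  obtain ⟨δ, hδ, h⟩ := hu (ε / (K + 1)) (by positivity)
  refine ⟨δ, hδ, fun E hE hd => ?_⟩
  have h1 := h E hE hd
  calc ∑ i ∈ Finset.range E.1, dist (H (u (E.2 i).1)) (H (u (E.2 i).2))
      ≤ ∑ i ∈ Finset.range E.1, K * dist (u (E.2 i).1) (u (E.2 i).2) :=
        Finset.sum_le_sum fun i hi =>
          hH.dist_le_mul _ (hs (hE.1 i hi).1) _ (hs (hE.1 i hi).2)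
    _ = K * ∑ i ∈ Finset.range E.1, dist (u (E.2 i).1) (u (E.2 i).2) :=
        (Finset.mul_sum _ _ _).symm
    _ ≤ K * (ε / (K + 1)) := by gcongr
    _ < (K + 1) * (ε / (K + 1)) := by gcongr; linarith
    _ = ε := by field_simp

namespace IsPrimitive

variable {u p v q : ℝ → ℝ}

theorem intervalIntegrable (h : IsPrimitive u p) (a b : ℝ) : IntervalIntegrable p volume a b :=
  h.locallyIntegrable.intervalIntegrable a b

theorem eq_add (h : IsPrimitive u p) (a : ℝ) : u = fun x => u a + ∫ t in a..x, p t := by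
  ext x
  rw [← h.sub_eq a x]
  ring

theorem continuous (h : IsPrimitive u p) : Continuous u := by
  rw [h.eq_add 0]
  exact continuous_const.add
    (intervalIntegral.continuous_primitive (fun a b => h.intervalIntegrable a b) 0)

theorem of_integral (hp : LocallyIntegrable p volume) (c : ℝ) :
    IsPrimitive (fun x => ∫ t in c..x, p t) p := by
  refine ⟨hp, fun a b => ?_⟩
  rw [intervalIntegral.integral_interval_sub_left (hp.intervalIntegrable _ _)
    (hp.intervalIntegrable _ _)]

theorem absolutelyContinuousOnInterval (h : IsPrimitive u p) (a b : ℝ) :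
    AbsolutelyContinuousOnInterval u a b := by
  have h1 := (h.intervalIntegrable a b).absolutelyContinuousOnInterval_intervalIntegral
    (c := a) left_mem_uIcc
  have h2 : AbsolutelyContinuousOnInterval (fun _ : ℝ => u a) a b :=
    (LipschitzWith.const (u a)).lipschitzOnWith.absolutelyContinuousOnInterval
  rw [h.eq_add a]
  exact h2.add h1

theorem ae_hasDerivAt (h : IsPrimitive u p) : ∀ᵐ x, HasDerivAt u (p x) x := by
  filter_upwards [LocallyIntegrable.ae_hasDerivAt_integral h.locallyIntegrable] with x hx
  rw [h.eq_add 0]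
  exact (hx 0).const_add _

/-- The fundamental theorem of calculus for absolutely continuous functions. -/
theorem of_ae_hasDerivAt (hu : ∀ a b, AbsolutelyContinuousOnInterval u a b)
    (hd : ∀ᵐ x, HasDerivAt u (p x) x) : IsPrimitive u p := by
  have hp : deriv u =ᵐ[volume] p := hd.mono fun x hx => hx.deriv
  have hi : ∀ a b, IntervalIntegrable p volume a b := fun a b =>
    (hu a b).intervalIntegrable_deriv.congr_ae (ae_restrict_of_ae hp)
  refine ⟨fun x => ⟨Icc (x - 1) (x + 1), ?_, ?_⟩, fun a b => ?_⟩
  · simp [Icc_mem_nhds (sub_one_lt x) (lt_add_one x)]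
  · exact (intervalIntegrable_iff_integrableOn_Icc_of_le (by linarith)).1 (hi _ _)
  · rw [← (hu a b).integral_deriv_eq_sub]
    exact intervalIntegral.integral_congr_ae (hp.mono fun x hx _ => hx)

theorem congr_ae (h : IsPrimitive u p) (hq : p =ᵐ[volume] q) : IsPrimitive u q :=
  of_ae_hasDerivAt h.absolutelyContinuousOnInterval <| by
    filter_upwards [h.ae_hasDerivAt, hq] with x h1 h2
    rwa [← h2]

theorem of_contDiff (h : ContDiff ℝ 1 u) : IsPrimitive u (deriv u) :=
  of_ae_hasDerivAt (fun _ _ => h.contDiffOn.absolutelyContinuousOnInterval)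
    (ae_of_all _ fun x => (h.differentiable (by simp) x).hasDerivAt)

theorem add (hu : IsPrimitive u p) (hv : IsPrimitive v q) :
    IsPrimitive (fun x => u x + v x) (fun x => p x + q x) :=
  of_ae_hasDerivAt (fun a b => (hu.absolutelyContinuousOnInterval a b).add
      (hv.absolutelyContinuousOnInterval a b)) <| by
    filter_upwards [hu.ae_hasDerivAt, hv.ae_hasDerivAt] with x h1 h2 using h1.add h2

theorem const_mul (c : ℝ) (hu : IsPrimitive u p) :
    IsPrimitive (fun x => c * u x) (fun x => c * p x) :=
  of_ae_hasDerivAt (fun a b => (hu.absolutelyContinuousOnInterval a b).const_mul c) <| by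
    filter_upwards [hu.ae_hasDerivAt] with x h1 using h1.const_mul c

theorem sub (hu : IsPrimitive u p) (hv : IsPrimitive v q) :
    IsPrimitive (fun x => u x - v x) (fun x => p x - q x) := by
  simpa [sub_eq_add_neg] using hu.add (hv.const_mul (-1))

theorem mul (hu : IsPrimitive u p) (hv : IsPrimitive v q) :
    IsPrimitive (fun x => u x * v x) (fun x => p x * v x + u x * q x) :=
  of_ae_hasDerivAt (fun a b => (hu.absolutelyContinuousOnInterval a b).mul
      (hv.absolutelyContinuousOnInterval a b)) <| by
    filter_upwards [hu.ae_hasDerivAt, hv.ae_hasDerivAt] with x h1 h2 using h1.mul h2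

/-- The chain rule. -/
theorem comp (hu : IsPrimitive u p) {H : ℝ → ℝ} (hH : ContDiff ℝ 1 H) :
    IsPrimitive (fun x => H (u x)) (fun x => deriv H (u x) * p x) := by
  refine of_ae_hasDerivAt (fun a b => ?_) ?_
  · obtain ⟨R, hR⟩ := (isCompact_uIcc.image (hu.continuous) :
      IsCompact (u '' uIcc a b)).isBounded.subset_closedBall 0
    obtain ⟨K, hK⟩ := (hH.contDiffOn (s := Metric.closedBall 0 R)).exists_lipschitzOnWith
      (by decide) (convex_closedBall _ _) (isCompact_closedBall _ _)
    exact (hu.absolutelyContinuousOnInterval a b).comp_lipschitzOnWith hK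
      fun x hx => hR (mem_image_of_mem u hx)
  · filter_upwards [hu.ae_hasDerivAt] with x hx
    exact (hH.differentiable (by simp) (u x)).hasDerivAt.comp x hx

theorem tendsto_atTop_of_integrable (h : IsPrimitive u p) (hu : Integrable u)
    (hp : Integrable p) : Tendsto u atTop (𝓝 0) := by
  have h1 : Tendsto u atTop (𝓝 (u 0 + ∫ x in Ioi 0, p x)) := by
    have := (intervalIntegral_tendsto_integral_Ioi 0 hp.integrableOn tendsto_id).const_add (u 0)
    refine this.congr fun x => ?_
    simp only [id]
    rw [← h.sub_eq]
    ring
  have h2 : IntegrableAtFilter u atTop volume := ⟨univ, univ_mem, hu.integrableOn⟩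
  have h3 := h2.eq_zero_of_tendsto (fun s hs => by
    obtain ⟨b, hb⟩ := mem_atTop_sets.1 hs
    rw [← top_le_iff, ← Real.volume_Ici (a := b)]
    exact measure_mono hb) h1
  rwa [h3] at h1

theorem tendsto_atBot_of_integrable (h : IsPrimitive u p) (hu : Integrable u)
    (hp : Integrable p) : Tendsto u atBot (𝓝 0) := by
  have h1 : Tendsto u atBot (𝓝 (u 0 - ∫ x in Iic 0, p x)) := by
    have := (intervalIntegral_tendsto_integral_Iic 0 hp.integrableOn tendsto_id).const_sub (u 0)
    refine this.congr fun x => ?_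
    simp only [id]
    rw [← h.sub_eq]
    ring
  have h2 : IntegrableAtFilter u atBot volume := ⟨univ, univ_mem, hu.integrableOn⟩
  have h3 := h2.eq_zero_of_tendsto (fun s hs => by
    obtain ⟨b, hb⟩ := mem_atBot_sets.1 hs
    rw [← top_le_iff, ← Real.volume_Iic (a := b)]
    exact measure_mono hb) h1
  rwa [h3] at h1

/-- An integrable function vanishes at `-∞`, so it is recovered from its derivative. -/
theorem eq_setIntegral_Iic (h : IsPrimitive u p) (hu : Integrable u) (hp : Integrable p) (x : ℝ) :
    u x = ∫ t in Iic x, p t := by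
  have h1 := intervalIntegral_tendsto_integral_Iic x hp.integrableOn tendsto_id
  have h2 := (h.tendsto_atBot_of_integrable hu hp).const_sub (u x)
  rw [sub_zero] at h2
  refine tendsto_nhds_unique (h2.congr fun y => ?_) h1
  simp only [id]
  rw [← h.sub_eq]

theorem integral_eq_zero (h : IsPrimitive u p) (hu : Integrable u) (hp : Integrable p) :
    ∫ x, p x = 0 := by
  have h1 := intervalIntegral_tendsto_integral hp tendsto_neg_atTop_atBot tendsto_id
  have h2 := (h.tendsto_atTop_of_integrable hu hp).sub
    ((h.tendsto_atBot_of_integrable hu hp).comp tendsto_neg_atTop_atBot)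
  rw [sub_zero] at h2
  refine tendsto_nhds_unique h1 (h2.congr fun y => ?_)
  simp only [id, Function.comp_apply]
  rw [← h.sub_eq]

theorem abs_le_integral_abs (h : IsPrimitive u p) (hu : Integrable u) (hp : Integrable p) (x : ℝ) :
    |u x| ≤ ∫ t, |p t| := by
  rw [h.eq_setIntegral_Iic hu hp x]
  exact (abs_integral_le_integral_abs).trans
    (setIntegral_le_integral hp.abs (ae_of_all _ fun _ => abs_nonneg _))

/-- Integration by parts against a test function. -/
theorem isWeakDeriv (h : IsPrimitive u p) : IsWeakDeriv u p := by
  intro φ hφ hc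
  have hd : Continuous (deriv φ) := hφ.continuous_deriv (by simp)
  have hφ1 : ContDiff ℝ 1 φ := hφ.of_le (by simp)
  have i1 : Integrable (fun x => u x * deriv φ x) :=
    (h.continuous.mul hd).integrable_of_hasCompactSupport hc.deriv.mul_left
  have i2 : Integrable (fun x => p x * φ x) := by
    simpa [smul_eq_mul, mul_comm] using
      h.locallyIntegrable.integrable_smul_left_of_hasCompactSupport hφ.continuous hc
  have i3 : Integrable (fun x => u x * φ x) :=
    (h.continuous.mul hφ.continuous).integrable_of_hasCompactSupport hc.mul_left
  have := (h.mul (of_contDiff hφ1)).integral_eq_zero i3 (i2.add i1)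
  rw [integral_add i2 i1] at this
  linarith

end IsPrimitive

/-! ### Weak derivatives -/

theorem IsWeakDeriv.ae_unique {u v p q : ℝ → ℝ} (hp : LocallyIntegrable p volume)
    (hq : LocallyIntegrable q volume) (hu : IsWeakDeriv u p) (hv : IsWeakDeriv v q)
    (huv : u =ᵐ[volume] v) : p =ᵐ[volume] q := by
  refine ae_eq_of_integral_contDiff_smul_eq hp hq fun φ hφ hc => ?_
  have h1 := hu φ hφ hc
  have h2 := hv φ hφ hc
  have h3 : ∫ x, u x * deriv φ x = ∫ x, v x * deriv φ x :=
    integral_congr_ae (huv.mono fun x hx => by simp only [hx])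
  simp only [smul_eq_mul, mul_comm (φ _)]
  linarith

/-- A primitive of a test function of integral zero is a test function. -/
theorem exists_test_primitive {ψ : ℝ → ℝ} (hψ : ContDiff ℝ ∞ ψ) (hc : HasCompactSupport ψ)
    (h0 : ∫ x, ψ x = 0) : ∃ φ : ℝ → ℝ, ContDiff ℝ ∞ φ ∧ HasCompactSupport φ ∧ deriv φ = ψ := by
  obtain ⟨R, hR⟩ := hc.isCompact.isBounded.subset_closedBall 0
  have hz : ∀ x, R < |x| → ψ x = 0 := fun x hx => by
    by_contra hne
    have := hR (subset_tsupport ψ hne)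
    simp only [Metric.mem_closedBall, dist_zero_right, Real.norm_eq_abs] at this
    linarith
  have hi : Integrable ψ := hψ.continuous.integrable_of_hasCompactSupport hc
  have hz' : ∀ x, R < |x| → ∫ t in Iic x, ψ t = 0 := fun x hx => by
    rcases le_total 0 x with h | h
    · rw [abs_of_nonneg h] at hx
      rw [← intervalIntegral.integral_Iic_add_Ioi hi.integrableOn hi.integrableOn (b := x)] at h0
      rw [setIntegral_eq_zero_of_forall_eq_zero (t := Ioi x), add_zero] at h0
      · exact h0
      · intro t ht
        exact hz t (by rw [abs_of_nonneg (h.trans (le_of_lt ht))]; exact hx.trans ht)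
    · rw [abs_of_nonpos h] at hx
      refine setIntegral_eq_zero_of_forall_eq_zero fun t ht => hz t ?_
      have ht : t ≤ x := ht
      rw [abs_of_nonpos (ht.trans h)]
      linarith
  have hd : ∀ x, HasDerivAt (fun x => ∫ t in Iic x, ψ t) (ψ x) x := fun x => by
    have : (fun x => ∫ t in Iic x, ψ t) = fun x => (∫ t in Iic 0, ψ t) + ∫ t in (0 : ℝ)..x, ψ t := by
      ext x
      rw [← intervalIntegral.integral_Iic_sub_Iic hi.integrableOn hi.integrableOn]
      ring
    rw [this]
    exact (intervalIntegral.integral_hasDerivAt_right (hi.intervalIntegrable)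
      (hψ.continuous.stronglyMeasurableAtFilter _ _) hψ.continuous.continuousAt).const_add _
  have hd' : deriv (fun x => ∫ t in Iic x, ψ t) = ψ := funext fun x => (hd x).deriv
  refine ⟨_, ?_, ?_, hd'⟩
  · rw [contDiff_infty_iff_deriv, hd']
    exact ⟨fun x => (hd x).differentiableAt, hψ⟩
  · refine HasCompactSupport.intro (isCompact_closedBall (0 : ℝ) R) fun x hx => hz' x ?_
    simpa using hx

/-- The lemma of du Bois-Reymond. -/
theorem ae_eq_const_of_integral_mul_deriv_eq_zero {z : ℝ → ℝ} (hz : LocallyIntegrable z volume)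
    (h : ∀ φ : ℝ → ℝ, ContDiff ℝ ∞ φ → HasCompactSupport φ → ∫ x, z x * deriv φ x = 0) :
    ∃ c, ∀ᵐ x, z x = c := by
  let b : ContDiffBump (0 : ℝ) := ⟨1, 2, one_pos, one_lt_two⟩
  let η : ℝ → ℝ := b.normed volume
  have hη : ContDiff ℝ ∞ η := b.contDiff_normed
  have hηc : HasCompactSupport η := b.hasCompactSupport_normed
  have hη1 : ∫ x, η x = 1 := b.integral_normed
  have hint : ∀ ψ : ℝ → ℝ, Continuous ψ → HasCompactSupport ψ → Integrable fun x => ψ x * z x :=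
    fun ψ h1 h2 => hz.integrable_smul_left_of_hasCompactSupport h1 h2
  refine ⟨∫ x, η x * z x, ?_⟩
  refine ae_eq_of_integral_contDiff_smul_eq hz (locallyIntegrable_const _) fun ψ hψ hc => ?_
  have i1 := hψ.continuous.integrable_of_hasCompactSupport (μ := volume) hc
  have i2 := hη.continuous.integrable_of_hasCompactSupport (μ := volume) hηc
  obtain ⟨φ, hφ, hφc, hφd⟩ := exists_test_primitive (ψ := fun x => ψ x - (∫ t, ψ t) * η x)
    (hψ.sub (contDiff_const.mul hη))
    (hc.sub (f := ψ) (f' := fun x => (∫ t, ψ t) * η x) hηc.mul_left) (by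
      rw [integral_sub i1 (i2.const_mul _), integral_const_mul, hη1]; ring)
  have h1 := h φ hφ hφc
  rw [hφd] at h1
  have h2 : (fun x => z x * (ψ x - (∫ t, ψ t) * η x))
      = fun x => ψ x * z x - (∫ t, ψ t) * (η x * z x) := by ext x; ring
  rw [h2, integral_sub (hint _ hψ.continuous hc) ((hint _ hη.continuous hηc).const_mul _),
    integral_const_mul] at h1
  simp only [smul_eq_mul]
  rw [integral_mul_const]
  linarith

/-- A function with a weak derivative has a locally absolutely continuous representative. -/
theorem IsWeakDeriv.exists_isPrimitive {u p : ℝ → ℝ} (hu : LocallyIntegrable u volume)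
    (hp : LocallyIntegrable p volume) (h : IsWeakDeriv u p) :
    ∃ v, IsPrimitive v p ∧ u =ᵐ[volume] v := by
  have h1 := IsPrimitive.of_integral hp 0
  set w : ℝ → ℝ := fun x => ∫ t in (0 : ℝ)..x, p t with hw
  have hwl : LocallyIntegrable w volume := h1.continuous.locallyIntegrable
  have hint : ∀ s ψ : ℝ → ℝ, LocallyIntegrable s volume → Continuous ψ → HasCompactSupport ψ →
      Integrable fun x => s x * ψ x := fun s ψ h0 h1 h2 => by
    simpa [mul_comm] using h0.integrable_smul_left_of_hasCompactSupport h1 h2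
  obtain ⟨c, hc⟩ := ae_eq_const_of_integral_mul_deriv_eq_zero (hu.sub hwl) fun φ hφ hφc => by
    have hd : Continuous (deriv φ) := hφ.continuous_deriv (by simp)
    have e1 := h φ hφ hφc
    have e2 := h1.isWeakDeriv φ hφ hφc
    have e3 : (fun x => (u - w) x * deriv φ x) = fun x => u x * deriv φ x - w x * deriv φ x := by
      ext x; simp [sub_mul]
    rw [e3, integral_sub (hint _ _ hu hd hφc.deriv) (hint _ _ hwl hd hφc.deriv), e1, e2, sub_self]
  refine ⟨fun x => w x + c, ⟨hp, fun a b => ?_⟩, ?_⟩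
  · rw [← h1.sub_eq a b]
    ring
  · filter_upwards [hc] with x hx
    simp only [Pi.sub_apply] at hx
    linarith

/-! ### Bounds in `L²` -/

/-- `f` is square integrable with `L²` norm at most `K`. -/
structure L2Le (f : ℝ → ℝ) (K : ℝ) : Prop where
  memLp : MemLp f 2 volume
  le : (eLpNorm f 2 volume).toReal ≤ K

namespace L2Le

variable {f g m : ℝ → ℝ} {K L B : ℝ}

theorem nonneg (h : L2Le f K) : 0 ≤ K := ENNReal.toReal_nonneg.trans h.le

theorem aesm (h : L2Le f K) : AEStronglyMeasurable f volume := h.memLp.aestronglyMeasurable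

theorem weaken (h : L2Le f K) (hK : K ≤ L) : L2Le f L := ⟨h.memLp, h.le.trans hK⟩

theorem mono_ae (h : L2Le g K) (hf : AEStronglyMeasurable f volume)
    (hfg : ∀ᵐ x, |f x| ≤ g x) : L2Le f K := by
  have h1 : ∀ᵐ x, ‖f x‖ ≤ ‖g x‖ := hfg.mono fun x hx => by
    simpa only [Real.norm_eq_abs] using hx.trans (le_abs_self _)
  exact ⟨h.memLp.mono hf h1,
    (ENNReal.toReal_mono h.memLp.eLpNorm_ne_top (eLpNorm_mono_ae h1)).trans h.le⟩

theorem congr_ae (h : L2Le g K) (hfg : f =ᵐ[volume] g) : L2Le f K :=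
  ⟨h.memLp.ae_eq hfg.symm, by rw [eLpNorm_congr_ae hfg]; exact h.le⟩

theorem add (hf : L2Le f K) (hg : L2Le g L) : L2Le (fun x => f x + g x) (K + L) := by
  refine ⟨hf.memLp.add hg.memLp, ?_⟩
  have := eLpNorm_add_le hf.aesm hg.aesm (p := 2) (by norm_num)
  refine (ENNReal.toReal_mono (by
    simp [hf.memLp.eLpNorm_ne_top, hg.memLp.eLpNorm_ne_top]) this).trans ?_
  rw [ENNReal.toReal_add hf.memLp.eLpNorm_ne_top hg.memLp.eLpNorm_ne_top]
  exact add_le_add hf.le hg.le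

theorem const_mul (c : ℝ) (hf : L2Le f K) : L2Le (fun x => c * f x) (|c| * K) := by
  refine ⟨hf.memLp.const_mul c, ?_⟩
  have : eLpNorm (fun x => c * f x) 2 volume = ‖c‖ₑ * eLpNorm f 2 volume :=
    eLpNorm_const_smul c f 2 volume
  rw [this, ENNReal.toReal_mul]
  simp only [toReal_enorm, Real.norm_eq_abs]
  exact mul_le_mul_of_nonneg_left hf.le (abs_nonneg c)

theorem abs (hf : L2Le f K) : L2Le (fun x => |f x|) K :=
  ⟨hf.memLp.norm, by
    have : eLpNorm (fun x => |f x|) 2 volume = eLpNorm f 2 volume := eLpNorm_norm f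
    rw [this]; exact hf.le⟩

theorem bdd_mul (hf : L2Le f K) (hm : AEStronglyMeasurable m volume) (hB : ∀ᵐ x, |m x| ≤ B) :
    L2Le (fun x => m x * f x) (|B| * K) := by
  refine (hf.abs.const_mul |B|).mono_ae (hm.mul hf.aesm) ?_ |>.weaken (by rw [abs_abs])
  filter_upwards [hB] with x hx
  rw [Pi.mul_apply, abs_mul]
  exact mul_le_mul_of_nonneg_right (hx.trans (le_abs_self B)) (abs_nonneg _)

theorem sq_toReal_eLpNorm (hf : MemLp f 2 volume) :
    (eLpNorm f 2 volume).toReal ^ 2 = ∫ x, f x ^ 2 := by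
  rw [hf.eLpNorm_eq_integral_rpow_norm (by norm_num) (by norm_num), ENNReal.toReal_ofReal
    (by positivity)]
  simp only [ENNReal.toReal_ofNat, Real.rpow_two, Real.norm_eq_abs, sq_abs]
  rw [← one_div, ← Real.sqrt_eq_rpow, Real.sq_sqrt (integral_nonneg fun x => sq_nonneg _)]

theorem integrable_sq (hf : L2Le f K) : Integrable fun x => f x ^ 2 := hf.memLp.integrable_sq

theorem integral_sq_le (hf : L2Le f K) : ∫ x, f x ^ 2 ≤ K ^ 2 := by
  rw [← sq_toReal_eLpNorm hf.memLp]
  exact pow_le_pow_left₀ ENNReal.toReal_nonneg hf.le 2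

theorem of_integral_sq (hf : AEStronglyMeasurable f volume) (hi : Integrable fun x => f x ^ 2)
    (hK : 0 ≤ K) (h : ∫ x, f x ^ 2 ≤ K ^ 2) : L2Le f K := by
  have hm := (memLp_two_iff_integrable_sq hf).2 hi
  refine ⟨hm, ?_⟩
  rw [← sq_toReal_eLpNorm hm] at h
  exact abs_le_of_sq_le_sq h hK |> (le_abs_self _).trans

theorem integrable_mul (hf : L2Le f K) (hg : L2Le g L) : Integrable fun x => f x * g x :=
  hf.memLp.integrable_mul hg.memLp

/-- The Cauchy-Schwarz inequality. -/
theorem integral_mul_le (hf : L2Le f K) (hg : L2Le g L) : ∫ x, |f x * g x| ≤ K * L := by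
  have h := integral_mul_norm_le_Lp_mul_Lq (p := 2) (q := 2) (μ := volume) (f := f) (g := g)
    (by constructor <;> norm_num) (by simpa using hf.memLp) (by simpa using hg.memLp)
  simp only [Real.norm_eq_abs, Real.rpow_two, sq_abs, ← Real.sqrt_eq_rpow] at h
  simp only [abs_mul]
  refine h.trans (mul_le_mul ?_ ?_ (Real.sqrt_nonneg _) hf.nonneg)
  · exact Real.sqrt_le_iff.2 ⟨hf.nonneg, hf.integral_sq_le⟩
  · exact Real.sqrt_le_iff.2 ⟨hg.nonneg, hg.integral_sq_le⟩

end L2Le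

/-! ### Averages against an exponential -/

/-- The convolution of `D` with `exp (-c |·|)`. -/
noncomputable def expAvg (c : ℝ) (D : ℝ → ℝ) (Z : ℝ) : ℝ := ∫ Z', Real.exp (-(c * |Z' - Z|)) * D Z'

/-- The `L¹` norm of `exp (-c |·|)`. -/
noncomputable def expMass (c : ℝ) : ℝ := ∫ x, Real.exp (-(c * |x|))

theorem integrable_exp_neg_mul_abs {c : ℝ} (hc : 0 < c) :
    Integrable fun x : ℝ => Real.exp (-(c * |x|)) := by
  rw [← integrableOn_univ, ← Iic_union_Ioi (a := (0 : ℝ)), integrableOn_union]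
  constructor
  · refine (integrableOn_exp_mul_Iic hc 0).congr_fun (fun x hx => ?_) measurableSet_Iic
    have hx : x ≤ 0 := hx
    simp only [abs_of_nonpos hx]
    ring_nf
  · refine (exp_neg_integrableOn_Ioi 0 hc).congr_fun (fun x hx => ?_) measurableSet_Ioi
    have hx : 0 < x := hx
    simp only [abs_of_pos hx]
    ring_nf

theorem expMass_pos {c : ℝ} (hc : 0 < c) : 0 < expMass c :=
  integral_exp_pos (integrable_exp_neg_mul_abs hc)

section expAvg

variable {c : ℝ} {D D' : ℝ → ℝ} {K : ℝ}

theorem integrable_exp_sub (hc : 0 < c) (Z : ℝ) :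
    Integrable fun Z' => Real.exp (-(c * |Z' - Z|)) :=
  (integrable_exp_neg_mul_abs hc).comp_sub_right Z

theorem integrable_expAvg (hc : 0 < c) (hD : MemLp D 2 volume) (Z : ℝ) :
    Integrable fun Z' => Real.exp (-(c * |Z' - Z|)) * D Z' := by
  have h1 : MemLp (fun Z' => Real.exp (-(c * |Z' - Z|))) 2 volume := by
    rw [memLp_two_iff_integrable_sq (by fun_prop)]
    refine (integrable_exp_sub (c := 2 * c) (by positivity) Z).congr (ae_of_all _ fun x => ?_)
    simp only [← Real.exp_nat_mul]
    congr 1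
    push_cast
    ring
  exact h1.integrable_mul hD

theorem integrable_exp_mul_sq (hD : MemLp D 2 volume) (hc : 0 < c) (Z : ℝ) :
    Integrable fun Z' => Real.exp (-(c * |Z' - Z|)) * D Z' ^ 2 := by
  refine hD.integrable_sq.bdd_mul (c := 1) (by fun_prop) (ae_of_all _ fun x => ?_)
  rw [Real.norm_eq_abs, abs_of_pos (Real.exp_pos _), Real.exp_le_one_iff]
  have := mul_nonneg hc.le (abs_nonneg (x - Z))
  linarith

/-- The weighted Cauchy-Schwarz inequality, as positivity of a variance. -/
theorem expAvg_sq_le (hc : 0 < c) (hD : MemLp D 2 volume) (Z : ℝ) :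
    expAvg c D Z ^ 2 ≤ expMass c * ∫ Z', Real.exp (-(c * |Z' - Z|)) * D Z' ^ 2 := by
  have hA := expMass_pos hc
  have hm : ∫ Z', Real.exp (-(c * |Z' - Z|)) = expMass c :=
    integral_sub_right_eq_self (fun x => Real.exp (-(c * |x|))) Z
  set m := expAvg c D Z with hmdef
  have i0 := integrable_exp_sub hc Z
  have i1 := integrable_expAvg hc hD Z
  have i2 := integrable_exp_mul_sq hD hc Z
  have h0 : 0 ≤ ∫ Z', Real.exp (-(c * |Z' - Z|)) * (D Z' - m / expMass c) ^ 2 :=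
    integral_nonneg fun _ => by positivity
  have e : (fun Z' => Real.exp (-(c * |Z' - Z|)) * (D Z' - m / expMass c) ^ 2) = fun Z' =>
      (Real.exp (-(c * |Z' - Z|)) * D Z' ^ 2
        - (2 * (m / expMass c)) * (Real.exp (-(c * |Z' - Z|)) * D Z'))
        + (m / expMass c) ^ 2 * Real.exp (-(c * |Z' - Z|)) := by
    ext x; ring
  rw [e, integral_add (f := fun Z' => _ - _) (i2.sub (i1.const_mul _)) (i0.const_mul _),
    integral_sub i2 (i1.const_mul _), integral_const_mul, integral_const_mul, hm] at h0
  change 0 ≤ _ - 2 * (m / expMass c) * m + _ at h0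
  have e2 : (m / expMass c) ^ 2 * expMass c = m ^ 2 / expMass c := by field_simp
  have e3 : 2 * (m / expMass c) * m = 2 * (m ^ 2 / expMass c) := by ring
  rw [e2, e3] at h0
  have : m ^ 2 / expMass c ≤ ∫ Z', Real.exp (-(c * |Z' - Z|)) * D Z' ^ 2 := by linarith
  rwa [div_le_iff₀ hA, mul_comm] at this

theorem abs_expAvg_le (hc : 0 < c) (hD : L2Le D K) (Z : ℝ) :
    |expAvg c D Z| ≤ (expMass c + 1) * K := by
  have hA := expMass_pos hc
  refine abs_le_of_sq_le_sq ?_ (mul_nonneg (by positivity) hD.nonneg)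
  calc expAvg c D Z ^ 2 ≤ expMass c * ∫ Z', Real.exp (-(c * |Z' - Z|)) * D Z' ^ 2 :=
        expAvg_sq_le hc hD.memLp Z
    _ ≤ expMass c * ∫ Z', D Z' ^ 2 := by
        refine mul_le_mul_of_nonneg_left ?_ hA.le
        refine integral_mono (integrable_exp_mul_sq hD.memLp hc Z) hD.integrable_sq fun x => ?_
        refine mul_le_of_le_one_left (sq_nonneg _) ?_
        rw [Real.exp_le_one_iff]
        have := mul_nonneg hc.le (abs_nonneg (x - Z))
        linarith
    _ ≤ expMass c * K ^ 2 := mul_le_mul_of_nonneg_left hD.integral_sq_le hA.le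
    _ ≤ ((expMass c + 1) * K) ^ 2 := by
        nlinarith [mul_nonneg hA.le (sq_nonneg K), sq_nonneg K,
          mul_nonneg (mul_nonneg hA.le hA.le) (sq_nonneg K)]

theorem aestronglyMeasurable_expAvg (hD : AEStronglyMeasurable D volume) :
    AEStronglyMeasurable (expAvg c D) volume := by
  have h : AEStronglyMeasurable (fun z : ℝ × ℝ => Real.exp (-(c * |z.2 - z.1|)) * D z.2)
      (volume.prod volume) :=
    (Continuous.aestronglyMeasurable (by fun_prop)).mul hD.comp_snd
  exact h.integral_prod_right'

/-- Young's inequality for the convolution of `L¹` and `L²`. -/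
theorem L2Le.expAvg (hc : 0 < c) (hD : L2Le D K) :
    L2Le (expAvg c D) ((expMass c + 1) * K) := by
  have hA := expMass_pos hc
  have hD2 := hD.integrable_sq
  have he := integrable_exp_neg_mul_abs hc
  have hconv : ∀ Z, convolution (fun t => D t ^ 2) (fun t => Real.exp (-(c * |t|)))
      (ContinuousLinearMap.mul ℝ ℝ) volume Z = ∫ Z', Real.exp (-(c * |Z' - Z|)) * D Z' ^ 2 :=
    fun Z => by
      refine integral_congr_ae (ae_of_all _ fun t => ?_)
      simp only [ContinuousLinearMap.mul_apply', abs_sub_comm Z t]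
      ring
  have hi : Integrable fun Z => ∫ Z', Real.exp (-(c * |Z' - Z|)) * D Z' ^ 2 :=
    (hD2.integrable_convolution (ContinuousLinearMap.mul ℝ ℝ) he).congr
      (ae_of_all _ hconv)
  have hint : ∫ Z, ∫ Z', Real.exp (-(c * |Z' - Z|)) * D Z' ^ 2 = (∫ t, D t ^ 2) * expMass c := by
    have := integral_convolution (ContinuousLinearMap.mul ℝ ℝ) hD2 he
    simp only [hconv] at this
    exact this
  have hmeas := aestronglyMeasurable_expAvg (c := c) hD.aesm
  have hsq : Integrable fun Z => DispersiveWave.expAvg c D Z ^ 2 :=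
    (hi.const_mul (expMass c)).mono' (hmeas.pow 2) (ae_of_all _ fun Z => by
      rw [Real.norm_eq_abs, abs_of_nonneg (sq_nonneg _)]
      exact expAvg_sq_le hc hD.memLp Z)
  refine L2Le.of_integral_sq hmeas hsq (mul_nonneg (by positivity) hD.nonneg) ?_
  calc ∫ Z, DispersiveWave.expAvg c D Z ^ 2
      ≤ ∫ Z, expMass c * ∫ Z', Real.exp (-(c * |Z' - Z|)) * D Z' ^ 2 :=
        integral_mono hsq (hi.const_mul _) fun Z => expAvg_sq_le hc hD.memLp Z
    _ = expMass c * ((∫ t, D t ^ 2) * expMass c) := by rw [integral_const_mul, hint]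
    _ ≤ expMass c * (K ^ 2 * expMass c) := by
        gcongr
        exact hD.integral_sq_le
    _ ≤ ((expMass c + 1) * K) ^ 2 := by
        nlinarith [mul_nonneg hA.le (sq_nonneg K), sq_nonneg K]

theorem expAvg_nonneg (hD : ∀ᵐ x, 0 ≤ D x) (Z : ℝ) : 0 ≤ expAvg c D Z :=
  integral_nonneg_of_ae (hD.mono fun _ hx => mul_nonneg (Real.exp_pos _).le hx)

theorem expAvg_mono (hc : 0 < c) (hD : MemLp D 2 volume) (hD' : MemLp D' 2 volume)
    (h : ∀ᵐ x, D x ≤ D' x) (Z : ℝ) : expAvg c D Z ≤ expAvg c D' Z :=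
  integral_mono_ae (integrable_expAvg hc hD Z) (integrable_expAvg hc hD' Z)
    (h.mono fun _ hx => mul_le_mul_of_nonneg_left hx (Real.exp_pos _).le)

theorem expAvg_const_mul (k : ℝ) (Z : ℝ) : expAvg c (fun x => k * D x) Z = k * expAvg c D Z := by
  unfold expAvg
  rw [← integral_const_mul]
  congr 1
  ext x
  ring

end expAvg

/-! ### The kernel with a variable weight -/

/-- `exp (-|∫_Z^{Z'} a|) h(Z')`. With `a = v cos² (w / 2)` and
`h = (g(u) cos² (w / 2) + (f''(u) / 2) sin² (w / 2)) v` it is the integrand of the nonlocal terms. -/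
noncomputable def weightedKernel (a h : ℝ → ℝ) (Z Z' : ℝ) : ℝ :=
  Real.exp (-|∫ s in Z..Z', a s|) * h Z'

/-- The part of the nonlocal terms to the right of `Z`. -/
noncomputable def rightPart (a h : ℝ → ℝ) (Z : ℝ) : ℝ := ∫ Z' in Ioi Z, weightedKernel a h Z Z'

/-- The part of the nonlocal terms to the left of `Z`. -/
noncomputable def leftPart (a h : ℝ → ℝ) (Z : ℝ) : ℝ := ∫ Z' in Iic Z, weightedKernel a h Z Z'

/-- The weight `a` is nonnegative and its integrals grow at least linearly, with slope `c > 0` and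
defect `M`. -/
structure IsWeight (c M : ℝ) (a : ℝ → ℝ) : Prop where
  pos : 0 < c
  locallyIntegrable : LocallyIntegrable a volume
  nonneg : ∀ᵐ x, 0 ≤ a x
  growth : ∀ x y, x ≤ y → c * (y - x) - M ≤ ∫ s in x..y, a s

namespace IsWeight

variable {c M δ : ℝ} {a b h k : ℝ → ℝ}

theorem integral_nonneg (ha : IsWeight c M a) {x y : ℝ} (hxy : x ≤ y) : 0 ≤ ∫ s in x..y, a s :=
  intervalIntegral.integral_nonneg_of_ae hxy ha.nonneg

theorem growth_abs (ha : IsWeight c M a) (Z Z' : ℝ) :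
    c * |Z' - Z| - M ≤ |∫ s in Z..Z', a s| := by
  rcases le_total Z Z' with h | h
  · rw [abs_of_nonneg (sub_nonneg.2 h)]
    exact (ha.growth _ _ h).trans (le_abs_self _)
  · rw [abs_of_nonpos (sub_nonpos.2 h), intervalIntegral.integral_symm, abs_neg, neg_sub]
    exact (ha.growth _ _ h).trans (le_abs_self _)

theorem exp_le (ha : IsWeight c M a) (Z Z' : ℝ) :
    Real.exp (-|∫ s in Z..Z', a s|) ≤ Real.exp M * Real.exp (-(c * |Z' - Z|)) := by
  rw [← Real.exp_add, Real.exp_le_exp]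
  linarith [ha.growth_abs Z Z']

theorem continuous_integral (ha : IsWeight c M a) (Z : ℝ) :
    Continuous fun Z' => ∫ s in Z..Z', a s :=
  (IsPrimitive.of_integral ha.locallyIntegrable Z).continuous

theorem integrable (ha : IsWeight c M a) (hh : MemLp h 2 volume) (Z : ℝ) :
    Integrable (weightedKernel a h Z) := by
  refine ((integrable_expAvg ha.pos hh Z).norm.const_mul (Real.exp M)).mono' ?_
    (ae_of_all _ fun Z' => ?_)
  · exact (Real.continuous_exp.comp (ha.continuous_integral Z).abs.neg).aestronglyMeasurable.mul
      hh.aestronglyMeasurable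
  · unfold weightedKernel
    rw [norm_mul, norm_mul, ← mul_assoc]
    refine mul_le_mul_of_nonneg_right ?_ (norm_nonneg _)
    simp only [Real.norm_eq_abs, abs_of_pos (Real.exp_pos _)]
    exact ha.exp_le Z Z'

theorem integral_eq (ha : IsWeight c M a) (hh : MemLp h 2 volume) (Z : ℝ) :
    ∫ Z', weightedKernel a h Z Z' = leftPart a h Z + rightPart a h Z :=
  (intervalIntegral.integral_Iic_add_Ioi (ha.integrable hh Z).integrableOn
    (ha.integrable hh Z).integrableOn).symm

theorem abs_parts_le_integral (ha : IsWeight c M a) (hh : MemLp h 2 volume) (Z : ℝ) :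
    |leftPart a h Z| + |rightPart a h Z| ≤ ∫ Z', |weightedKernel a h Z Z'| := by
  have hi := (ha.integrable hh Z).abs
  rw [← intervalIntegral.integral_Iic_add_Ioi (b := Z) hi.integrableOn hi.integrableOn]
  exact add_le_add abs_integral_le_integral_abs abs_integral_le_integral_abs

/-- The nonlocal terms are dominated by an average against an exponential. -/
theorem abs_parts_le (ha : IsWeight c M a) (hh : MemLp h 2 volume) (Z : ℝ) :
    |leftPart a h Z| + |rightPart a h Z| ≤ Real.exp M * expAvg c (fun x => |h x|) Z := by
  refine (ha.abs_parts_le_integral hh Z).trans ?_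
  unfold expAvg
  rw [← integral_const_mul]
  refine integral_mono (ha.integrable hh Z).abs
    ((integrable_expAvg ha.pos hh.norm Z).const_mul _) fun Z' => ?_
  simp only [weightedKernel, abs_mul, abs_of_pos (Real.exp_pos _), ← mul_assoc]
  exact mul_le_mul_of_nonneg_right (ha.exp_le Z Z') (abs_nonneg _)

theorem abs_exp_sub_exp_le {x y m : ℝ} (hx : m ≤ x) (hy : m ≤ y) :
    |Real.exp (-x) - Real.exp (-y)| ≤ Real.exp (-m) * |x - y| := by
  wlog hxy : x ≤ y generalizing x y
  · rw [abs_sub_comm, abs_sub_comm x]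
    exact this hy hx (le_of_not_ge hxy)
  have h1 : Real.exp (-y) ≤ Real.exp (-x) := Real.exp_le_exp.2 (by linarith)
  rw [abs_of_nonneg (by linarith), abs_of_nonpos (by linarith)]
  have h2 : Real.exp (-y) = Real.exp (-x) * Real.exp (-(y - x)) := by
    rw [← Real.exp_add]; congr 1; ring
  have h3 := Real.add_one_le_exp (-(y - x))
  calc Real.exp (-x) - Real.exp (-y) = Real.exp (-x) * (1 - Real.exp (-(y - x))) := by
        rw [h2]; ring
    _ ≤ Real.exp (-x) * (y - x) := mul_le_mul_of_nonneg_left (by linarith) (Real.exp_pos _).le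
    _ ≤ Real.exp (-m) * (y - x) :=
        mul_le_mul_of_nonneg_right (Real.exp_le_exp.2 (by linarith)) (by linarith)
    _ = Real.exp (-m) * -(x - y) := by ring

/-- Part of the exponential decay pays for the linear growth of the difference of the exponents. -/
theorem abs_exp_sub_le (ha : IsWeight c M a) (hb : IsWeight c M b)
    (hab : ∀ᵐ x, |a x - b x| ≤ δ) (Z Z' : ℝ) :
    |Real.exp (-|∫ s in Z..Z', a s|) - Real.exp (-|∫ s in Z..Z', b s|)|
      ≤ (2 / c * Real.exp M) * δ * Real.exp (-(c / 2 * |Z' - Z|)) := by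
  have hδ : 0 ≤ δ := by
    obtain ⟨x, hx⟩ := hab.exists
    exact (abs_nonneg _).trans hx
  have h1 : |(∫ s in Z..Z', a s) - ∫ s in Z..Z', b s| ≤ δ * |Z' - Z| := by
    rw [← intervalIntegral.integral_sub (ha.locallyIntegrable.intervalIntegrable _ _)
      (hb.locallyIntegrable.intervalIntegrable _ _)]
    exact intervalIntegral.norm_integral_le_of_norm_le_const_ae (f := fun s => a s - b s)
      (hab.mono fun x hx _ => hx)
  have h2 := abs_exp_sub_exp_le (ha.growth_abs Z Z') (hb.growth_abs Z Z')
  have h3 := (abs_abs_sub_abs_le (∫ s in Z..Z', a s) (∫ s in Z..Z', b s)).trans h1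
  have hc := ha.pos
  have h4 : c / 2 * |Z' - Z| ≤ Real.exp (c / 2 * |Z' - Z|) :=
    (by linarith : c / 2 * |Z' - Z| ≤ c / 2 * |Z' - Z| + 1).trans (Real.add_one_le_exp _)
  have h5 : Real.exp (-(c * |Z' - Z| - M))
      = Real.exp M * Real.exp (-(c / 2 * |Z' - Z|)) * Real.exp (-(c / 2 * |Z' - Z|)) := by
    rw [← Real.exp_add, ← Real.exp_add]; congr 1; ring
  have h6 : Real.exp (-(c / 2 * |Z' - Z|)) * (c / 2 * |Z' - Z|) ≤ 1 := by
    rw [Real.exp_neg, inv_mul_le_iff₀ (Real.exp_pos _), mul_one]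
    exact h4
  calc _ ≤ Real.exp (-(c * |Z' - Z| - M)) * (δ * |Z' - Z|) :=
        h2.trans (mul_le_mul_of_nonneg_left h3 (Real.exp_pos _).le)
    _ = (2 / c * Real.exp M) * δ * Real.exp (-(c / 2 * |Z' - Z|))
        * (Real.exp (-(c / 2 * |Z' - Z|)) * (c / 2 * |Z' - Z|)) := by
        rw [h5]; field_simp
    _ ≤ _ := mul_le_of_le_one_right (by positivity) h6

/-- Lipschitz dependence of the nonlocal terms on the weight and on the density. -/
theorem abs_parts_sub_le (ha : IsWeight c M a) (hb : IsWeight c M b)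
    (hab : ∀ᵐ x, |a x - b x| ≤ δ) (hh : MemLp h 2 volume) (hk : MemLp k 2 volume) (Z : ℝ) :
    |leftPart a h Z - leftPart b k Z| + |rightPart a h Z - rightPart b k Z|
      ≤ (2 / c + 1) * Real.exp M * expAvg (c / 2) (fun x => |h x - k x| + δ * |k x|) Z := by
  have hc := ha.pos
  have hδ : 0 ≤ δ := by
    obtain ⟨x, hx⟩ := hab.exists
    exact (abs_nonneg _).trans hx
  have i1 := ha.integrable hh Z
  have i2 := hb.integrable hk Z
  have hi : Integrable fun Z' => |weightedKernel a h Z Z' - weightedKernel b k Z Z'| :=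
    (i1.sub i2).abs
  have hD : MemLp (fun x => |h x - k x| + δ * |k x|) 2 volume :=
    (hh.sub hk).norm.add (hk.norm.const_mul δ)
  calc _ ≤ ∫ Z', |weightedKernel a h Z Z' - weightedKernel b k Z Z'| := by
        rw [← intervalIntegral.integral_Iic_add_Ioi (b := Z) hi.integrableOn hi.integrableOn]
        refine add_le_add ?_ ?_
        · rw [leftPart, leftPart, ← integral_sub i1.integrableOn i2.integrableOn]
          exact abs_integral_le_integral_abs
        · rw [rightPart, rightPart, ← integral_sub i1.integrableOn i2.integrableOn]
          exact abs_integral_le_integral_abs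
    _ ≤ _ := by
        unfold expAvg
        rw [← integral_const_mul]
        refine integral_mono hi ((integrable_expAvg (by positivity) hD Z).const_mul _)
          fun Z' => ?_
        simp only [weightedKernel]
        set A := Real.exp (-|∫ s in Z..Z', a s|)
        set B := Real.exp (-|∫ s in Z..Z', b s|)
        have h1 : |A - B| ≤ (2 / c * Real.exp M) * δ * Real.exp (-(c / 2 * |Z' - Z|)) :=
          abs_exp_sub_le ha hb hab Z Z'
        have h2 : A ≤ Real.exp M * Real.exp (-(c / 2 * |Z' - Z|)) := by
          refine (ha.exp_le Z Z').trans (mul_le_mul_of_nonneg_left ?_ (Real.exp_pos _).le)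
          rw [Real.exp_le_exp]
          have := mul_nonneg hc.le (abs_nonneg (Z' - Z))
          linarith
        have h0 : 0 ≤ A := (Real.exp_pos _).le
        set e := Real.exp (-(c / 2 * |Z' - Z|))
        have he : 0 < e := Real.exp_pos _
        have hM := Real.exp_pos M
        have hcc : 0 < 2 / c := by positivity
        calc |A * h Z' - B * k Z'| = |A * (h Z' - k Z') + (A - B) * k Z'| := by congr 1; ring
          _ ≤ A * |h Z' - k Z'| + |A - B| * |k Z'| := by
              refine (abs_add_le _ _).trans ?_
              rw [abs_mul, abs_mul, abs_of_nonneg h0]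
          _ ≤ Real.exp M * e * |h Z' - k Z'| + (2 / c * Real.exp M) * δ * e * |k Z'| := by gcongr
          _ ≤ (2 / c + 1) * Real.exp M * (e * (|h Z' - k Z'| + δ * |k Z'|)) := by
              have p1 : 0 ≤ 2 / c * (Real.exp M * e * |h Z' - k Z'|) := by positivity
              have p2 : 0 ≤ Real.exp M * e * (δ * |k Z'|) := by positivity
              nlinarith

/-! Both parts are absolutely continuous and solve a linear system of ordinary differential
equations in `Z`. -/

theorem exp_right (ha : IsWeight c M a) {Z Z' : ℝ} (hZ : Z ≤ Z') :
    Real.exp (-|∫ s in Z..Z', a s|)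
      = Real.exp (∫ s in (0 : ℝ)..Z, a s) * Real.exp (-∫ s in (0 : ℝ)..Z', a s) := by
  rw [abs_of_nonneg (ha.integral_nonneg hZ), ← Real.exp_add,
    ← intervalIntegral.integral_interval_sub_left
      (ha.locallyIntegrable.intervalIntegrable 0 Z') (ha.locallyIntegrable.intervalIntegrable 0 Z)]
  congr 1; ring

theorem exp_left (ha : IsWeight c M a) {Z Z' : ℝ} (hZ : Z' ≤ Z) :
    Real.exp (-|∫ s in Z..Z', a s|)
      = Real.exp (-∫ s in (0 : ℝ)..Z, a s) * Real.exp (∫ s in (0 : ℝ)..Z', a s) := by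
  rw [intervalIntegral.integral_symm, abs_neg, abs_of_nonneg (ha.integral_nonneg hZ),
    ← Real.exp_add, ← intervalIntegral.integral_interval_sub_left
      (ha.locallyIntegrable.intervalIntegrable 0 Z) (ha.locallyIntegrable.intervalIntegrable 0 Z')]
  congr 1; ring

theorem isPrimitive_exp (ha : IsWeight c M a) :
    IsPrimitive (fun Z => Real.exp (∫ s in (0 : ℝ)..Z, a s))
      (fun Z => Real.exp (∫ s in (0 : ℝ)..Z, a s) * a Z) := by
  simpa using (IsPrimitive.of_integral ha.locallyIntegrable 0).comp Real.contDiff_exp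

theorem isPrimitive_exp_neg (ha : IsWeight c M a) :
    IsPrimitive (fun Z => Real.exp (-∫ s in (0 : ℝ)..Z, a s))
      (fun Z => -(Real.exp (-∫ s in (0 : ℝ)..Z, a s) * a Z)) := by
  simpa using ((IsPrimitive.of_integral ha.locallyIntegrable 0).const_mul (-1)).comp
    Real.contDiff_exp

theorem isPrimitive_rightPart (ha : IsWeight c M a) (hh : MemLp h 2 volume) :
    IsPrimitive (rightPart a h) (fun Z => a Z * rightPart a h Z - h Z) := by
  have hl : LocallyIntegrable h volume := hh.locallyIntegrable (by norm_num)
  set φ : ℝ → ℝ := fun Z' => Real.exp (-∫ s in (0 : ℝ)..Z', a s) * h Z' with hφ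
  have hR : rightPart a h = fun Z =>
      Real.exp (∫ s in (0 : ℝ)..Z, a s) * ∫ Z' in Ioi Z, φ Z' := by
    ext Z
    rw [rightPart, ← integral_const_mul]
    refine setIntegral_congr_fun measurableSet_Ioi fun Z' hZ => ?_
    simp only [weightedKernel, hφ]
    rw [ha.exp_right (le_of_lt hZ), mul_assoc]
  have hφl : LocallyIntegrable φ volume :=
    hl.continuous_smul (g := fun Z' => Real.exp (-∫ s in (0 : ℝ)..Z', a s))
      ha.isPrimitive_exp_neg.continuous
  have hφi : ∀ Z, IntegrableOn φ (Ioi Z) := fun Z => by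
    have := ((ha.integrable hh Z).integrableOn (s := Ioi Z)).const_mul
      (Real.exp (∫ s in (0 : ℝ)..Z, a s))⁻¹
    refine IntegrableOn.congr_fun this (fun Z' hZ => ?_) measurableSet_Ioi
    simp only [weightedKernel, hφ]
    rw [ha.exp_right (le_of_lt hZ), mul_assoc, inv_mul_cancel_left₀ (Real.exp_pos _).ne']
  have hI : IsPrimitive (fun Z => ∫ Z' in Ioi Z, φ Z') (fun Z => -φ Z) := by
    refine ⟨hφl.neg, fun x y => ?_⟩
    rw [intervalIntegral.integral_neg,
      ← intervalIntegral.integral_Ioi_sub_Ioi' (hφi x) (hφi y)]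
    ring
  have := (ha.isPrimitive_exp.mul hI)
  rw [← hR] at this
  refine this.congr_ae (ae_of_all _ fun Z => ?_)
  simp only [hR, hφ, Real.exp_neg]
  field_simp
  ring

theorem isPrimitive_leftPart (ha : IsWeight c M a) (hh : MemLp h 2 volume) :
    IsPrimitive (leftPart a h) (fun Z => h Z - a Z * leftPart a h Z) := by
  have hl : LocallyIntegrable h volume := hh.locallyIntegrable (by norm_num)
  set φ : ℝ → ℝ := fun Z' => Real.exp (∫ s in (0 : ℝ)..Z', a s) * h Z' with hφ
  have hL : leftPart a h = fun Z =>
      Real.exp (-∫ s in (0 : ℝ)..Z, a s) * ∫ Z' in Iic Z, φ Z' := by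
    ext Z
    rw [leftPart, ← integral_const_mul]
    refine setIntegral_congr_fun measurableSet_Iic fun Z' hZ => ?_
    simp only [weightedKernel, hφ]
    rw [ha.exp_left hZ, mul_assoc]
  have hφl : LocallyIntegrable φ volume :=
    hl.continuous_smul (g := fun Z' => Real.exp (∫ s in (0 : ℝ)..Z', a s))
      ha.isPrimitive_exp.continuous
  have hφi : ∀ Z, IntegrableOn φ (Iic Z) := fun Z => by
    have := ((ha.integrable hh Z).integrableOn (s := Iic Z)).const_mul
      (Real.exp (-∫ s in (0 : ℝ)..Z, a s))⁻¹
    refine IntegrableOn.congr_fun this (fun Z' hZ => ?_) measurableSet_Iic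
    simp only [weightedKernel, hφ]
    rw [ha.exp_left hZ, mul_assoc, inv_mul_cancel_left₀ (Real.exp_pos _).ne']
  have hI : IsPrimitive (fun Z => ∫ Z' in Iic Z, φ Z') φ := by
    refine ⟨hφl, fun x y => ?_⟩
    rw [← intervalIntegral.integral_Iic_sub_Iic (hφi x) (hφi y)]
  have := (ha.isPrimitive_exp_neg.mul hI)
  rw [← hL] at this
  refine this.congr_ae (ae_of_all _ fun Z => ?_)
  simp only [hL, hφ, Real.exp_neg]
  field_simp
  ring

/-- The kernel has mass at most `1` on each side of `Z` for the measure `a(Z') dZ'`. -/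
theorem kernel_self_right (ha : IsWeight c M a) (Z : ℝ) :
    IntegrableOn (weightedKernel a a Z) (Ioi Z) ∧ ∫ Z' in Ioi Z, weightedKernel a a Z Z' ≤ 1 := by
  have hb : ∀ N, Z ≤ N → ∫ Z' in Z..N, weightedKernel a a Z Z' ≤ 1 := fun N hN => by
    have h1 := ((ha.isPrimitive_exp_neg.const_mul (-Real.exp (∫ s in (0 : ℝ)..Z, a s))).sub_eq Z N)
    have h2 : ∫ Z' in Z..N, weightedKernel a a Z Z'
        = ∫ x in Z..N, -Real.exp (∫ s in (0 : ℝ)..Z, a s)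
          * -(Real.exp (-∫ s in (0 : ℝ)..x, a s) * a x) := by
      refine intervalIntegral.integral_congr fun x hx => ?_
      rw [uIcc_of_le hN] at hx
      simp only [weightedKernel]
      rw [ha.exp_right hx.1]
      ring
    rw [h2, ← h1]
    have h3 : Real.exp (∫ s in (0 : ℝ)..Z, a s) * Real.exp (-∫ s in (0 : ℝ)..Z, a s) = 1 := by
      rw [← Real.exp_add]; simp
    have h4 : 0 < Real.exp (∫ s in (0 : ℝ)..Z, a s) * Real.exp (-∫ s in (0 : ℝ)..N, a s) := by
      positivity
    linarith
  have hloc : LocallyIntegrable (weightedKernel a a Z) volume :=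
    ha.locallyIntegrable.continuous_smul (g := fun Z' => Real.exp (-|∫ s in Z..Z', a s|))
      (Real.continuous_exp.comp (ha.continuous_integral Z).abs.neg)
  have hnn : ∀ᵐ x, 0 ≤ weightedKernel a a Z x :=
    ha.nonneg.mono fun x hx => mul_nonneg (Real.exp_pos _).le hx
  have hi : IntegrableOn (weightedKernel a a Z) (Ioi Z) := by
    refine integrableOn_Ioi_of_intervalIntegral_norm_bounded (l := atTop) (b := id) 1 Z
      (fun N => (hloc.intervalIntegrable Z N).1) tendsto_id ?_
    filter_upwards [eventually_ge_atTop Z] with N hN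
    rw [intervalIntegral.integral_congr_ae (g := weightedKernel a a Z)
      (hnn.mono fun x hx _ => Real.norm_of_nonneg hx)]
    exact hb N hN
  refine ⟨hi, le_of_tendsto (intervalIntegral_tendsto_integral_Ioi Z hi tendsto_id) ?_⟩
  filter_upwards [eventually_ge_atTop Z] with N hN using hb N hN

theorem kernel_self_left (ha : IsWeight c M a) (Z : ℝ) :
    IntegrableOn (weightedKernel a a Z) (Iic Z) ∧ ∫ Z' in Iic Z, weightedKernel a a Z Z' ≤ 1 := by
  have hb : ∀ N, N ≤ Z → ∫ Z' in N..Z, weightedKernel a a Z Z' ≤ 1 := fun N hN => by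
    have h1 := ((ha.isPrimitive_exp.const_mul (Real.exp (-∫ s in (0 : ℝ)..Z, a s))).sub_eq N Z)
    have h2 : ∫ Z' in N..Z, weightedKernel a a Z Z'
        = ∫ x in N..Z, Real.exp (-∫ s in (0 : ℝ)..Z, a s)
          * (Real.exp (∫ s in (0 : ℝ)..x, a s) * a x) := by
      refine intervalIntegral.integral_congr fun x hx => ?_
      rw [uIcc_of_le hN] at hx
      simp only [weightedKernel]
      rw [ha.exp_left hx.2]
      ring
    rw [h2, ← h1]
    have h3 : Real.exp (-∫ s in (0 : ℝ)..Z, a s) * Real.exp (∫ s in (0 : ℝ)..Z, a s) = 1 := by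
      rw [← Real.exp_add]; simp
    have h4 : 0 < Real.exp (-∫ s in (0 : ℝ)..Z, a s) * Real.exp (∫ s in (0 : ℝ)..N, a s) := by
      positivity
    linarith
  have hloc : LocallyIntegrable (weightedKernel a a Z) volume :=
    ha.locallyIntegrable.continuous_smul (g := fun Z' => Real.exp (-|∫ s in Z..Z', a s|))
      (Real.continuous_exp.comp (ha.continuous_integral Z).abs.neg)
  have hnn : ∀ᵐ x, 0 ≤ weightedKernel a a Z x :=
    ha.nonneg.mono fun x hx => mul_nonneg (Real.exp_pos _).le hx
  have hi : IntegrableOn (weightedKernel a a Z) (Iic Z) := by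
    refine integrableOn_Iic_of_intervalIntegral_norm_bounded (l := atBot) (a := id) 1 Z
      (fun N => (hloc.intervalIntegrable N Z).1) tendsto_id ?_
    filter_upwards [eventually_le_atBot Z] with N hN
    rw [intervalIntegral.integral_congr_ae (g := weightedKernel a a Z)
      (hnn.mono fun x hx _ => Real.norm_of_nonneg hx)]
    exact hb N hN
  refine ⟨hi, le_of_tendsto (intervalIntegral_tendsto_integral_Iic Z hi tendsto_id) ?_⟩
  filter_upwards [eventually_le_atBot Z] with N hN using hb N hN

/-- A bound that does not see the constants of the weight: only the energy enters. -/
theorem abs_parts_le_of_le (ha : IsWeight c M a) (hh : MemLp h 2 volume) {G : ℝ} {b : ℝ → ℝ}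
    (hG : 0 ≤ G) (hb : Integrable b) (hb0 : ∀ᵐ x, 0 ≤ b x) (hle : ∀ᵐ x, |h x| ≤ G * a x + b x)
    (Z : ℝ) : |leftPart a h Z| + |rightPart a h Z| ≤ 2 * G + ∫ x, b x := by
  obtain ⟨i1, e1⟩ := ha.kernel_self_left Z
  obtain ⟨i2, e2⟩ := ha.kernel_self_right Z
  have i3 : Integrable (weightedKernel a a Z) := by
    rw [← integrableOn_univ, ← Iic_union_Ioi (a := Z)]
    exact i1.union i2
  have e3 : ∫ Z', weightedKernel a a Z Z' ≤ 2 := by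
    rw [← intervalIntegral.integral_Iic_add_Ioi i1 i2]
    linarith
  calc _ ≤ ∫ Z', |weightedKernel a h Z Z'| := ha.abs_parts_le_integral hh Z
    _ ≤ ∫ Z', (G * weightedKernel a a Z Z' + b Z') := by
        refine integral_mono_ae (ha.integrable hh Z).abs ((i3.const_mul G).add hb) ?_
        filter_upwards [hle, hb0] with x hx hx0
        simp only [weightedKernel, abs_mul, abs_of_pos (Real.exp_pos _)]
        have h1 : Real.exp (-|∫ s in Z..x, a s|) ≤ 1 := by
          rw [Real.exp_le_one_iff]
          linarith [abs_nonneg (∫ s in Z..x, a s)]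
        have h2 := Real.exp_pos (-|∫ s in Z..x, a s|)
        nlinarith
    _ = G * (∫ Z', weightedKernel a a Z Z') + ∫ x, b x := by
        rw [integral_add (i3.const_mul G) hb, integral_const_mul]
    _ ≤ _ := by nlinarith

end IsWeight

/-! ### The phase space -/

/-- The weak derivative of the component `u` of a point of `X`. -/
noncomputable def X.p (q : X) : ℝ → ℝ := H1.weakDeriv q.1

namespace X

variable (q r : X)

theorem stronglyMeasurable_u : StronglyMeasurable q.u := Lp.stronglyMeasurable q.1.1.1
theorem stronglyMeasurable_p : StronglyMeasurable q.p := Lp.stronglyMeasurable q.1.1.2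
theorem stronglyMeasurable_w : StronglyMeasurable q.w := Lp.stronglyMeasurable q.2.1.1.2
theorem stronglyMeasurable_v : StronglyMeasurable q.v := Lp.stronglyMeasurable q.2.2

theorem norm_u_le : ‖q.1.1.1‖ ≤ ‖q‖ := (norm_fst_le q.1.1).trans (norm_fst_le q)
theorem norm_p_le : ‖q.1.1.2‖ ≤ ‖q‖ := (norm_snd_le q.1.1).trans (norm_fst_le q)
theorem norm_w_le : ‖q.2.1.1.1‖ ≤ ‖q‖ :=
  (norm_fst_le q.2.1.1).trans ((norm_fst_le q.2).trans (norm_snd_le q))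
theorem norm_w_le' : ‖q.2.1.1.2‖ ≤ ‖q‖ :=
  (norm_snd_le q.2.1.1).trans ((norm_fst_le q.2).trans (norm_snd_le q))
theorem norm_v_le : ‖q.2.2‖ ≤ ‖q‖ := (norm_snd_le q.2).trans (norm_snd_le q)

theorem l2Le_coe (s : Lp ℝ 2 (volume : Measure ℝ)) : L2Le s ‖s‖ := ⟨Lp.memLp s, le_rfl⟩

theorem ae_abs_coe_le (s : Lp ℝ ∞ (volume : Measure ℝ)) : ∀ᵐ x, |s x| ≤ ‖s‖ := by
  have h1 := Lp.norm_def s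
  have h2 := ae_le_eLpNormEssSup (f := s) (μ := volume)
  filter_upwards [h2] with x hx
  rw [h1, eLpNorm_exponent_top, ← Real.norm_eq_abs, ← toReal_enorm]
  exact ENNReal.toReal_mono (by
    rw [← eLpNorm_exponent_top]; exact Lp.eLpNorm_ne_top s) hx

theorem l2Le_u : L2Le q.u ‖q‖ := (l2Le_coe _).weaken q.norm_u_le
theorem l2Le_p : L2Le q.p ‖q‖ := (l2Le_coe _).weaken q.norm_p_le

theorem w_ae_eq : q.w =ᵐ[volume] q.2.1.1.1 := by
  have : (q.2.1.1.1 : ℝ → ℝ) =ᵐ[volume] q.2.1.1.2 := q.2.1.2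
  exact this.symm

theorem l2Le_w : L2Le q.w ‖q‖ := ((l2Le_coe _).weaken q.norm_w_le).congr_ae q.w_ae_eq

theorem ae_abs_w_le : ∀ᵐ x, |q.w x| ≤ ‖q‖ :=
  (ae_abs_coe_le q.2.1.1.2).mono fun _ hx => hx.trans q.norm_w_le'

theorem ae_abs_v_le : ∀ᵐ x, |q.v x| ≤ ‖q‖ :=
  (ae_abs_coe_le q.2.2).mono fun _ hx => hx.trans q.norm_v_le

theorem isWeakDeriv : IsWeakDeriv q.u q.p := q.1.2

theorem locallyIntegrable_u : LocallyIntegrable q.u volume :=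
  q.l2Le_u.memLp.locallyIntegrable (by norm_num)

theorem locallyIntegrable_p : LocallyIntegrable q.p volume :=
  q.l2Le_p.memLp.locallyIntegrable (by norm_num)

theorem exists_isPrimitive : ∃ U, IsPrimitive U q.p ∧ q.u =ᵐ[volume] U :=
  q.isWeakDeriv.exists_isPrimitive q.locallyIntegrable_u q.locallyIntegrable_p

/-- The Sobolev embedding of `H¹` into `L^∞`. -/
theorem ae_abs_u_le : ∀ᵐ x, |q.u x| ≤ 2 * ‖q‖ := by
  obtain ⟨U, hU, hUe⟩ := q.exists_isPrimitive
  have h2 : L2Le U ‖q‖ := q.l2Le_u.congr_ae hUe.symm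
  have hp := q.l2Le_p
  have i1 : Integrable fun x => U x * U x := h2.integrable_mul h2
  have i2 : Integrable fun x => U x * q.p x := h2.integrable_mul hp
  have i3 : Integrable fun x => q.p x * U x + U x * q.p x :=
    (hp.integrable_mul h2).add i2
  filter_upwards [hUe] with x hx
  rw [hx]
  refine abs_le_of_sq_le_sq ?_ (by positivity)
  have h3 := (hU.mul hU).abs_le_integral_abs i1 i3 x
  have h4 : ∫ t, |q.p t * U t + U t * q.p t| = 2 * ∫ t, |U t * q.p t| := by
    rw [← integral_const_mul]
    congr 1
    ext t
    rw [mul_comm (q.p t), ← two_mul, abs_mul, abs_two]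
  have h5 := h2.integral_mul_le hp
  calc U x ^ 2 ≤ |U x * U x| := by rw [← sq]; exact le_abs_self _
    _ ≤ 2 * (‖q‖ * ‖q‖) := by linarith
    _ ≤ (2 * ‖q‖) ^ 2 := by nlinarith [norm_nonneg q]

theorem u_sub : (q - r).u =ᵐ[volume] fun x => q.u x - r.u x := Lp.coeFn_sub q.1.1.1 r.1.1.1
theorem p_sub : (q - r).p =ᵐ[volume] fun x => q.p x - r.p x := Lp.coeFn_sub q.1.1.2 r.1.1.2
theorem w_sub : (q - r).w =ᵐ[volume] fun x => q.w x - r.w x := Lp.coeFn_sub q.2.1.1.2 r.2.1.1.2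
theorem v_sub : (q - r).v =ᵐ[volume] fun x => q.v x - r.v x := Lp.coeFn_sub q.2.2 r.2.2

theorem u_add : (q + r).u =ᵐ[volume] fun x => q.u x + r.u x := Lp.coeFn_add q.1.1.1 r.1.1.1
theorem p_add : (q + r).p =ᵐ[volume] fun x => q.p x + r.p x := Lp.coeFn_add q.1.1.2 r.1.1.2
theorem w_add : (q + r).w =ᵐ[volume] fun x => q.w x + r.w x := Lp.coeFn_add q.2.1.1.2 r.2.1.1.2
theorem v_add : (q + r).v =ᵐ[volume] fun x => q.v x + r.v x := Lp.coeFn_add q.2.2 r.2.2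

theorem u_smul (c : ℝ) : (c • q).u =ᵐ[volume] fun x => c * q.u x := Lp.coeFn_smul c q.1.1.1
theorem p_smul (c : ℝ) : (c • q).p =ᵐ[volume] fun x => c * q.p x := Lp.coeFn_smul c q.1.1.2
theorem w_smul (c : ℝ) : (c • q).w =ᵐ[volume] fun x => c * q.w x := Lp.coeFn_smul c q.2.1.1.2
theorem v_smul (c : ℝ) : (c • q).v =ᵐ[volume] fun x => c * q.v x := Lp.coeFn_smul c q.2.2

variable {q r}

/-- A point of `X` is determined by its three functions, since weak derivatives are unique. -/
theorem ext_ae (hu : q.u =ᵐ[volume] r.u) (hw : q.w =ᵐ[volume] r.w) (hv : q.v =ᵐ[volume] r.v) :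
    q = r := by
  have hp : q.p =ᵐ[volume] r.p :=
    q.isWeakDeriv.ae_unique q.locallyIntegrable_p r.locallyIntegrable_p r.isWeakDeriv hu
  refine Prod.ext (Subtype.ext (Prod.ext (Lp.ext hu) (Lp.ext hp)))
    (Prod.ext (Subtype.ext (Prod.ext (Lp.ext ?_) (Lp.ext hw))) (Lp.ext hv))
  exact q.w_ae_eq.symm.trans (hw.trans r.w_ae_eq)

theorem norm_coe_le {s : Lp ℝ ∞ (volume : Measure ℝ)} {K : ℝ} (hK : 0 ≤ K)
    (h : ∀ᵐ x, |s x| ≤ K) : ‖s‖ ≤ K := by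
  rw [Lp.norm_def, eLpNorm_exponent_top]
  refine ENNReal.toReal_le_of_le_ofReal hK ?_
  exact eLpNormEssSup_le_of_ae_bound h

theorem norm_le {K : ℝ} (hu : L2Le q.u K) (hp : L2Le q.p K) (hw : L2Le q.w K)
    (hw' : ∀ᵐ x, |q.w x| ≤ K) (hv : ∀ᵐ x, |q.v x| ≤ K) : ‖q‖ ≤ K := by
  have h1 : ‖q.1.1.1‖ ≤ K := hu.le
  have h2 : ‖q.1.1.2‖ ≤ K := hp.le
  have h3 : ‖q.2.1.1.1‖ ≤ K := (hw.congr_ae q.w_ae_eq.symm).le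
  have h4 : ‖q.2.1.1.2‖ ≤ K := norm_coe_le hu.nonneg hw'
  have h5 : ‖q.2.2‖ ≤ K := norm_coe_le hu.nonneg hv
  exact norm_prod_le_iff.2 ⟨norm_prod_le_iff.2 ⟨h1, h2⟩,
    norm_prod_le_iff.2 ⟨norm_prod_le_iff.2 ⟨h3, h4⟩, h5⟩⟩

/-- Functions with the right integrability are the components of a point of `X`. -/
theorem exists_of_functions {U p w v : ℝ → ℝ} {K L : ℝ} (hU : IsPrimitive U p)
    (hU2 : MemLp U 2 volume) (hp2 : MemLp p 2 volume) (hw : MemLp w 2 volume)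
    (hw' : ∀ᵐ x, |w x| ≤ K) (hvm : AEStronglyMeasurable v volume) (hv : ∀ᵐ x, |v x| ≤ L) :
    ∃ q : X, q.u =ᵐ[volume] U ∧ q.p =ᵐ[volume] p ∧ q.w =ᵐ[volume] w ∧ q.v =ᵐ[volume] v := by
  have hwi : MemLp w ∞ volume := memLp_top_of_bound hw.aestronglyMeasurable K hw'
  have hvi : MemLp v ∞ volume := memLp_top_of_bound hvm L hv
  refine ⟨(⟨(hU2.toLp U, hp2.toLp p), fun φ hφ hc => ?_⟩,
    ⟨(hw.toLp w, hwi.toLp w), ?_⟩, hvi.toLp v), hU2.coeFn_toLp, hp2.coeFn_toLp,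
    hwi.coeFn_toLp, hvi.coeFn_toLp⟩
  · have h := hU.isWeakDeriv φ hφ hc
    have e1 : ∫ x, hU2.toLp U x * deriv φ x = ∫ x, U x * deriv φ x :=
      integral_congr_ae (hU2.coeFn_toLp.mono fun x hx => by simp only [hx])
    have e2 : ∫ x, hp2.toLp p x * φ x = ∫ x, p x * φ x :=
      integral_congr_ae (hp2.coeFn_toLp.mono fun x hx => by simp only [hx])
    simp only [e1, e2, h]
  · exact hw.coeFn_toLp.trans hwi.coeFn_toLp.symm

end X

/-! ### The right-hand side -/

/-- The weight `v cos² (w / 2)` in the exponent of the kernel. -/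
noncomputable def X.weight (q : X) (s : ℝ) : ℝ := q.v s * Real.cos (q.w s / 2) ^ 2

/-- The density `(g(u) cos² (w / 2) + (f''(u) / 2) sin² (w / 2)) v` of the nonlocal terms. -/
noncomputable def X.density (f g : ℝ → ℝ) (q : X) (s : ℝ) : ℝ :=
  (g (q.u s) * Real.cos (q.w s / 2) ^ 2
    + deriv (deriv f) (q.u s) / 2 * Real.sin (q.w s / 2) ^ 2) * q.v s

theorem kernelIntegrand_eq (f g : ℝ → ℝ) (q : X) :
    kernelIntegrand f g q = weightedKernel q.weight (q.density f g) := by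
  ext Z Z'
  simp only [kernelIntegrand, weightedKernel, X.weight, X.density, mul_assoc]

theorem nonlocalPx_eq (f g : ℝ → ℝ) (q : X) (Z : ℝ) : nonlocalPx f g q Z =
    1 / 2 * (rightPart q.weight (q.density f g) Z - leftPart q.weight (q.density f g) Z) := by
  rw [nonlocalPx, kernelIntegrand_eq]
  rfl

/-- A common constant for the bounds of `g` and `f''` on `[-ρ, ρ]`, where `g(0) = 0`. -/
structure NonlinBound (f g : ℝ → ℝ) (ρ K : ℝ) : Prop where
  nonneg : 0 ≤ K
  g_le : ∀ x, |x| ≤ ρ → |g x| ≤ K * |x|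
  g_sub : ∀ x y, |x| ≤ ρ → |y| ≤ ρ → |g x - g y| ≤ K * |x - y|
  F_le : ∀ x, |x| ≤ ρ → |deriv (deriv f) x| ≤ K
  F_sub : ∀ x y, |x| ≤ ρ → |y| ≤ ρ → |deriv (deriv f) x - deriv (deriv f) y| ≤ K * |x - y|

theorem contDiff_deriv_deriv {f : ℝ → ℝ} (hf : ContDiff ℝ ∞ f) :
    ContDiff ℝ ∞ (deriv (deriv f)) :=
  (contDiff_infty_iff_deriv.1 (contDiff_infty_iff_deriv.1 hf).2).2

theorem exists_nonlinBound {f g : ℝ → ℝ} (hf : ContDiff ℝ ∞ f) (hg : ContDiff ℝ ∞ g)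
    (hg0 : g 0 = 0) (ρ : ℝ) (hρ : 0 ≤ ρ) : ∃ K, NonlinBound f g ρ K := by
  have key : ∀ h : ℝ → ℝ, ContDiff ℝ ∞ h → ∃ K : NNReal, ∀ x y, |x| ≤ ρ → |y| ≤ ρ →
      |h x - h y| ≤ K * |x - y| := fun h hh => by
    obtain ⟨K, hK⟩ := ((hh.of_le (by simp) : ContDiff ℝ 1 h).contDiffOn
      (s := Metric.closedBall 0 ρ)).exists_lipschitzOnWith
      (by decide) (convex_closedBall _ _) (isCompact_closedBall _ _)
    refine ⟨K, fun x y hx hy => ?_⟩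
    have := hK.dist_le_mul x (by simpa using hx) y (by simpa using hy)
    simpa only [Real.dist_eq] using this
  obtain ⟨K1, h1⟩ := key g hg
  obtain ⟨K2, h2⟩ := key _ (contDiff_deriv_deriv hf)
  have p1 : (0 : ℝ) ≤ K1 := K1.2
  have p2 : (0 : ℝ) ≤ K2 := K2.2
  have p3 := abs_nonneg (deriv (deriv f) 0)
  have p4 := mul_nonneg p2 hρ
  refine ⟨K1 + K2 + |deriv (deriv f) 0| + K2 * ρ, by positivity, fun x hx => ?_, fun x y hx hy => ?_,
    fun x hx => ?_, fun x y hx hy => ?_⟩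
  · have := h1 x 0 hx (by simpa using hρ)
    rw [hg0, sub_zero, sub_zero] at this
    exact this.trans (mul_le_mul_of_nonneg_right (by linarith) (abs_nonneg _))
  · exact (h1 x y hx hy).trans (mul_le_mul_of_nonneg_right (by linarith) (abs_nonneg _))
  · have h3 := h2 x 0 hx (by simpa using hρ)
    rw [sub_zero] at h3
    have h4 := abs_sub_abs_le_abs_sub (deriv (deriv f) x) (deriv (deriv f) 0)
    have h5 := mul_le_mul_of_nonneg_left hx p2
    linarith
  · exact (h2 x y hx hy).trans (mul_le_mul_of_nonneg_right (by linarith) (abs_nonneg _))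

/-- Since `v cos² (w / 2) = v - sin² (w / 2) v`, its integrals differ from those of `v ≥ c` by at most
the total mass of `sin² (w / 2) v`. -/
theorem isWeight_of_le {q : X} {c M : ℝ} (hc : 0 < c) (hv : ∀ᵐ x, c ≤ q.v x)
    (hi : Integrable fun x => Real.sin (q.w x / 2) ^ 2 * q.v x)
    (hM : ∫ x, Real.sin (q.w x / 2) ^ 2 * q.v x ≤ M) : IsWeight c M q.weight := by
  have hvi : LocallyIntegrable q.v volume := by
    have : MemLp q.v ∞ volume := Lp.memLp q.2.2
    exact this.locallyIntegrable le_top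
  have he : ∀ x, q.weight x = q.v x - Real.sin (q.w x / 2) ^ 2 * q.v x := fun x => by
    rw [X.weight, Real.cos_sq']; ring
  have hwl : LocallyIntegrable q.weight volume := by
    rw [funext he]
    exact hvi.sub hi.locallyIntegrable
  refine ⟨hc, hwl, ?_, fun x y hxy => ?_⟩
  · filter_upwards [hv] with x hx
    exact mul_nonneg (hc.le.trans hx) (sq_nonneg _)
  · have e1 : ∫ s in x..y, q.weight s
        = (∫ s in x..y, q.v s) - ∫ s in x..y, Real.sin (q.w s / 2) ^ 2 * q.v s := by
      rw [← intervalIntegral.integral_sub (hvi.intervalIntegrable _ _) hi.intervalIntegrable]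
      simp only [he]
    have e2 : c * (y - x) ≤ ∫ s in x..y, q.v s := by
      have := intervalIntegral.integral_mono_ae hxy (intervalIntegrable_const (c := c))
        (hvi.intervalIntegrable x y) hv
      simpa [mul_comm] using this
    have e3 : ∫ s in x..y, Real.sin (q.w s / 2) ^ 2 * q.v s ≤ M := by
      rw [intervalIntegral.integral_of_le hxy]
      refine (setIntegral_le_integral hi ?_).trans hM
      filter_upwards [hv] with x hx
      exact mul_nonneg (sq_nonneg _) (hc.le.trans hx)
    linarith

/-- The points of the phase space of norm at most `R` at which `v` is bounded below by `c > 0`. -/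
structure Good (c R : ℝ) (q : X) : Prop where
  pos : 0 < c
  le_v : ∀ᵐ x, c ≤ q.v x
  norm_le : ‖q‖ ≤ R

theorem sin_half_sq_le (w : ℝ) : Real.sin (w / 2) ^ 2 ≤ w ^ 2 / 4 := by
  have := Real.abs_sin_le_abs (x := w / 2)
  have h2 := pow_le_pow_left₀ (abs_nonneg _) this 2
  rw [sq_abs, sq_abs] at h2
  linarith

theorem sin_half_sq_le_abs (w : ℝ) : Real.sin (w / 2) ^ 2 ≤ |w| / 2 := by
  have h1 := Real.abs_sin_le_abs (x := w / 2)
  have h2 := Real.abs_sin_le_one (w / 2)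
  rw [abs_div, abs_two] at h1
  rw [← sq_abs]
  nlinarith [abs_nonneg (Real.sin (w / 2))]

namespace Good

variable {c R : ℝ} {q : X} {f g : ℝ → ℝ} {K : ℝ}

theorem nonneg (h : Good c R q) : 0 ≤ R := (norm_nonneg _).trans h.norm_le

theorem weaken {c' R' : ℝ} (h : Good c R q) (hc : 0 < c') (hcc : c' ≤ c) (hR : R ≤ R') :
    Good c' R' q :=
  ⟨hc, h.le_v.mono fun _ hx => hcc.trans hx, h.norm_le.trans hR⟩

theorem ae_bounds (h : Good c R q) :
    ∀ᵐ x, |q.u x| ≤ 2 * R ∧ |q.w x| ≤ R ∧ |q.v x| ≤ R ∧ c ≤ q.v x := by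
  filter_upwards [q.ae_abs_u_le, q.ae_abs_w_le, q.ae_abs_v_le, h.le_v] with x h1 h2 h3 h4
  have := h.norm_le
  exact ⟨by linarith, by linarith, by linarith, h4⟩

theorem isWeight (h : Good c R q) : IsWeight c (R * R ^ 2) q.weight := by
  have hw := q.l2Le_w.weaken h.norm_le
  have hle : ∀ᵐ x, Real.sin (q.w x / 2) ^ 2 * q.v x ≤ R * q.w x ^ 2 := by
    filter_upwards [h.ae_bounds] with x hx
    have h1 := sin_half_sq_le (q.w x)
    have h2 := (le_abs_self _).trans hx.2.2.1
    have h3 := h.pos.le.trans hx.2.2.2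
    nlinarith [sq_nonneg (q.w x), sq_nonneg (Real.sin (q.w x / 2))]
  have hi : Integrable fun x => Real.sin (q.w x / 2) ^ 2 * q.v x := by
    refine (hw.integrable_sq.const_mul R).mono' ?_ ?_
    · exact (((Real.continuous_sin.comp_stronglyMeasurable
        ((q.stronglyMeasurable_w).div stronglyMeasurable_const)).pow 2).mul
        q.stronglyMeasurable_v).aestronglyMeasurable
    · filter_upwards [hle, h.le_v] with x hx hv
      rwa [Real.norm_of_nonneg (mul_nonneg (sq_nonneg _) (h.pos.le.trans hv))]
  refine isWeight_of_le h.pos h.le_v hi ?_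
  refine (integral_mono_ae hi (hw.integrable_sq.const_mul R) hle).trans ?_
  rw [integral_const_mul]
  exact mul_le_mul_of_nonneg_left hw.integral_sq_le h.nonneg

end Good

/-! ### Pointwise estimates for the nonlinear terms -/

theorem abs_cos_half_sq_sub_le (w z : ℝ) :
    |Real.cos (w / 2) ^ 2 - Real.cos (z / 2) ^ 2| ≤ |w - z| := by
  have h : Real.cos (w / 2) ^ 2 - Real.cos (z / 2) ^ 2 = (Real.cos w - Real.cos z) / 2 := by
    rw [Real.cos_sq, Real.cos_sq]; ring_nf
  have h2 := Real.abs_cos_sub_cos_le w z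
  rw [h, abs_div, abs_two]
  linarith [abs_nonneg (w - z)]

theorem abs_sin_half_sq_sub_le (w z : ℝ) :
    |Real.sin (w / 2) ^ 2 - Real.sin (z / 2) ^ 2| ≤ |w - z| := by
  rw [Real.sin_sq, Real.sin_sq, sub_sub_sub_cancel_left, abs_sub_comm]
  exact abs_cos_half_sq_sub_le w z

theorem abs_mul_sub_mul_le (a b c d : ℝ) :
    |a * b - c * d| ≤ |a - c| * |b| + |c| * |b - d| := by
  have : a * b - c * d = (a - c) * b + c * (b - d) := by ring
  rw [this, ← abs_mul, ← abs_mul]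
  exact abs_add_le _ _

theorem cos_half_sq_le_one (w : ℝ) : Real.cos (w / 2) ^ 2 ≤ 1 := Real.cos_sq_le_one _

theorem sin_half_sq_le_one (w : ℝ) : Real.sin (w / 2) ^ 2 ≤ 1 := Real.sin_sq_le_one _

namespace NonlinBound

variable {f g : ℝ → ℝ} {ρ K R : ℝ}

/-- The bracket in the density is linearly small in `(u, w)`, because `g(0) = 0`. -/
theorem abs_inner_le (hK : NonlinBound f g ρ K) {u w : ℝ} (hu : |u| ≤ ρ) :
    |g u * Real.cos (w / 2) ^ 2 + deriv (deriv f) u / 2 * Real.sin (w / 2) ^ 2|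
      ≤ K * (|u| + |w|) := by
  have h1 := hK.g_le u hu
  have h2 := hK.F_le u hu
  have h3 := sin_half_sq_le_abs w
  have h4 := cos_half_sq_le_one w
  refine (abs_add_le _ _).trans ?_
  rw [abs_mul, abs_mul, abs_of_nonneg (sq_nonneg (Real.cos _)),
    abs_of_nonneg (sq_nonneg (Real.sin _)), abs_div, abs_two]
  have e1 : |g u| * Real.cos (w / 2) ^ 2 ≤ K * |u| * 1 :=
    mul_le_mul h1 h4 (sq_nonneg _) (mul_nonneg hK.nonneg (abs_nonneg _))
  have e2 : |deriv (deriv f) u| / 2 * Real.sin (w / 2) ^ 2 ≤ K / 2 * (|w| / 2) :=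
    mul_le_mul (by linarith) h3 (sq_nonneg _) (by linarith [hK.nonneg])
  have e3 := mul_nonneg hK.nonneg (abs_nonneg w)
  linarith

theorem abs_inner_sub_le (hK : NonlinBound f g ρ K) {u w u' w' : ℝ} (hu : |u| ≤ ρ)
    (hu' : |u'| ≤ ρ) :
    |(g u * Real.cos (w / 2) ^ 2 + deriv (deriv f) u / 2 * Real.sin (w / 2) ^ 2)
      - (g u' * Real.cos (w' / 2) ^ 2 + deriv (deriv f) u' / 2 * Real.sin (w' / 2) ^ 2)|
      ≤ K * (2 + ρ) * (|u - u'| + |w - w'|) := by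
  have h1 := abs_mul_sub_mul_le (g u) (Real.cos (w / 2) ^ 2) (g u') (Real.cos (w' / 2) ^ 2)
  have h2 := abs_mul_sub_mul_le (deriv (deriv f) u / 2) (Real.sin (w / 2) ^ 2)
    (deriv (deriv f) u' / 2) (Real.sin (w' / 2) ^ 2)
  have hρ : 0 ≤ ρ := (abs_nonneg _).trans hu
  have hK0 := hK.nonneg
  have a1 := abs_nonneg (u - u')
  have a2 := abs_nonneg (w - w')
  rw [abs_of_nonneg (sq_nonneg (Real.cos (w / 2)))] at h1
  rw [abs_of_nonneg (sq_nonneg (Real.sin (w / 2)))] at h2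
  have e1 : |g u - g u'| * Real.cos (w / 2) ^ 2 ≤ K * |u - u'| * 1 :=
    mul_le_mul (hK.g_sub u u' hu hu') (cos_half_sq_le_one w) (sq_nonneg _) (by positivity)
  have e2 : |g u'| * |Real.cos (w / 2) ^ 2 - Real.cos (w' / 2) ^ 2| ≤ K * ρ * |w - w'| :=
    mul_le_mul ((hK.g_le u' hu').trans (mul_le_mul_of_nonneg_left hu' hK0))
      (abs_cos_half_sq_sub_le w w') (abs_nonneg _) (by positivity)
  have e3 : |deriv (deriv f) u / 2 - deriv (deriv f) u' / 2| * Real.sin (w / 2) ^ 2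
      ≤ K * |u - u'| * 1 := by
    refine mul_le_mul ?_ (sin_half_sq_le_one w) (sq_nonneg _) (by positivity)
    rw [← sub_div, abs_div, abs_two]
    have := hK.F_sub u u' hu hu'
    linarith [abs_nonneg (deriv (deriv f) u - deriv (deriv f) u')]
  have e4 : |deriv (deriv f) u' / 2| * |Real.sin (w / 2) ^ 2 - Real.sin (w' / 2) ^ 2|
      ≤ K * |w - w'| := by
    refine mul_le_mul ?_ (abs_sin_half_sq_sub_le w w') (abs_nonneg _) hK0
    rw [abs_div, abs_two]
    linarith [hK.F_le u' hu', abs_nonneg (deriv (deriv f) u')]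
  have e5 : (g u * Real.cos (w / 2) ^ 2 + deriv (deriv f) u / 2 * Real.sin (w / 2) ^ 2)
      - (g u' * Real.cos (w' / 2) ^ 2 + deriv (deriv f) u' / 2 * Real.sin (w' / 2) ^ 2)
      = (g u * Real.cos (w / 2) ^ 2 - g u' * Real.cos (w' / 2) ^ 2)
      + (deriv (deriv f) u / 2 * Real.sin (w / 2) ^ 2
        - deriv (deriv f) u' / 2 * Real.sin (w' / 2) ^ 2) := by ring
  rw [e5]
  refine (abs_add_le _ _).trans ?_
  have e6 : 0 ≤ K * ρ * |u - u'| := by positivity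
  have e7 : 0 ≤ K * |w - w'| := by positivity
  nlinarith

/-- Lipschitz bound for the density of the nonlocal terms. -/
theorem abs_density_sub_le (hK : NonlinBound f g ρ K) {u w v u' w' v' δ : ℝ} (hu : |u| ≤ ρ)
    (hu' : |u'| ≤ ρ) (hv : |v| ≤ R) (hvv : |v - v'| ≤ δ) :
    |(g u * Real.cos (w / 2) ^ 2 + deriv (deriv f) u / 2 * Real.sin (w / 2) ^ 2) * v
      - (g u' * Real.cos (w' / 2) ^ 2 + deriv (deriv f) u' / 2 * Real.sin (w' / 2) ^ 2) * v'|
      ≤ K * (2 + ρ) * (R + 1) * (|u - u'| + |w - w'| + δ * (|u'| + |w'|)) := by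
  have h1 := hK.abs_inner_sub_le (w := w) (w' := w') hu hu'
  have h2 := hK.abs_inner_le (w := w') hu'
  refine (abs_mul_sub_mul_le _ _ _ _).trans ?_
  have hρ : 0 ≤ ρ := (abs_nonneg _).trans hu
  have hR : 0 ≤ R := (abs_nonneg _).trans hv
  have hδ : 0 ≤ δ := (abs_nonneg _).trans hvv
  have hK0 := hK.nonneg
  have e1 := mul_le_mul h1 hv (abs_nonneg _) (by positivity)
  have e2 := mul_le_mul h2 hvv (abs_nonneg _) (by positivity)
  refine (add_le_add e1 e2).trans ?_
  set X := |u - u'| + |w - w'|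
  set Y := |u'| + |w'|
  have hX : 0 ≤ X := by positivity
  have hY : 0 ≤ Y := by positivity
  have t1 : 0 ≤ K * (2 + ρ) * X := by positivity
  have t2 : 0 ≤ K * δ * Y := by positivity
  have t3 : 0 ≤ K * δ * Y * (ρ + R * (2 + ρ)) := by positivity
  nlinarith

/-- Lipschitz bound for the right-hand side of the equation for `w`. -/
theorem abs_wrhs_sub_le (hK : NonlinBound f g ρ K) {u w P u' w' P' B : ℝ} (hu : |u| ≤ ρ)
    (hu' : |u'| ≤ ρ) (hB : |P'| ≤ B) :
    |(2 * (g u - P) * Real.cos (w / 2) ^ 2 - deriv (deriv f) u * Real.sin (w / 2) ^ 2)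
      - (2 * (g u' - P') * Real.cos (w' / 2) ^ 2 - deriv (deriv f) u' * Real.sin (w' / 2) ^ 2)|
      ≤ (3 * K + 2 * K * ρ + 2 * B + 2) * (|u - u'| + |w - w'| + |P - P'|) := by
  have hρ : 0 ≤ ρ := (abs_nonneg _).trans hu
  have hB0 : 0 ≤ B := (abs_nonneg _).trans hB
  have hK0 := hK.nonneg
  have h1 := abs_mul_sub_mul_le (2 * (g u - P)) (Real.cos (w / 2) ^ 2) (2 * (g u' - P'))
    (Real.cos (w' / 2) ^ 2)
  have h2 := abs_mul_sub_mul_le (deriv (deriv f) u) (Real.sin (w / 2) ^ 2)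
    (deriv (deriv f) u') (Real.sin (w' / 2) ^ 2)
  rw [abs_of_nonneg (sq_nonneg (Real.cos (w / 2)))] at h1
  rw [abs_of_nonneg (sq_nonneg (Real.sin (w / 2)))] at h2
  have e1 : |2 * (g u - P) - 2 * (g u' - P')| * Real.cos (w / 2) ^ 2
      ≤ 2 * (K * |u - u'| + |P - P'|) * 1 := by
    refine mul_le_mul ?_ (cos_half_sq_le_one w) (sq_nonneg _) (by positivity)
    have : 2 * (g u - P) - 2 * (g u' - P') = 2 * ((g u - g u') - (P - P')) := by ring
    rw [this, abs_mul, abs_two]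
    have h3 := hK.g_sub u u' hu hu'
    have h4 := abs_sub (g u - g u') (P - P')
    linarith
  have e2 : |2 * (g u' - P')| * |Real.cos (w / 2) ^ 2 - Real.cos (w' / 2) ^ 2|
      ≤ 2 * (K * ρ + B) * |w - w'| := by
    refine mul_le_mul ?_ (abs_cos_half_sq_sub_le w w') (abs_nonneg _) (by positivity)
    rw [abs_mul, abs_two]
    have h3 := (hK.g_le u' hu').trans (mul_le_mul_of_nonneg_left hu' hK0)
    have h4 := abs_sub (g u') P'
    linarith
  have e3 : |deriv (deriv f) u - deriv (deriv f) u'| * Real.sin (w / 2) ^ 2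
      ≤ K * |u - u'| * 1 :=
    mul_le_mul (hK.F_sub u u' hu hu') (sin_half_sq_le_one w) (sq_nonneg _) (by positivity)
  have e4 : |deriv (deriv f) u'| * |Real.sin (w / 2) ^ 2 - Real.sin (w' / 2) ^ 2|
      ≤ K * |w - w'| :=
    mul_le_mul (hK.F_le u' hu') (abs_sin_half_sq_sub_le w w') (abs_nonneg _) hK0
  have e5 : (2 * (g u - P) * Real.cos (w / 2) ^ 2 - deriv (deriv f) u * Real.sin (w / 2) ^ 2)
      - (2 * (g u' - P') * Real.cos (w' / 2) ^ 2 - deriv (deriv f) u' * Real.sin (w' / 2) ^ 2)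
      = (2 * (g u - P) * Real.cos (w / 2) ^ 2 - 2 * (g u' - P') * Real.cos (w' / 2) ^ 2)
      - (deriv (deriv f) u * Real.sin (w / 2) ^ 2
        - deriv (deriv f) u' * Real.sin (w' / 2) ^ 2) := by ring
  rw [e5]
  refine (abs_sub _ _).trans ?_
  set x := |u - u'|
  set y := |w - w'|
  set z := |P - P'|
  have hx : 0 ≤ x := abs_nonneg _
  have hy : 0 ≤ y := abs_nonneg _
  have hz : 0 ≤ z := abs_nonneg _
  have t1 : 0 ≤ (2 * K * ρ + 2 * B + 2) * x := by positivity
  have t2 : 0 ≤ (2 * K + 2) * y := by positivity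
  have t3 : 0 ≤ (3 * K + 2 * K * ρ + 2 * B) * z := by positivity
  nlinarith

theorem abs_vfactor_le (hK : NonlinBound f g ρ K) {u P B : ℝ} (hu : |u| ≤ ρ) (hB : |P| ≤ B) :
    |g u - P + deriv (deriv f) u / 2| ≤ K * ρ + B + K := by
  have h3 := (hK.g_le u hu).trans (mul_le_mul_of_nonneg_left hu hK.nonneg)
  have h4 := hK.F_le u hu
  have h5 : |deriv (deriv f) u / 2| ≤ K := by
    rw [abs_div, abs_two]
    linarith [hK.nonneg]
  linarith [abs_add_le (g u - P) (deriv (deriv f) u / 2), abs_sub (g u) P]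

/-- Lipschitz bound for the right-hand side of the equation for `v`. -/
theorem abs_vrhs_sub_le (hK : NonlinBound f g ρ K) {u w v P u' w' v' P' B : ℝ} (hu : |u| ≤ ρ)
    (hu' : |u'| ≤ ρ) (hB : |P'| ≤ B) (hv : |v| ≤ R) (hv' : |v'| ≤ R) :
    |(g u - P + deriv (deriv f) u / 2) * v * Real.sin w
      - (g u' - P' + deriv (deriv f) u' / 2) * v' * Real.sin w'|
      ≤ (2 * K + 1 + (K * ρ + B + K)) * (R + 1)
        * (|u - u'| + |w - w'| + |P - P'| + |v - v'|) := by
  have hρ : 0 ≤ ρ := (abs_nonneg _).trans hu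
  have hR : 0 ≤ R := (abs_nonneg _).trans hv
  have hB0 : 0 ≤ B := (abs_nonneg _).trans hB
  have hK0 := hK.nonneg
  rw [mul_assoc, mul_assoc]
  refine (abs_mul_sub_mul_le _ _ _ _).trans ?_
  have e1 : |(g u - P + deriv (deriv f) u / 2) - (g u' - P' + deriv (deriv f) u' / 2)|
      ≤ 2 * K * |u - u'| + |P - P'| := by
    have : (g u - P + deriv (deriv f) u / 2) - (g u' - P' + deriv (deriv f) u' / 2)
        = ((g u - g u') - (P - P')) + (deriv (deriv f) u - deriv (deriv f) u') / 2 := by ring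
    rw [this]
    have h3 := hK.g_sub u u' hu hu'
    have h4 := abs_sub (g u - g u') (P - P')
    have h5 : |(deriv (deriv f) u - deriv (deriv f) u') / 2| ≤ K * |u - u'| := by
      rw [abs_div, abs_two]
      have := hK.F_sub u u' hu hu'
      linarith [abs_nonneg (deriv (deriv f) u - deriv (deriv f) u')]
    linarith [abs_add_le ((g u - g u') - (P - P'))
      ((deriv (deriv f) u - deriv (deriv f) u') / 2)]
  have e2 : |v * Real.sin w| ≤ R := by
    rw [abs_mul]
    exact (mul_le_of_le_one_right (abs_nonneg _) (Real.abs_sin_le_one w)).trans hv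
  have e3 : |v * Real.sin w - v' * Real.sin w'| ≤ |v - v'| + R * |w - w'| := by
    refine (abs_mul_sub_mul_le _ _ _ _).trans (add_le_add ?_ ?_)
    · exact mul_le_of_le_one_right (abs_nonneg _) (Real.abs_sin_le_one w)
    · exact mul_le_mul hv' (Real.abs_sin_sub_sin_le w w') (abs_nonneg _) hR
  have e4 := hK.abs_vfactor_le hu' hB
  refine (add_le_add (mul_le_mul e1 e2 (abs_nonneg _) (by positivity))
    (mul_le_mul e4 e3 (abs_nonneg _) (by positivity))).trans ?_
  set x := |u - u'|
  set y := |w - w'|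
  set z := |P - P'|
  set t := |v - v'|
  have hx : 0 ≤ x := abs_nonneg _
  have hy : 0 ≤ y := abs_nonneg _
  have hz : 0 ≤ z := abs_nonneg _
  have ht : 0 ≤ t := abs_nonneg _
  set A := K * ρ + B + K with hA
  have hA0 : 0 ≤ A := by positivity
  have t1 : 0 ≤ (2 * K + (1 + A) * (R + 1)) * x := by positivity
  have t2 : 0 ≤ (A + (2 * K + 1) * (R + 1)) * y := by positivity
  have t3 : 0 ≤ (1 + (2 * K + A) * (R + 1)) * z := by positivity
  have t4 : 0 ≤ (A * R + (2 * K + 1) * (R + 1)) * t := by positivity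
  nlinarith

end NonlinBound

/-! ### The vector field -/

theorem X.measurable_density {f g : ℝ → ℝ} (hf : ContDiff ℝ ∞ f) (hg : ContDiff ℝ ∞ g) (q : X) :
    Measurable (q.density f g) := by
  have h1 := q.stronglyMeasurable_u.measurable
  have h2 := q.stronglyMeasurable_w.measurable
  have h3 := q.stronglyMeasurable_v.measurable
  have h4 := hg.continuous.measurable
  have h5 := (contDiff_deriv_deriv hf).continuous.measurable
  unfold X.density
  exact (((h4.comp h1).mul (by fun_prop)).add (((h5.comp h1).div_const 2).mul (by fun_prop))).mul h3

theorem X.measurable_weight (q : X) : Measurable q.weight := by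
  have h2 := q.stronglyMeasurable_w.measurable
  have h3 := q.stronglyMeasurable_v.measurable
  unfold X.weight
  fun_prop

/-- `|P| + |P_x|` is at most this sum. -/
noncomputable def partsSum (a h : ℝ → ℝ) (Z : ℝ) : ℝ := |leftPart a h Z| + |rightPart a h Z|

namespace IsWeight

variable {c M : ℝ} {q : X} {f g : ℝ → ℝ} {d : X}

theorem nonlocalP_eq (ha : IsWeight c M q.weight) (hh : MemLp (q.density f g) 2 volume) (Z : ℝ) :
    nonlocalP f g q Z =
      1 / 2 * (leftPart q.weight (q.density f g) Z + rightPart q.weight (q.density f g) Z) := by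
  rw [nonlocalP, kernelIntegrand_eq, ha.integral_eq hh]

theorem isPrimitive_nonlocalP (ha : IsWeight c M q.weight) (hh : MemLp (q.density f g) 2 volume) :
    IsPrimitive (nonlocalP f g q) (fun Z => q.weight Z * nonlocalPx f g q Z) := by
  rw [funext (ha.nonlocalP_eq hh)]
  refine (((ha.isPrimitive_leftPart hh).add (ha.isPrimitive_rightPart hh)).const_mul
    (1 / 2)).congr_ae (ae_of_all _ fun Z => ?_)
  simp only [nonlocalPx_eq]
  ring

theorem isPrimitive_neg_nonlocalPx (ha : IsWeight c M q.weight)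
    (hh : MemLp (q.density f g) 2 volume) :
    IsPrimitive (fun Z => -nonlocalPx f g q Z)
      (fun Z => q.density f g Z - q.weight Z * nonlocalP f g q Z) := by
  have : (fun Z => -nonlocalPx f g q Z) = fun Z => 1 / 2 *
      (leftPart q.weight (q.density f g) Z - rightPart q.weight (q.density f g) Z) := by
    ext Z; rw [nonlocalPx_eq]; ring
  rw [this]
  refine (((ha.isPrimitive_leftPart hh).sub (ha.isPrimitive_rightPart hh)).const_mul
    (1 / 2)).congr_ae (ae_of_all _ fun Z => ?_)
  simp only [ha.nonlocalP_eq hh]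
  ring

theorem abs_nonlocalP_le (ha : IsWeight c M q.weight) (hh : MemLp (q.density f g) 2 volume)
    (Z : ℝ) : |nonlocalP f g q Z| ≤ partsSum q.weight (q.density f g) Z := by
  rw [ha.nonlocalP_eq hh, abs_mul, abs_of_pos (by norm_num : (0 : ℝ) < 1 / 2), partsSum]
  have h1 := abs_add_le (leftPart q.weight (q.density f g) Z) (rightPart q.weight (q.density f g) Z)
  have h2 := abs_nonneg (leftPart q.weight (q.density f g) Z)
  have h3 := abs_nonneg (rightPart q.weight (q.density f g) Z)
  linarith

theorem _root_.DispersiveWave.abs_nonlocalPx_le (f g : ℝ → ℝ) (q : X) (Z : ℝ) :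
    |nonlocalPx f g q Z| ≤ partsSum q.weight (q.density f g) Z := by
  rw [nonlocalPx_eq, abs_mul, abs_of_pos (by norm_num : (0 : ℝ) < 1 / 2), partsSum]
  have h1 := abs_sub (rightPart q.weight (q.density f g) Z) (leftPart q.weight (q.density f g) Z)
  have h2 := abs_nonneg (leftPart q.weight (q.density f g) Z)
  have h3 := abs_nonneg (rightPart q.weight (q.density f g) Z)
  linarith

theorem l2Le_partsSum {a h : ℝ → ℝ} {K : ℝ} (ha : IsWeight c M a) (hh : L2Le h K) :
    L2Le (partsSum a h) (Real.exp M * ((expMass c + 1) * K)) := by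
  refine ((hh.abs.expAvg ha.pos).const_mul (Real.exp M)).mono_ae ?_ (ae_of_all _ fun Z => ?_)
    |>.weaken (by rw [abs_of_pos (Real.exp_pos _)])
  · exact ((ha.isPrimitive_leftPart hh.memLp).continuous.abs.add
      (ha.isPrimitive_rightPart hh.memLp).continuous.abs).aestronglyMeasurable
  · rw [partsSum, abs_of_nonneg (by positivity)]
    exact ha.abs_parts_le hh.memLp Z

theorem partsSum_le {a h : ℝ → ℝ} {K : ℝ} (ha : IsWeight c M a) (hh : L2Le h K) (Z : ℝ) :
    partsSum a h Z ≤ Real.exp M * ((expMass c + 1) * K) :=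
  (ha.abs_parts_le hh.memLp Z).trans (mul_le_mul_of_nonneg_left
    ((le_abs_self _).trans (abs_expAvg_le ha.pos hh.abs Z)) (Real.exp_pos _).le)

theorem continuous_nonlocalPx (ha : IsWeight c M q.weight) (hh : MemLp (q.density f g) 2 volume) :
    Continuous (nonlocalPx f g q) :=
  (ha.isPrimitive_neg_nonlocalPx hh).continuous.neg.congr fun _ => neg_neg _

/-- The weak derivative of `-P_x`. -/
theorem rhs_p_eq (ha : IsWeight c M q.weight) (hh : MemLp (q.density f g) 2 volume)
    (hd : IsRHS f g q d) :
    d.p =ᵐ[volume] fun Z => q.density f g Z - q.weight Z * nonlocalP f g q Z := by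
  have h := ha.isPrimitive_neg_nonlocalPx hh
  exact d.isWeakDeriv.ae_unique d.locallyIntegrable_p h.locallyIntegrable h.isWeakDeriv hd.u_eq

/-- If the density is square integrable, the right-hand side is a point of `X`. -/
theorem exists_isRHS (hf : ContDiff ℝ ∞ f) (hg : ContDiff ℝ ∞ g) {ρ K N : ℝ}
    (hK : NonlinBound f g ρ K) (hu : ∀ᵐ x, |q.u x| ≤ ρ)
    (ha : IsWeight c M q.weight) (hh : L2Le (q.density f g) N) : ∃ d : X, IsRHS f g q d := by
  have hT := ha.l2Le_partsSum hh
  have hTs := ha.partsSum_le hh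
  set B := Real.exp M * ((expMass c + 1) * N)
  have hPc := (ha.isPrimitive_nonlocalP hh.memLp).continuous
  have hPxc := ha.continuous_nonlocalPx hh.memLp
  have hP := ha.abs_nonlocalP_le hh.memLp
  have hPL : L2Le (nonlocalP f g q) B := hT.mono_ae hPc.aestronglyMeasurable (ae_of_all _ hP)
  have hPxL : L2Le (fun Z => -nonlocalPx f g q Z) B := hT.mono_ae hPxc.neg.aestronglyMeasurable
    (ae_of_all _ fun Z => by rw [abs_neg]; exact abs_nonlocalPx_le f g q Z)
  have mu := q.stronglyMeasurable_u.measurable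
  have mw := q.stronglyMeasurable_w.measurable
  have mv := q.stronglyMeasurable_v.measurable
  have mg := hg.continuous.measurable.comp mu
  have mF := (contDiff_deriv_deriv hf).continuous.measurable.comp mu
  have mP := hPc.measurable
  have hwt : ∀ᵐ x, |q.weight x| ≤ ‖q‖ := by
    filter_upwards [q.ae_abs_v_le] with x hx
    rw [X.weight, abs_mul, abs_of_nonneg (sq_nonneg (Real.cos _))]
    exact (mul_le_of_le_one_right (abs_nonneg _) (cos_half_sq_le_one _)).trans hx
  have hpL : MemLp (fun Z => q.density f g Z - q.weight Z * nonlocalP f g q Z) 2 volume :=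
    hh.memLp.sub (hPL.bdd_mul q.measurable_weight.aestronglyMeasurable hwt).memLp
  have hwm : Measurable fun Z => 2 * (g (q.u Z) - nonlocalP f g q Z) * Real.cos (q.w Z / 2) ^ 2
      - deriv (deriv f) (q.u Z) * Real.sin (q.w Z / 2) ^ 2 :=
    (((mg.sub mP).const_mul 2).mul (by fun_prop)).sub (mF.mul (by fun_prop))
  have hvm : Measurable fun Z => (g (q.u Z) - nonlocalP f g q Z + deriv (deriv f) (q.u Z) / 2)
      * q.v Z * Real.sin (q.w Z) :=
    (((mg.sub mP).add (mF.div_const 2)).mul mv).mul (by fun_prop)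
  have hK0 := hK.nonneg
  have hwle : ∀ᵐ Z, |2 * (g (q.u Z) - nonlocalP f g q Z) * Real.cos (q.w Z / 2) ^ 2
      - deriv (deriv f) (q.u Z) * Real.sin (q.w Z / 2) ^ 2|
      ≤ 2 * K * |q.u Z| + 2 * partsSum q.weight (q.density f g) Z + K * |q.w Z| := by
    filter_upwards [hu] with Z hZ
    refine (abs_sub _ _).trans ?_
    rw [abs_mul, abs_mul, abs_mul, abs_two, abs_of_nonneg (sq_nonneg (Real.cos _)),
      abs_of_nonneg (sq_nonneg (Real.sin _))]
    have e1 : 2 * |g (q.u Z) - nonlocalP f g q Z| * Real.cos (q.w Z / 2) ^ 2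
        ≤ 2 * |g (q.u Z) - nonlocalP f g q Z| :=
      mul_le_of_le_one_right (by positivity) (cos_half_sq_le_one _)
    have e2 : |deriv (deriv f) (q.u Z)| * Real.sin (q.w Z / 2) ^ 2 ≤ K * (|q.w Z| / 2) :=
      mul_le_mul (hK.F_le _ hZ) (sin_half_sq_le_abs _) (sq_nonneg _) hK0
    have e3 := hK.g_le _ hZ
    have e4 := abs_sub (g (q.u Z)) (nonlocalP f g q Z)
    have e5 := hP Z
    have e6 := mul_nonneg hK0 (abs_nonneg (q.w Z))
    linarith
  have hwL : MemLp (fun Z => 2 * (g (q.u Z) - nonlocalP f g q Z) * Real.cos (q.w Z / 2) ^ 2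
      - deriv (deriv f) (q.u Z) * Real.sin (q.w Z / 2) ^ 2) 2 volume :=
    (((q.l2Le_u.abs.const_mul (2 * K)).add (hT.const_mul 2)).add
      (q.l2Le_w.abs.const_mul K)).mono_ae hwm.aestronglyMeasurable hwle |>.memLp
  obtain ⟨d, d1, -, d3, d4⟩ := X.exists_of_functions (ha.isPrimitive_neg_nonlocalPx hh.memLp)
    hPxL.memLp hpL hwL (K := 2 * K * (2 * ‖q‖) + 2 * B + K * ‖q‖) (by
      filter_upwards [hwle, q.ae_abs_u_le, q.ae_abs_w_le] with Z h1 h2 h3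
      refine h1.trans ?_
      have := hTs Z
      gcongr) hvm.aestronglyMeasurable (L := (K * ρ + B + K) * ‖q‖ * 1) (by
      filter_upwards [hu, q.ae_abs_v_le] with Z h1 h2
      have h3 := hK.abs_vfactor_le h1 ((hP Z).trans (hTs Z))
      rw [abs_mul, abs_mul]
      exact mul_le_mul (mul_le_mul h3 h2 (abs_nonneg _) ((abs_nonneg _).trans h3))
        (Real.abs_sin_le_one _) (abs_nonneg _)
        (mul_nonneg ((abs_nonneg _).trans h3) (norm_nonneg _)))
  exact ⟨d, fun Z => by rw [kernelIntegrand_eq]; exact ha.integrable hh.memLp Z, d1, d3, d4⟩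

end IsWeight

theorem IsRHS.unique {f g : ℝ → ℝ} {q d e : X} (hd : IsRHS f g q d) (he : IsRHS f g q e) : d = e :=
  X.ext_ae (by filter_upwards [hd.u_eq, he.u_eq] with x h1 h2 using h1.trans h2.symm)
    (by filter_upwards [hd.w_eq, he.w_eq] with x h1 h2 using h1.trans h2.symm)
    (by filter_upwards [hd.v_eq, he.v_eq] with x h1 h2 using h1.trans h2.symm)

theorem expAvg_anti {c c' : ℝ} {D : ℝ → ℝ} (hc : 0 < c) (hcc : c ≤ c') (hD : MemLp D 2 volume)
    (h0 : ∀ᵐ x, 0 ≤ D x) (Z : ℝ) : expAvg c' D Z ≤ expAvg c D Z := by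
  refine integral_mono_ae (integrable_expAvg (hc.trans_le hcc) hD Z) (integrable_expAvg hc hD Z) ?_
  filter_upwards [h0] with x hx
  refine mul_le_mul_of_nonneg_right ?_ hx
  rw [Real.exp_le_exp]
  have := mul_le_mul_of_nonneg_right hcc (abs_nonneg (x - Z))
  linarith

namespace Good

variable {c R : ℝ} {q : X} {f g : ℝ → ℝ} {K : ℝ}

theorem l2Le_density (hf : ContDiff ℝ ∞ f) (hg : ContDiff ℝ ∞ g) (h : Good c R q)
    (hK : NonlinBound f g (2 * R) K) : L2Le (q.density f g) (K * R * (R + R)) := by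
  have hR := h.nonneg
  have hK0 := hK.nonneg
  refine (((q.l2Le_u.weaken h.norm_le).abs.add (q.l2Le_w.weaken h.norm_le).abs).const_mul
    (K * R)).mono_ae (q.measurable_density hf hg).aestronglyMeasurable ?_
    |>.weaken (by rw [abs_of_nonneg (by positivity)])
  filter_upwards [h.ae_bounds] with x hx
  rw [X.density, abs_mul]
  have h1 := hK.abs_inner_le (w := q.w x) hx.1
  calc _ ≤ K * (|q.u x| + |q.w x|) * R := mul_le_mul h1 hx.2.2.1 (abs_nonneg _) (by positivity)
    _ = _ := by ring

theorem exists_isRHS (hf : ContDiff ℝ ∞ f) (hg : ContDiff ℝ ∞ g) (hg0 : g 0 = 0)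
    (h : Good c R q) : ∃ d, IsRHS f g q d := by
  obtain ⟨K, hK⟩ := exists_nonlinBound hf hg hg0 (2 * R) (by linarith [h.nonneg])
  exact h.isWeight.exists_isRHS hf hg hK (h.ae_bounds.mono fun _ hx => hx.1)
    (h.l2Le_density hf hg hK)

end Good

/-! ### Lipschitz continuity of the vector field -/

set_option maxHeartbeats 1000000 in
/-- The vector field is Lipschitz on sets of bounded norm on which `v` is bounded below. Every
difference is controlled by `D + exp(-c |·| / 2) * D`, where
`D = |u - ũ| + |w - w̃| + ‖q - r‖ (|ũ| + |w̃|)`. -/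
theorem exists_lipschitz {f g : ℝ → ℝ} (hf : ContDiff ℝ ∞ f) (hg : ContDiff ℝ ∞ g) (hg0 : g 0 = 0)
    {c R : ℝ} (hc : 0 < c) (hR : 0 ≤ R) : ∃ L : ℝ, 0 ≤ L ∧ ∀ q r d e : X, Good c R q → Good c R r →
      IsRHS f g q d → IsRHS f g r e → ‖d - e‖ ≤ L * ‖q - r‖ := by
  obtain ⟨K, hK⟩ := exists_nonlinBound hf hg hg0 (2 * R) (by linarith)
  have hK0 := hK.nonneg
  have hm1 := expMass_pos hc
  have hm2 := expMass_pos (half_pos hc)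
  -- `exp M` is the factor in the exponential bounds of the kernel and `B` bounds the nonlocal terms;
  -- the other constants bound the differences of the local and nonlocal parts of the right-hand side.
  obtain ⟨M, hM⟩ : ∃ x, x = R * R ^ 2 := ⟨_, rfl⟩
  obtain ⟨B, hB⟩ : ∃ x, x = Real.exp M * ((expMass c + 1) * (K * R * (R + R))) := ⟨_, rfl⟩
  have hB0 : 0 ≤ B := by rw [hB]; positivity
  obtain ⟨C1, hC1⟩ : ∃ x, x = K * (2 + 2 * R) * (R + 1) := ⟨_, rfl⟩
  have hC10 : 0 ≤ C1 := by rw [hC1]; positivity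
  obtain ⟨C2, hC2⟩ : ∃ x, x = C1 + (1 + R) * (K * R) := ⟨_, rfl⟩
  have hC20 : 0 ≤ C2 := by rw [hC2]; positivity
  obtain ⟨C3, hC3⟩ : ∃ x, x = (2 / c + 1) * Real.exp M * C2 := ⟨_, rfl⟩
  have hC30 : 0 ≤ C3 := by rw [hC3]; positivity
  obtain ⟨C4, hC4⟩ : ∃ x, x = Real.exp M * (K * R) := ⟨_, rfl⟩
  have hC40 : 0 ≤ C4 := by rw [hC4]; positivity
  obtain ⟨Cw, hCw⟩ : ∃ x, x = 3 * K + 2 * K * (2 * R) + 2 * B + 2 := ⟨_, rfl⟩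
  have hCw0 : 0 ≤ Cw := by rw [hCw]; positivity
  obtain ⟨Cv, hCv⟩ : ∃ x, x = (2 * K + 1 + (K * (2 * R) + B + K)) * (R + 1) := ⟨_, rfl⟩
  have hCv0 : 0 ≤ Cv := by rw [hCv]; positivity
  obtain ⟨C5, hC5⟩ : ∃ x,
      x = C1 + R * C3 + (1 + R) * C4 + C3 + Cw * (1 + C3) + Cv * (2 + C3) := ⟨_, rfl⟩
  have hC50 : 0 ≤ C5 := by rw [hC5]; positivity
  -- `m` bounds both norms of the exponential average
  obtain ⟨m, hm⟩ : ∃ x, x = expMass (c / 2) + 1 := ⟨_, rfl⟩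
  have hm0 : 0 < m := by rw [hm]; positivity
  refine ⟨C5 * (3 + 3 * R) * (1 + m), by positivity, fun q r d e hq hr hd he => ?_⟩
  set δ := ‖q - r‖ with hδ
  have hδ0 : 0 ≤ δ := norm_nonneg _
  have hWq := hq.isWeight
  have hWr := hr.isWeight
  rw [← hM] at hWq hWr
  have hhq := hq.l2Le_density hf hg hK
  have hhr := hr.l2Le_density hf hg hK
  set D : ℝ → ℝ := fun x => |q.u x - r.u x| + |q.w x - r.w x| + δ * (|r.u x| + |r.w x|) with hD
  have hD0 : ∀ x, 0 ≤ D x := fun x => by positivity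
  have hDL : L2Le D ((3 + 3 * R) * δ) := by
    have h1 : L2Le (fun x => q.u x - r.u x) δ := (q - r).l2Le_u.congr_ae (X.u_sub q r).symm
    have h2 : L2Le (fun x => q.w x - r.w x) δ := (q - r).l2Le_w.congr_ae (X.w_sub q r).symm
    refine ((h1.abs.add h2.abs).add (((r.l2Le_u.weaken hr.norm_le).abs.add
      (r.l2Le_w.weaken hr.norm_le).abs).const_mul δ)).weaken ?_
    rw [abs_of_nonneg hδ0]
    linarith [mul_nonneg hR hδ0]
  have hdu : ∀ᵐ x, |q.u x - r.u x| ≤ 2 * δ := by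
    filter_upwards [(q - r).ae_abs_u_le, X.u_sub q r] with x h1 h2
    rwa [h2] at h1
  have hdw : ∀ᵐ x, |q.w x - r.w x| ≤ δ := by
    filter_upwards [(q - r).ae_abs_w_le, X.w_sub q r] with x h1 h2
    rwa [h2] at h1
  have hdv : ∀ᵐ x, |q.v x - r.v x| ≤ δ := by
    filter_upwards [(q - r).ae_abs_v_le, X.v_sub q r] with x h1 h2
    rwa [h2] at h1
  have hDs : ∀ᵐ x, D x ≤ (3 + 3 * R) * δ := by
    filter_upwards [hdu, hdw, hr.ae_bounds] with x h1 h2 h3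
    have := mul_le_mul_of_nonneg_left (add_le_add h3.1 h3.2.1) hδ0
    simp only [hD]
    linarith
  set N := expAvg (c / 2) D with hN
  have hN0 : ∀ x, 0 ≤ N x := expAvg_nonneg (ae_of_all _ hD0)
  have hNL : L2Le N (m * ((3 + 3 * R) * δ)) := by rw [hm]; exact hDL.expAvg (half_pos hc)
  have hNs : ∀ x, N x ≤ m * ((3 + 3 * R) * δ) := fun x =>
    by rw [hm]; exact (le_abs_self _).trans (abs_expAvg_le (half_pos hc) hDL x)
  have hDNL : L2Le (fun x => D x + N x) ((3 + 3 * R) * (1 + m) * δ) :=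
    (hDL.add hNL).weaken (by linarith)
  have hDNs : ∀ᵐ x, D x + N x ≤ (3 + 3 * R) * (1 + m) * δ := by
    filter_upwards [hDs] with x hx
    linarith [hNs x]
  -- the densities and the weights
  have hdens : ∀ᵐ x, |q.density f g x - r.density f g x| ≤ C1 * D x := by
    filter_upwards [hq.ae_bounds, hr.ae_bounds, hdv] with x h1 h2 h3
    rw [hC1]
    exact hK.abs_density_sub_le h1.1 h2.1 h1.2.2.1 h3
  have hrd : ∀ᵐ x, |r.density f g x| ≤ K * R * (|r.u x| + |r.w x|) := by
    filter_upwards [hr.ae_bounds] with x hx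
    rw [X.density, abs_mul]
    calc _ ≤ K * (|r.u x| + |r.w x|) * R :=
          mul_le_mul (hK.abs_inner_le hx.1) hx.2.2.1 (abs_nonneg _) (by positivity)
      _ = _ := by ring
  have hδrd : ∀ᵐ x, δ * |r.density f g x| ≤ K * R * D x := by
    filter_upwards [hrd] with x hx
    have h1 := mul_le_mul_of_nonneg_left hx hδ0
    have h2 : 0 ≤ K * R * (|q.u x - r.u x| + |q.w x - r.w x|) := by positivity
    simp only [hD]
    linarith
  have hwt : ∀ᵐ x, |q.weight x - r.weight x| ≤ (1 + R) * δ := by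
    filter_upwards [hr.ae_bounds, hdv, hdw] with x h1 h2 h3
    refine (abs_mul_sub_mul_le _ _ _ _).trans ?_
    rw [abs_of_nonneg (sq_nonneg (Real.cos (q.w x / 2)))]
    have e1 := mul_le_mul h2 (cos_half_sq_le_one (q.w x)) (sq_nonneg _) hδ0
    have e2 := mul_le_mul h1.2.2.1 ((abs_cos_half_sq_sub_le (q.w x) (r.w x)).trans h3)
      (abs_nonneg _) hR
    linarith
  -- the nonlocal terms
  have hDc : L2Le (fun x => C2 * D x) (|C2| * ((3 + 3 * R) * δ)) := hDL.const_mul C2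
  set S : ℝ → ℝ := fun Z =>
    |leftPart q.weight (q.density f g) Z - leftPart r.weight (r.density f g) Z|
      + |rightPart q.weight (q.density f g) Z - rightPart r.weight (r.density f g) Z| with hS
  have hSN : ∀ Z, S Z ≤ C3 * N Z := fun Z => by
    refine (hWq.abs_parts_sub_le hWr hwt hhq.memLp hhr.memLp Z).trans ?_
    rw [hC3, mul_assoc _ C2]
    refine mul_le_mul_of_nonneg_left ?_ (by positivity)
    rw [hN, ← expAvg_const_mul]
    refine expAvg_mono (half_pos hc) ((hhq.memLp.sub hhr.memLp).norm.add
      (hhr.memLp.norm.const_mul _)) hDc.memLp ?_ Z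
    filter_upwards [hdens, hδrd] with x h1 h2
    have h3 := mul_le_mul_of_nonneg_left h2 (by linarith : 0 ≤ 1 + R)
    rw [hC2]
    change |q.density f g x - r.density f g x| + (1 + R) * δ * |r.density f g x| ≤ _
    linarith
  have hTr := hWr.partsSum_le hhr
  rw [← hB] at hTr
  have hδT : ∀ Z, δ * partsSum r.weight (r.density f g) Z ≤ C4 * N Z := fun Z => by
    have h1 := mul_le_mul_of_nonneg_left (hWr.abs_parts_le hhr.memLp Z) hδ0
    refine h1.trans ?_
    have h2 := expAvg_anti (half_pos hc) (by linarith : c / 2 ≤ c) hhr.memLp.norm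
      (ae_of_all _ fun x => norm_nonneg _) Z
    have h3 : δ * expAvg (c / 2) (fun x => |r.density f g x|) Z ≤ K * R * N Z := by
      rw [hN, ← expAvg_const_mul, ← expAvg_const_mul]
      exact expAvg_mono (half_pos hc) (hhr.memLp.norm.const_mul δ) (hDL.const_mul (K * R)).memLp
        hδrd Z
    have h4 := mul_le_mul_of_nonneg_left h2 hδ0
    calc _ = Real.exp M * (δ * expAvg c (fun x => |r.density f g x|) Z) := by ring
      _ ≤ Real.exp M * (K * R * N Z) :=
          mul_le_mul_of_nonneg_left (h4.trans h3) (Real.exp_pos _).le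
      _ = C4 * N Z := by rw [hC4]; ring
  have hP : ∀ Z, |nonlocalP f g q Z - nonlocalP f g r Z| ≤ C3 * N Z := fun Z => by
    refine le_trans ?_ (hSN Z)
    rw [hWq.nonlocalP_eq hhq.memLp, hWr.nonlocalP_eq hhr.memLp, hS]
    have h1 := abs_add_le (leftPart q.weight (q.density f g) Z
      - leftPart r.weight (r.density f g) Z) (rightPart q.weight (q.density f g) Z
      - rightPart r.weight (r.density f g) Z)
    rw [← mul_sub, add_sub_add_comm, abs_mul, abs_of_pos (by norm_num : (0 : ℝ) < 1 / 2)]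
    have h2 : 0 ≤ S Z := by positivity
    simp only [hS] at h2 ⊢
    linarith
  have hPx : ∀ Z, |nonlocalPx f g q Z - nonlocalPx f g r Z| ≤ C3 * N Z := fun Z => by
    refine le_trans ?_ (hSN Z)
    rw [nonlocalPx_eq, nonlocalPx_eq, hS]
    have h1 := abs_sub (rightPart q.weight (q.density f g) Z
      - rightPart r.weight (r.density f g) Z) (leftPart q.weight (q.density f g) Z
      - leftPart r.weight (r.density f g) Z)
    rw [← mul_sub, sub_sub_sub_comm, abs_mul, abs_of_pos (by norm_num : (0 : ℝ) < 1 / 2)]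
    have h2 : 0 ≤ S Z := by positivity
    simp only [hS] at h2 ⊢
    linarith
  have hPr : ∀ Z, |nonlocalP f g r Z| ≤ B := fun Z =>
    (hWr.abs_nonlocalP_le hhr.memLp Z).trans (hTr Z)
  -- the components
  have hDN0 : ∀ x, 0 ≤ D x + N x := fun x => add_nonneg (hD0 x) (hN0 x)
  have fin : ∀ {F : ℝ → ℝ}, AEStronglyMeasurable F volume →
      (∀ᵐ x, |F x| ≤ C5 * (D x + N x)) → L2Le F (C5 * (3 + 3 * R) * (1 + m) * δ) :=
    fun hF h => ((hDNL.const_mul C5).mono_ae hF h).weaken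
      (by rw [abs_of_nonneg hC50]; exact le_of_eq (by ring))
  have du : ∀ᵐ x, |(d - e).u x| ≤ C5 * (D x + N x) := by
    filter_upwards [X.u_sub d e, hd.u_eq, he.u_eq] with x h1 h2 h3
    rw [h1, h2, h3, neg_sub_neg, abs_sub_comm]
    refine (hPx x).trans ?_
    have e1 : 0 ≤ (C5 - C3) * N x := mul_nonneg (by
      have : 0 ≤ C1 + R * C3 + (1 + R) * C4 + Cw * (1 + C3) + Cv * (2 + C3) := by positivity
      linarith) (hN0 x)
    have e2 := mul_nonneg hC50 (hD0 x)
    linarith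
  have dp : ∀ᵐ x, |(d - e).p x| ≤ C5 * (D x + N x) := by
    filter_upwards [X.p_sub d e, hWq.rhs_p_eq hhq.memLp hd, hWr.rhs_p_eq hhr.memLp he, hdens, hwt,
      hq.ae_bounds] with x h1 h2 h3 h4 h5 h6
    rw [h1, h2, h3, sub_sub_sub_comm]
    refine (abs_sub _ _).trans ?_
    have e1 := abs_mul_sub_mul_le (nonlocalP f g q x) (q.weight x) (nonlocalP f g r x) (r.weight x)
    rw [mul_comm (q.weight x), mul_comm (r.weight x)]
    have e2 : |q.weight x| ≤ R := by
      rw [X.weight, abs_mul, abs_of_nonneg (sq_nonneg (Real.cos _))]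
      exact (mul_le_of_le_one_right (abs_nonneg _) (cos_half_sq_le_one _)).trans h6.2.2.1
    have e3 := mul_le_mul (hP x) e2 (abs_nonneg _) (mul_nonneg hC30 (hN0 x))
    have e4 : |nonlocalP f g r x| * |q.weight x - r.weight x| ≤ (1 + R) * (C4 * N x) := by
      calc _ ≤ partsSum r.weight (r.density f g) x * ((1 + R) * δ) :=
            mul_le_mul (hWr.abs_nonlocalP_le hhr.memLp x) h5 (abs_nonneg _)
              ((abs_nonneg _).trans (hWr.abs_nonlocalP_le hhr.memLp x))
        _ = (1 + R) * (δ * partsSum r.weight (r.density f g) x) := by ring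
        _ ≤ _ := mul_le_mul_of_nonneg_left (hδT x) (by linarith)
    have e5 : 0 ≤ (C5 - C1) * D x := mul_nonneg (by
      have : 0 ≤ R * C3 + (1 + R) * C4 + C3 + Cw * (1 + C3) + Cv * (2 + C3) := by positivity
      linarith) (hD0 x)
    have e6 : 0 ≤ (C5 - (R * C3 + (1 + R) * C4)) * N x := mul_nonneg (by
      have : 0 ≤ C1 + C3 + Cw * (1 + C3) + Cv * (2 + C3) := by positivity
      linarith) (hN0 x)
    linarith
  have hduw : ∀ x, |q.u x - r.u x| + |q.w x - r.w x| ≤ D x := fun x => by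
    have : 0 ≤ δ * (|r.u x| + |r.w x|) := by positivity
    simp only [hD]
    linarith
  have dw : ∀ᵐ x, |(d - e).w x| ≤ C5 * (D x + N x) := by
    filter_upwards [X.w_sub d e, hd.w_eq, he.w_eq, hq.ae_bounds, hr.ae_bounds]
      with x h1 h2 h3 h4 h5
    rw [h1, h2, h3]
    refine (hK.abs_wrhs_sub_le h4.1 h5.1 (hPr x)).trans ?_
    rw [← hCw]
    have e1 : Cw * (|q.u x - r.u x| + |q.w x - r.w x| + |nonlocalP f g q x - nonlocalP f g r x|)
        ≤ Cw * (D x + C3 * N x) :=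
      mul_le_mul_of_nonneg_left (add_le_add (hduw x) (hP x)) hCw0
    refine e1.trans ?_
    have e2 : 0 ≤ (C5 - Cw) * D x := mul_nonneg (by
      have : 0 ≤ C1 + R * C3 + (1 + R) * C4 + C3 + Cw * C3 + Cv * (2 + C3) := by positivity
      linarith) (hD0 x)
    have e3 : 0 ≤ (C5 - Cw * C3) * N x := mul_nonneg (by
      have : 0 ≤ C1 + R * C3 + (1 + R) * C4 + C3 + Cw + Cv * (2 + C3) := by positivity
      linarith) (hN0 x)
    linarith
  have hle : (3 + 3 * R) * (1 + m) * δ ≥ δ := by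
    have : 1 ≤ (3 + 3 * R) * (1 + m) := by linarith [mul_nonneg hR hm0.le]
    exact le_mul_of_one_le_left hδ0 this
  have dv : ∀ᵐ x, |(d - e).v x| ≤ C5 * (3 + 3 * R) * (1 + m) * δ := by
    filter_upwards [X.v_sub d e, hd.v_eq, he.v_eq, hq.ae_bounds, hr.ae_bounds, hdv, hDNs]
      with x h1 h2 h3 h4 h5 h6 h7
    rw [h1, h2, h3]
    refine (hK.abs_vrhs_sub_le h4.1 h5.1 (hPr x) h4.2.2.1 h5.2.2.1).trans ?_
    rw [← hCv]
    have e0 : |q.u x - r.u x| + |q.w x - r.w x| + |nonlocalP f g q x - nonlocalP f g r x|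
        + |q.v x - r.v x| ≤ D x + C3 * N x + (3 + 3 * R) * (1 + m) * δ :=
      add_le_add (add_le_add (hduw x) (hP x)) (h6.trans hle)
    have e1 : D x + C3 * N x ≤ (1 + C3) * (D x + N x) := by
      linarith [mul_nonneg hC30 (hD0 x), hN0 x]
    have e2 : (1 + C3) * (D x + N x) ≤ (1 + C3) * ((3 + 3 * R) * (1 + m) * δ) :=
      mul_le_mul_of_nonneg_left h7 (by linarith)
    have e3 := mul_le_mul_of_nonneg_left (e0.trans (add_le_add_left (e1.trans e2) _)) hCv0
    refine e3.trans ?_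
    have e4 : 0 ≤ (C5 - Cv * (2 + C3)) * ((3 + 3 * R) * (1 + m) * δ) := mul_nonneg (by
      have : 0 ≤ C1 + R * C3 + (1 + R) * C4 + C3 + Cw * (1 + C3) := by positivity
      linarith) (by positivity)
    linarith
  refine X.norm_le (fin (d - e).stronglyMeasurable_u.aestronglyMeasurable du)
    (fin (d - e).stronglyMeasurable_p.aestronglyMeasurable dp)
    (fin (d - e).stronglyMeasurable_w.aestronglyMeasurable dw) ?_ dv
  filter_upwards [dw, hDNs] with x h1 h2
  refine h1.trans ((mul_le_mul_of_nonneg_left h2 hC50).trans (le_of_eq (by ring)))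

/-! ### Bounds in terms of the energy -/

/-- The density `(u² cos² (w / 2) + sin² (w / 2)) v` of the energy, the `H¹` norm squared of the
solution in the original variables. -/
noncomputable def X.energyDensity (q : X) (x : ℝ) : ℝ :=
  (q.u x ^ 2 * Real.cos (q.w x / 2) ^ 2 + Real.sin (q.w x / 2) ^ 2) * q.v x

/-- The energy of a point of the phase space. -/
noncomputable def X.energy (q : X) : ℝ := ∫ x, q.energyDensity x

theorem X.measurable_energyDensity (q : X) : Measurable q.energyDensity := by
  have h1 := q.stronglyMeasurable_u.measurable
  have h2 := q.stronglyMeasurable_w.measurable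
  have h3 := q.stronglyMeasurable_v.measurable
  unfold X.energyDensity
  fun_prop

theorem X.integrable_energyDensity (q : X) : Integrable q.energyDensity := by
  refine ((q.l2Le_u.integrable_sq.add q.l2Le_w.integrable_sq).const_mul ‖q‖).mono'
    q.measurable_energyDensity.aestronglyMeasurable ?_
  filter_upwards [q.ae_abs_v_le] with x hx
  rw [X.energyDensity, Real.norm_eq_abs, abs_mul, abs_of_nonneg (by positivity), mul_comm]
  refine mul_le_mul hx ?_ (by positivity) (norm_nonneg _)
  have h1 := sin_half_sq_le (q.w x)
  have h2 := mul_le_of_le_one_right (sq_nonneg (q.u x)) (cos_half_sq_le_one (q.w x))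
  simp only [Pi.add_apply]
  linarith [sq_nonneg (q.w x)]

/-- Bounds that are propagated by the equations: `c ≤ v ≤ V`, energy at most `E`, `|u| ≤ ρ`. -/
structure Tame (c V E ρ : ℝ) (q : X) : Prop where
  pos : 0 < c
  le_v : ∀ᵐ x, c ≤ q.v x
  v_le : ∀ᵐ x, |q.v x| ≤ V
  energy_le : q.energy ≤ E
  u_le : ∀ᵐ x, |q.u x| ≤ ρ

namespace Tame

variable {c V E ρ K : ℝ} {q : X} {f g : ℝ → ℝ}

theorem energyDensity_nonneg (h : Tame c V E ρ q) : ∀ᵐ x, 0 ≤ q.energyDensity x := by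
  filter_upwards [h.le_v] with x hx
  exact mul_nonneg (by positivity) (h.pos.le.trans hx)

theorem energy_nonneg (h : Tame c V E ρ q) : 0 ≤ E :=
  (integral_nonneg_of_ae h.energyDensity_nonneg).trans h.energy_le

theorem v_nonneg (h : Tame c V E ρ q) : 0 ≤ V := by
  obtain ⟨x, hx⟩ := h.v_le.exists
  exact (abs_nonneg _).trans hx

theorem u_nonneg (h : Tame c V E ρ q) : 0 ≤ ρ := by
  obtain ⟨x, hx⟩ := h.u_le.exists
  exact (abs_nonneg _).trans hx

theorem sin_sq_le (h : Tame c V E ρ q) :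
    ∀ᵐ x, Real.sin (q.w x / 2) ^ 2 * q.v x ≤ q.energyDensity x := by
  filter_upwards [h.le_v] with x hx
  refine mul_le_mul_of_nonneg_right ?_ (h.pos.le.trans hx)
  have := mul_nonneg (sq_nonneg (q.u x)) (sq_nonneg (Real.cos (q.w x / 2)))
  linarith

theorem integrable_sin_sq (h : Tame c V E ρ q) :
    Integrable fun x => Real.sin (q.w x / 2) ^ 2 * q.v x := by
  have h2 := q.stronglyMeasurable_w.measurable
  have h3 := q.stronglyMeasurable_v.measurable
  refine q.integrable_energyDensity.mono' (by fun_prop) ?_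
  filter_upwards [h.le_v, h.sin_sq_le] with x hx hs
  rwa [Real.norm_of_nonneg (mul_nonneg (sq_nonneg _) (h.pos.le.trans hx))]

theorem integral_sin_sq_le (h : Tame c V E ρ q) :
    ∫ x, Real.sin (q.w x / 2) ^ 2 * q.v x ≤ E :=
  (integral_mono_ae h.integrable_sin_sq q.integrable_energyDensity h.sin_sq_le).trans h.energy_le

theorem isWeight (h : Tame c V E ρ q) : IsWeight c E q.weight :=
  isWeight_of_le h.pos h.le_v h.integrable_sin_sq h.integral_sin_sq_le

/-- The energy controls `|u| cos² (w / 2) + sin² (w / 2)` in `L²`. -/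
theorem l2Le_main (h : Tame c V E ρ q) :
    L2Le (fun x => |q.u x| * Real.cos (q.w x / 2) ^ 2 + Real.sin (q.w x / 2) ^ 2)
      (2 * E / c + 1) := by
  have h1 := q.stronglyMeasurable_u.measurable
  have h2 := q.stronglyMeasurable_w.measurable
  have hc := h.pos
  have hE := h.energy_nonneg
  have hm : Measurable fun x =>
      |q.u x| * Real.cos (q.w x / 2) ^ 2 + Real.sin (q.w x / 2) ^ 2 := by
    have : Measurable fun x => |q.u x| := measurable_norm.comp h1
    fun_prop
  have hle : ∀ᵐ x, (|q.u x| * Real.cos (q.w x / 2) ^ 2 + Real.sin (q.w x / 2) ^ 2) ^ 2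
      ≤ 2 / c * q.energyDensity x := by
    filter_upwards [h.le_v] with x hx
    rw [X.energyDensity, ← sq_abs (q.u x)]
    set a := |q.u x|
    have c1 := cos_half_sq_le_one (q.w x)
    have s1 := sin_half_sq_le_one (q.w x)
    set C := Real.cos (q.w x / 2) ^ 2 with hC
    set S := Real.sin (q.w x / 2) ^ 2 with hS
    have C0 : 0 ≤ C := sq_nonneg _
    have S0 : 0 ≤ S := sq_nonneg _
    have e1 : (a * C) ^ 2 ≤ a ^ 2 * C := by
      have := mul_le_mul_of_nonneg_left (mul_le_of_le_one_left C0 c1) (sq_nonneg a)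
      linarith
    have e2 : S ^ 2 ≤ S := by
      have := mul_le_of_le_one_left S0 s1
      linarith
    have e3 : (a * C + S) ^ 2 ≤ 2 * (a ^ 2 * C + S) := by
      linarith [sq_nonneg (a * C - S)]
    have e4 : 0 ≤ a ^ 2 * C + S := by positivity
    calc (a * C + S) ^ 2 ≤ 2 * (a ^ 2 * C + S) := e3
      _ = 2 / c * ((a ^ 2 * C + S) * c) := by field_simp
      _ ≤ 2 / c * ((a ^ 2 * C + S) * q.v x) :=
        mul_le_mul_of_nonneg_left (mul_le_mul_of_nonneg_left hx e4) (by positivity)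
  have hi : Integrable fun x =>
      (|q.u x| * Real.cos (q.w x / 2) ^ 2 + Real.sin (q.w x / 2) ^ 2) ^ 2 := by
    refine (q.integrable_energyDensity.const_mul (2 / c)).mono'
      (hm.pow_const 2).aestronglyMeasurable (hle.mono fun x hx => ?_)
    rwa [Real.norm_of_nonneg (sq_nonneg _)]
  refine L2Le.of_integral_sq hm.aestronglyMeasurable hi (by positivity) ?_
  refine (integral_mono_ae hi (q.integrable_energyDensity.const_mul (2 / c)) hle).trans ?_
  rw [integral_const_mul]
  have e1 : 2 / c * q.energy ≤ 2 / c * E := mul_le_mul_of_nonneg_left h.energy_le (by positivity)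
  have e2 : 2 / c * E = 2 * E / c := by ring
  have e3 : 0 ≤ 2 * E / c := by positivity
  have e4 : (∫ x, q.energyDensity x) = q.energy := rfl
  rw [e4]
  nlinarith

theorem abs_density_le (hK : NonlinBound f g ρ K) (h : Tame c V E ρ q) :
    ∀ᵐ x, |q.density f g x|
      ≤ K * (|q.u x| * Real.cos (q.w x / 2) ^ 2 + Real.sin (q.w x / 2) ^ 2) * q.v x := by
  filter_upwards [h.le_v, h.u_le] with x hx hu
  have hv := h.pos.le.trans hx
  rw [X.density, abs_mul, abs_of_nonneg hv]
  refine mul_le_mul_of_nonneg_right ((abs_add_le _ _).trans ?_) hv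
  rw [abs_mul, abs_mul, abs_of_nonneg (sq_nonneg (Real.cos _)),
    abs_of_nonneg (sq_nonneg (Real.sin _)), abs_div, abs_two]
  have e1 := mul_le_mul_of_nonneg_right (hK.g_le _ hu) (sq_nonneg (Real.cos (q.w x / 2)))
  have e2 : |deriv (deriv f) (q.u x)| / 2 ≤ K := by
    linarith [hK.F_le _ hu, abs_nonneg (deriv (deriv f) (q.u x))]
  have e3 := mul_le_mul_of_nonneg_right e2 (sq_nonneg (Real.sin (q.w x / 2)))
  linarith

theorem l2Le_density (hf : ContDiff ℝ ∞ f) (hg : ContDiff ℝ ∞ g) (hK : NonlinBound f g ρ K)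
    (h : Tame c V E ρ q) : L2Le (q.density f g) (K * V * (2 * E / c + 1)) := by
  have hK0 := hK.nonneg
  have hV := h.v_nonneg
  refine ((h.l2Le_main.const_mul (K * V)).mono_ae
    (q.measurable_density hf hg).aestronglyMeasurable ?_).weaken
    (by rw [abs_of_nonneg (by positivity)])
  filter_upwards [h.abs_density_le hK, h.v_le] with x h1 h2
  refine h1.trans ?_
  have := mul_le_mul_of_nonneg_left ((le_abs_self _).trans h2) (by positivity :
    0 ≤ K * (|q.u x| * Real.cos (q.w x / 2) ^ 2 + Real.sin (q.w x / 2) ^ 2))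
  linarith

/-- A bound for the nonlocal terms by the energy and the sup norm of `u` only. -/
theorem partsSum_le (hf : ContDiff ℝ ∞ f) (hg : ContDiff ℝ ∞ g) (hK : NonlinBound f g ρ K)
    (h : Tame c V E ρ q) (Z : ℝ) :
    partsSum q.weight (q.density f g) Z ≤ 2 * (K * ρ) + K * E := by
  have hK0 := hK.nonneg
  have hρ := h.u_nonneg
  refine (h.isWeight.abs_parts_le_of_le (h.l2Le_density hf hg hK).memLp (G := K * ρ)
    (b := fun x => K * (Real.sin (q.w x / 2) ^ 2 * q.v x)) (by positivity)
    (h.integrable_sin_sq.const_mul K) ?_ ?_ Z).trans ?_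
  · filter_upwards [h.le_v] with x hx
    have := h.pos.le.trans hx
    positivity
  · filter_upwards [h.abs_density_le hK, h.le_v, h.u_le] with x h1 h2 h3
    refine h1.trans ?_
    have hv := h.pos.le.trans h2
    have := mul_le_mul_of_nonneg_left h3 (by positivity :
      0 ≤ K * (Real.cos (q.w x / 2) ^ 2 * q.v x))
    rw [X.weight]
    linarith
  · rw [integral_const_mul]
    have := mul_le_mul_of_nonneg_left h.integral_sin_sq_le hK0
    linarith

/-- The right-hand side is bounded in `X` in terms of the propagated bounds. -/
theorem norm_rhs_le (hf : ContDiff ℝ ∞ f) (hg : ContDiff ℝ ∞ g) (hK : NonlinBound f g ρ K)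
    (c V E : ℝ) : ∃ S : ℝ, ∀ q d : X, Tame c V E ρ q → IsRHS f g q d → ‖d‖ ≤ S := by
  obtain ⟨N, hN⟩ : ∃ N, N = 2 * E / c + 1 := ⟨_, rfl⟩
  obtain ⟨N1, hN1⟩ : ∃ N, N = K * V * (2 * E / c + 1) := ⟨_, rfl⟩
  obtain ⟨N2, hN2⟩ : ∃ x, x = Real.exp E * ((expMass c + 1) * N1) := ⟨_, rfl⟩
  obtain ⟨B, hB⟩ : ∃ x, x = 2 * (K * ρ) + K * E := ⟨_, rfl⟩
  refine ⟨N2 + (N1 + V * N2) + (2 * K * N + 2 * N2) + (2 * K * ρ + 2 * B + 2 * K)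
    + (K * ρ + B + K) * V, fun q d h hd => ?_⟩
  have hK0 := hK.nonneg
  have hV := h.v_nonneg
  have hρ := h.u_nonneg
  have hE := h.energy_nonneg
  have hW := h.isWeight
  have hh := h.l2Le_density hf hg hK
  have hm := h.l2Le_main
  have hT := hW.l2Le_partsSum hh
  have hTs := h.partsSum_le hf hg hK
  rw [← hN1] at hh hT
  rw [← hN] at hm
  rw [← hN2] at hT
  rw [← hB] at hTs
  have hP := hW.abs_nonlocalP_le hh.memLp
  have hN0 := hm.nonneg
  have hN10 := hh.nonneg
  have hN20 := hT.nonneg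
  have hB0 : 0 ≤ B := by rw [hB]; positivity
  have p1 : 0 ≤ V * N2 := by positivity
  have p2 : 0 ≤ 2 * K * N + 2 * N2 := by positivity
  have p3 : 0 ≤ 2 * K * ρ + 2 * B + 2 * K := by positivity
  have p4 : 0 ≤ (K * ρ + B + K) * V := by positivity
  have hwle : ∀ᵐ Z, |d.w Z| ≤ 2 * K * (|q.u Z| * Real.cos (q.w Z / 2) ^ 2
      + Real.sin (q.w Z / 2) ^ 2) + 2 * partsSum q.weight (q.density f g) Z := by
    filter_upwards [hd.w_eq, h.u_le] with Z h1 h2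
    rw [h1]
    refine (abs_sub _ _).trans ?_
    rw [abs_mul, abs_mul, abs_mul, abs_two, abs_of_nonneg (sq_nonneg (Real.cos _)),
      abs_of_nonneg (sq_nonneg (Real.sin _))]
    have e1 : |g (q.u Z) - nonlocalP f g q Z| * Real.cos (q.w Z / 2) ^ 2
        ≤ K * |q.u Z| * Real.cos (q.w Z / 2) ^ 2 + partsSum q.weight (q.density f g) Z := by
      have e2 := mul_le_mul_of_nonneg_right (abs_sub (g (q.u Z)) (nonlocalP f g q Z))
        (sq_nonneg (Real.cos (q.w Z / 2)))
      have e3 := mul_le_mul_of_nonneg_right (hK.g_le _ h2) (sq_nonneg (Real.cos (q.w Z / 2)))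
      have e4 := mul_le_of_le_one_right (abs_nonneg (nonlocalP f g q Z))
        (cos_half_sq_le_one (q.w Z))
      linarith [hP Z]
    have e5 := mul_le_mul_of_nonneg_right (hK.F_le _ h2) (sq_nonneg (Real.sin (q.w Z / 2)))
    have e6 : 0 ≤ K * Real.sin (q.w Z / 2) ^ 2 := by positivity
    linarith
  refine X.norm_le ?_ ?_ ?_ ?_ ?_
  · refine (hT.mono_ae d.stronglyMeasurable_u.aestronglyMeasurable ?_).weaken (by linarith)
    filter_upwards [hd.u_eq] with Z hZ
    rw [hZ, abs_neg]
    exact abs_nonlocalPx_le f g q Z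
  · refine ((hh.abs.add (hT.const_mul V)).mono_ae d.stronglyMeasurable_p.aestronglyMeasurable
      ?_).weaken (by rw [abs_of_nonneg hV]; linarith)
    filter_upwards [hW.rhs_p_eq hh.memLp hd, h.v_le] with Z h1 h2
    rw [h1]
    refine (abs_sub _ _).trans ?_
    rw [abs_mul]
    have e1 : |q.weight Z| ≤ V := by
      rw [X.weight, abs_mul, abs_of_nonneg (sq_nonneg (Real.cos _))]
      exact (mul_le_of_le_one_right (abs_nonneg _) (cos_half_sq_le_one _)).trans h2
    exact add_le_add_right (mul_le_mul e1 (hP Z) (abs_nonneg _) hV) _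
  · refine (((hm.const_mul (2 * K)).add (hT.const_mul 2)).mono_ae
      d.stronglyMeasurable_w.aestronglyMeasurable hwle).weaken ?_
    rw [abs_of_nonneg (by positivity), abs_two]
    linarith
  · filter_upwards [hwle, h.u_le] with Z h1 h2
    refine h1.trans ?_
    have e1 := mul_le_mul h2 (cos_half_sq_le_one (q.w Z)) (sq_nonneg _) hρ
    have e2 := mul_le_mul_of_nonneg_left e1 hK0
    have e4 := mul_le_mul_of_nonneg_left (sin_half_sq_le_one (q.w Z)) hK0
    have e5 := hTs Z
    linarith
  · filter_upwards [hd.v_eq, h.u_le, h.v_le] with Z h1 h2 h3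
    rw [h1, abs_mul, abs_mul]
    have e1 := hK.abs_vfactor_le h2 ((hP Z).trans (hTs Z))
    have e2 := mul_le_mul e1 h3 (abs_nonneg _) ((abs_nonneg _).trans e1)
    have e3 := mul_le_of_le_one_right (by positivity :
      0 ≤ |g (q.u Z) - nonlocalP f g q Z + deriv (deriv f) (q.u Z) / 2| * |q.v Z|)
      (Real.abs_sin_le_one (q.w Z))
    linarith

end Tame

/-! ### Differentiation of functionals along curves in the phase space -/

/-- A functional on `X` that is linear up to a quadratic remainder is differentiated along curves by
its linear part. -/
theorem hasDerivWithinAt_of_quadratic {J ℓ : X → ℝ} {q d : X} {C t : ℝ} {U : ℝ → X} {I : Set ℝ}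
    (hadd : ∀ η θ, ℓ (η + θ) = ℓ η + ℓ θ) (hsmul : ∀ (k : ℝ) η, ℓ (k • η) = k * ℓ η)
    (hℓ : ∀ η, |ℓ η| ≤ C * ‖η‖) (hJ : ∀ η, ‖η‖ ≤ 1 → |J (q + η) - J q - ℓ η| ≤ C * ‖η‖ ^ 2)
    (hU : HasDerivWithinAt U d I t) (hq : U t = q) :
    HasDerivWithinAt (fun s => J (U s)) (ℓ d) I t := by
  let L : X →ₗ[ℝ] ℝ := ⟨⟨ℓ, hadd⟩, hsmul⟩
  have hF : HasFDerivAt J (L.mkContinuous C hℓ) q := by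
    rw [hasFDerivAt_iff_isLittleO_nhds_zero]
    have h1 : (fun η => J (q + η) - J q - L.mkContinuous C hℓ η) =O[𝓝 0] fun η : X => ‖η‖ ^ 2 := by
      refine Asymptotics.IsBigO.of_bound C ?_
      filter_upwards [Metric.closedBall_mem_nhds (0 : X) one_pos] with η hη
      rw [Real.norm_of_nonneg (sq_nonneg _)]
      exact hJ η (by simpa using hη)
    refine h1.trans_isLittleO ?_
    exact Asymptotics.isLittleO_norm_pow_id one_lt_two
  subst hq
  exact hF.comp_hasDerivWithinAt t hU

theorem abs_sub_le_sq_of_hasDerivAt {φ φ' : ℝ → ℝ} (h : ∀ x, HasDerivAt φ (φ' x) x)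
    (hL : ∀ x y, |φ' x - φ' y| ≤ |x - y|) (w b : ℝ) :
    |φ (w + b) - φ w - b * φ' w| ≤ b ^ 2 := by
  have h1 : ∀ x ∈ uIcc w (w + b),
      HasDerivWithinAt (fun x => φ x - φ' w * x) (φ' x - φ' w) (uIcc w (w + b)) x := fun x _ => by
    have h0 := (hasDerivAt_id x).const_mul (φ' w)
    rw [mul_one] at h0
    exact ((h x).sub h0).hasDerivWithinAt
  have h2 : ∀ x ∈ uIcc w (w + b), ‖φ' x - φ' w‖ ≤ |b| := fun x hx => by
    refine (hL x w).trans ?_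
    have := abs_sub_left_of_mem_uIcc hx
    simpa using this
  have h3 := (convex_uIcc w (w + b)).norm_image_sub_le_of_norm_hasDerivWithin_le h1 h2
    left_mem_uIcc right_mem_uIcc
  have h4 : φ (w + b) - φ' w * (w + b) - (φ w - φ' w * w) = φ (w + b) - φ w - b * φ' w := by ring
  rw [h4, add_sub_cancel_left, Real.norm_eq_abs, Real.norm_eq_abs, ← sq, sq_abs] at h3
  exact h3

theorem abs_sin_taylor (w b : ℝ) : |Real.sin (w + b) - Real.sin w - b * Real.cos w| ≤ b ^ 2 :=
  abs_sub_le_sq_of_hasDerivAt Real.hasDerivAt_sin Real.abs_cos_sub_cos_le w b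

theorem abs_cos_taylor (w b : ℝ) : |Real.cos (w + b) - Real.cos w + b * Real.sin w| ≤ b ^ 2 := by
  have := abs_sub_le_sq_of_hasDerivAt Real.hasDerivAt_cos (fun x y => by
    rw [neg_sub_neg, abs_sub_comm]; exact Real.abs_sin_sub_sin_le x y) w b
  simpa using this

/-- The defect in the relation `u_Z = (v sin w) / 2`. -/
noncomputable def X.defect (q : X) (x : ℝ) : ℝ := q.p x - 1 / 2 * (q.v x * Real.sin (q.w x))

theorem X.integrableOn_p (q : X) {s : Set ℝ} (hs : volume s < ⊤) : IntegrableOn q.p s := by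
  have : IsFiniteMeasure (volume.restrict s) := ⟨by simpa using hs⟩
  exact q.l2Le_p.memLp.restrict s |>.integrable (by norm_num)

theorem integrableOn_of_ae_bound {F : ℝ → ℝ} {C : ℝ} {s : Set ℝ} (hF : Measurable F)
    (hs : volume s < ⊤) (hC : ∀ᵐ x, |F x| ≤ C) : IntegrableOn F s :=
  IntegrableOn.of_bound hs hF.aestronglyMeasurable C (ae_restrict_of_ae hC)

theorem X.integrableOn_v_sin (q : X) {s : Set ℝ} (hs : volume s < ⊤) :
    IntegrableOn (fun x => q.v x * Real.sin (q.w x)) s := by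
  have h2 := q.stronglyMeasurable_w.measurable
  have h3 := q.stronglyMeasurable_v.measurable
  refine integrableOn_of_ae_bound (C := ‖q‖) (by fun_prop) hs ?_
  filter_upwards [q.ae_abs_v_le] with x hx
  rw [abs_mul]
  exact (mul_le_of_le_one_right (abs_nonneg _) (Real.abs_sin_le_one _)).trans hx

theorem X.integrableOn_defect (q : X) {s : Set ℝ} (hs : volume s < ⊤) :
    IntegrableOn q.defect s :=
  (q.integrableOn_p hs).sub ((q.integrableOn_v_sin hs).const_mul _)

/-- The derivative of the defect integrated over a set of finite measure. -/
theorem hasDerivWithinAt_integral_defect {U : ℝ → X} {d : X} {I s : Set ℝ} {t : ℝ}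
    (hsm : MeasurableSet s) (hs : volume s < ⊤) (hU : HasDerivWithinAt U d I t) :
    HasDerivWithinAt (fun τ => ∫ x in s, (U τ).defect x)
      (∫ x in s, (d.p x - 1 / 2 * (d.v x * Real.sin ((U t).w x)
        + (U t).v x * Real.cos ((U t).w x) * d.w x))) I t := by
  set q := U t with hq
  have mw := q.stronglyMeasurable_w.measurable
  have mv := q.stronglyMeasurable_v.measurable
  set V := volume.real s with hV
  have hV0 : 0 ≤ V := measureReal_nonneg
  have hsf : IsFiniteMeasure (volume.restrict s) := ⟨by simpa using hs⟩
  -- the linear part, away from `p`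
  have hB : ∀ η : X, ∀ᵐ x, |η.v x * Real.sin (q.w x) + q.v x * Real.cos (q.w x) * η.w x|
      ≤ (1 + ‖q‖) * ‖η‖ := fun η => by
    filter_upwards [η.ae_abs_v_le, η.ae_abs_w_le, q.ae_abs_v_le] with x h1 h2 h3
    refine (abs_add_le _ _).trans ?_
    rw [abs_mul, abs_mul, abs_mul]
    have e1 := (mul_le_of_le_one_right (abs_nonneg (η.v x))
      (Real.abs_sin_le_one (q.w x))).trans h1
    have e2 := mul_le_mul ((mul_le_of_le_one_right (abs_nonneg (q.v x))
      (Real.abs_cos_le_one (q.w x))).trans h3) h2 (abs_nonneg _) (norm_nonneg _)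
    linarith
  have hBi : ∀ η : X, IntegrableOn
      (fun x => η.v x * Real.sin (q.w x) + q.v x * Real.cos (q.w x) * η.w x) s := fun η => by
    have := η.stronglyMeasurable_w.measurable
    have := η.stronglyMeasurable_v.measurable
    exact integrableOn_of_ae_bound (by fun_prop) hs (hB η)
  have hℓi : ∀ η : X, IntegrableOn (fun x => η.p x - 1 / 2 * (η.v x * Real.sin (q.w x)
      + q.v x * Real.cos (q.w x) * η.w x)) s := fun η =>
    (η.integrableOn_p hs).sub ((hBi η).const_mul _)
  obtain ⟨A, hA⟩ : ∃ A, L2Le (s.indicator fun _ : ℝ => (1 : ℝ)) A :=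
    ⟨_, memLp_indicator_const 2 hsm 1 (Or.inr hs.ne), le_rfl⟩
  have hA0 := hA.nonneg
  have hp : ∀ η : X, |∫ x in s, η.p x| ≤ A * ‖η‖ := fun η => by
    refine le_trans ?_ (hA.integral_mul_le η.l2Le_p)
    rw [← integral_indicator hsm]
    refine abs_integral_le_integral_abs.trans (le_of_eq (integral_congr_ae (ae_of_all _ fun x => ?_)))
    by_cases hx : x ∈ s <;> simp [hx]
  have hle : ∀ {F : ℝ → ℝ} {k : ℝ}, (∀ᵐ x, |F x| ≤ k) → |∫ x in s, F x| ≤ k * V := fun {F} {k} hF =>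
    norm_setIntegral_le_of_norm_le_const_ae (f := F) hs (ae_restrict_of_ae hF)
  refine hasDerivWithinAt_of_quadratic (J := fun r => ∫ x in s, r.defect x)
    (ℓ := fun η => ∫ x in s, (η.p x - 1 / 2 * (η.v x * Real.sin (q.w x)
      + q.v x * Real.cos (q.w x) * η.w x))) (C := A + (1 + ‖q‖) * V) ?_ ?_ ?_ ?_ hU hq.symm
  · intro η θ
    rw [← integral_add (hℓi η) (hℓi θ)]
    refine integral_congr_ae (ae_restrict_of_ae ?_)
    filter_upwards [X.p_add η θ, X.w_add η θ, X.v_add η θ] with x h1 h2 h3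
    simp only [h1, h2, h3]
    ring
  · intro k η
    rw [← integral_const_mul]
    refine integral_congr_ae (ae_restrict_of_ae ?_)
    filter_upwards [X.p_smul η k, X.w_smul η k, X.v_smul η k] with x h1 h2 h3
    simp only [h1, h2, h3]
    ring
  · intro η
    rw [integral_sub (η.integrableOn_p hs) ((hBi η).const_mul _), integral_const_mul]
    have h1 := hle (hB η)
    have h2 := hp η
    refine (abs_sub _ _).trans ?_
    rw [abs_mul, abs_of_pos (by norm_num : (0 : ℝ) < 1 / 2)]
    linarith [abs_nonneg (∫ x in s, (η.v x * Real.sin (q.w x)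
      + q.v x * Real.cos (q.w x) * η.w x))]
  · intro η _
    have i0 : IntegrableOn (fun x => (q + η).defect x - q.defect x) s :=
      ((q + η).integrableOn_defect hs).sub (q.integrableOn_defect hs)
    rw [← integral_sub ((q + η).integrableOn_defect hs) (q.integrableOn_defect hs),
      ← integral_sub i0 (hℓi η)]
    have hr : ∀ᵐ x, |(q + η).defect x - q.defect x - (η.p x - 1 / 2 * (η.v x * Real.sin (q.w x)
        + q.v x * Real.cos (q.w x) * η.w x))| ≤ (1 + ‖q‖) * ‖η‖ ^ 2 := by
      filter_upwards [X.p_add q η, X.w_add q η, X.v_add q η, η.ae_abs_v_le, η.ae_abs_w_le,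
        q.ae_abs_v_le] with x h1 h2 h3 h4 h5 h6
      simp only [X.defect, h1, h2, h3]
      set v := q.v x
      set w := q.w x
      set a := η.v x
      set b := η.w x
      have e : q.p x + η.p x - 1 / 2 * ((v + a) * Real.sin (w + b))
          - (q.p x - 1 / 2 * (v * Real.sin w))
          - (η.p x - 1 / 2 * (a * Real.sin w + v * Real.cos w * b))
          = -(1 / 2 * (v * (Real.sin (w + b) - Real.sin w - b * Real.cos w)
            + a * (Real.sin (w + b) - Real.sin w))) := by ring
      have h7 := abs_sin_taylor w b
      have h8 := Real.abs_sin_sub_sin_le (w + b) w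
      rw [add_sub_cancel_left] at h8
      have h9 : b ^ 2 ≤ ‖η‖ ^ 2 := by
        rw [← sq_abs b]
        exact pow_le_pow_left₀ (abs_nonneg _) h5 2
      rw [e, abs_neg, abs_mul, abs_of_pos (by norm_num : (0 : ℝ) < 1 / 2)]
      have h10 := abs_add_le (v * (Real.sin (w + b) - Real.sin w - b * Real.cos w))
        (a * (Real.sin (w + b) - Real.sin w))
      rw [abs_mul, abs_mul] at h10
      have h11 := mul_le_mul h6 (h7.trans h9) (abs_nonneg _) (norm_nonneg _)
      have h12 := mul_le_mul h4 (h8.trans h5) (abs_nonneg _) (norm_nonneg _)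
      have h13 : 0 ≤ ‖q‖ * ‖η‖ ^ 2 := by positivity
      have h14 : 0 ≤ ‖η‖ ^ 2 := by positivity
      rw [← sq] at h12
      linarith
    refine (hle hr).trans ?_
    have : 0 ≤ A * ‖η‖ ^ 2 := by positivity
    linarith

/-- The derivative of `v` integrated over a set of finite measure. -/
theorem hasDerivWithinAt_integral_v {U : ℝ → X} {d : X} {I s : Set ℝ} {t : ℝ}
    (hs : volume s < ⊤) (hU : HasDerivWithinAt U d I t) :
    HasDerivWithinAt (fun τ => ∫ x in s, (U τ).v x) (∫ x in s, d.v x) I t := by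
  have hi : ∀ η : X, IntegrableOn η.v s := fun η =>
    integrableOn_of_ae_bound η.stronglyMeasurable_v.measurable hs η.ae_abs_v_le
  have hadd : ∀ η θ : X, ∫ x in s, (η + θ).v x = (∫ x in s, η.v x) + ∫ x in s, θ.v x :=
    fun η θ => by
      rw [← integral_add (hi η) (hi θ)]
      exact integral_congr_ae (ae_restrict_of_ae (X.v_add η θ))
  refine hasDerivWithinAt_of_quadratic (J := fun r => ∫ x in s, r.v x)
    (ℓ := fun η => ∫ x in s, η.v x) (C := volume.real s) hadd ?_ ?_ ?_ hU rfl
  · intro k η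
    rw [← integral_const_mul]
    exact integral_congr_ae (ae_restrict_of_ae (X.v_smul η k))
  · intro η
    rw [mul_comm]
    exact norm_setIntegral_le_of_norm_le_const_ae (f := η.v) hs (ae_restrict_of_ae η.ae_abs_v_le)
  · intro η _
    simp only [hadd, add_sub_cancel_left, sub_self, abs_zero]
    positivity

/-- Second order Taylor remainder of `(u, w) ↦ u² cos² (w / 2) + sin² (w / 2)`. -/
theorem abs_energy_taylor {u w a b ρ : ℝ} (hu : |u| ≤ ρ) (ha : |a| ≤ 2) :
    |((u + a) ^ 2 * Real.cos ((w + b) / 2) ^ 2 + Real.sin ((w + b) / 2) ^ 2)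
      - (u ^ 2 * Real.cos (w / 2) ^ 2 + Real.sin (w / 2) ^ 2)
      - (2 * u * Real.cos (w / 2) ^ 2 * a + 1 / 2 * (1 - u ^ 2) * Real.sin w * b)|
      ≤ ((ρ + 2) ^ 2 + ρ + 3) * (a ^ 2 + b ^ 2) := by
  have hρ : 0 ≤ ρ := (abs_nonneg _).trans hu
  have c1 : ∀ z : ℝ, Real.cos (z / 2) ^ 2 = 1 / 2 + Real.cos z / 2 := fun z => by
    rw [Real.cos_sq]; ring_nf
  rw [Real.sin_sq, Real.sin_sq, c1, c1]
  set T := Real.cos (w + b) - Real.cos w + b * Real.sin w with hT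
  have hTle : |T| ≤ b ^ 2 := abs_cos_taylor w b
  have e : ((u + a) ^ 2 * (1 / 2 + Real.cos (w + b) / 2) + (1 - (1 / 2 + Real.cos (w + b) / 2)))
      - (u ^ 2 * (1 / 2 + Real.cos w / 2) + (1 - (1 / 2 + Real.cos w / 2)))
      - (2 * u * (1 / 2 + Real.cos w / 2) * a + 1 / 2 * (1 - u ^ 2) * Real.sin w * b)
      = ((u + a) ^ 2 - 1) / 2 * T + a ^ 2 * ((1 + Real.cos w) / 2)
        - (u + a / 2) * (a * b) * Real.sin w := by
    rw [hT]; ring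
  rw [e]
  have h1 : |((u + a) ^ 2 - 1) / 2| ≤ (ρ + 2) ^ 2 + 1 := by
    have h2 : (u + a) ^ 2 ≤ (ρ + 2) ^ 2 := by
      rw [← sq_abs]
      exact pow_le_pow_left₀ (abs_nonneg _) ((abs_add_le u a).trans (add_le_add hu ha)) 2
    rw [abs_le]
    constructor <;> linarith [sq_nonneg (u + a), sq_nonneg (ρ + 2)]
  have h2 : |(1 + Real.cos w) / 2| ≤ 1 := by
    rw [abs_le]
    constructor <;> linarith [Real.cos_le_one w, Real.neg_one_le_cos w]
  have h3 : |u + a / 2| ≤ ρ + 1 := by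
    have := abs_add_le u (a / 2)
    rw [abs_div, abs_two] at this
    linarith
  have h4 : |a * b| ≤ a ^ 2 + b ^ 2 := by
    rw [abs_le]
    constructor <;> nlinarith [sq_nonneg (a + b), sq_nonneg (a - b)]
  have e1 := mul_le_mul h1 hTle (abs_nonneg _) (by positivity)
  have e2 := mul_le_mul_of_nonneg_left h2 (sq_nonneg a)
  have e3 := mul_le_mul h3 h4 (abs_nonneg _) (by positivity)
  have e4 : |(u + a / 2) * (a * b) * Real.sin w| ≤ (ρ + 1) * (a ^ 2 + b ^ 2) := by
    rw [abs_mul, abs_mul]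
    exact (mul_le_of_le_one_right (by positivity) (Real.abs_sin_le_one w)).trans e3
  have e5 := abs_add_le (((u + a) ^ 2 - 1) / 2 * T) (a ^ 2 * ((1 + Real.cos w) / 2))
  have e6 := abs_sub (((u + a) ^ 2 - 1) / 2 * T + a ^ 2 * ((1 + Real.cos w) / 2))
    ((u + a / 2) * (a * b) * Real.sin w)
  rw [abs_mul, abs_mul, abs_of_nonneg (sq_nonneg a)] at e5
  have e7 : 0 ≤ ((ρ + 2) ^ 2 + 1) * a ^ 2 := by positivity
  have e8 : 0 ≤ b ^ 2 := sq_nonneg b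
  linarith

/-- The derivative of the energy along a curve. -/
theorem hasDerivWithinAt_energy {U : ℝ → X} {d : X} {I : Set ℝ} {t : ℝ}
    (hU : HasDerivWithinAt U d I t) :
    HasDerivWithinAt (fun τ => (U τ).energy)
      (∫ x, ((2 * (U t).u x * Real.cos ((U t).w x / 2) ^ 2 * d.u x
          + 1 / 2 * (1 - (U t).u x ^ 2) * Real.sin ((U t).w x) * d.w x) * (U t).v x
        + ((U t).u x ^ 2 * Real.cos ((U t).w x / 2) ^ 2 + Real.sin ((U t).w x / 2) ^ 2)
          * d.v x)) I t := by
  set q := U t with hq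
  have mu := q.stronglyMeasurable_u.measurable
  have mw := q.stronglyMeasurable_w.measurable
  have mv := q.stronglyMeasurable_v.measurable
  obtain ⟨N, hN⟩ : ∃ N, N = ‖q‖ := ⟨_, rfl⟩
  have hN0 : 0 ≤ N := by rw [hN]; exact norm_nonneg _
  have qu := q.l2Le_u
  have qw := q.l2Le_w
  rw [← hN] at qu qw
  -- the bound for the first order part in `(u, w)`
  have hlin : ∀ η : X, ∀ᵐ x, |2 * q.u x * Real.cos (q.w x / 2) ^ 2 * η.u x
      + 1 / 2 * (1 - q.u x ^ 2) * Real.sin (q.w x) * η.w x|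
      ≤ 2 * |q.u x * η.u x| + (1 + (2 * N) ^ 2) * |q.w x * η.w x| := fun η => by
    filter_upwards [q.ae_abs_u_le] with x hx
    rw [← hN] at hx
    refine (abs_add_le _ _).trans (add_le_add ?_ ?_)
    · have : 2 * q.u x * Real.cos (q.w x / 2) ^ 2 * η.u x
          = 2 * (q.u x * η.u x) * Real.cos (q.w x / 2) ^ 2 := by ring
      rw [this, abs_mul, abs_mul, abs_two, abs_of_nonneg (sq_nonneg (Real.cos _))]
      exact mul_le_of_le_one_right (by positivity) (cos_half_sq_le_one _)
    · rw [abs_mul, abs_mul, abs_mul, abs_mul]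
      have e1 : |(1 : ℝ) / 2| * |1 - q.u x ^ 2| ≤ 1 + (2 * N) ^ 2 := by
        have h1 : q.u x ^ 2 ≤ (2 * N) ^ 2 := by
          rw [← sq_abs]
          exact pow_le_pow_left₀ (abs_nonneg _) hx 2
        have h2 := abs_sub 1 (q.u x ^ 2)
        rw [abs_one, abs_of_nonneg (sq_nonneg (q.u x))] at h2
        rw [abs_of_pos (by norm_num : (0 : ℝ) < 1 / 2)]
        linarith [abs_nonneg (1 - q.u x ^ 2)]
      have e2 := mul_le_mul e1 (Real.abs_sin_le_abs (x := q.w x)) (abs_nonneg _) (by positivity)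
      calc _ ≤ (1 + (2 * N) ^ 2) * |q.w x| * |η.w x| :=
            mul_le_mul_of_nonneg_right e2 (abs_nonneg _)
        _ = _ := by ring
  have hzero : ∀ x, q.u x ^ 2 * Real.cos (q.w x / 2) ^ 2 + Real.sin (q.w x / 2) ^ 2
      ≤ q.u x ^ 2 + q.w x ^ 2 := fun x => by
    have h1 := sin_half_sq_le (q.w x)
    have h2 := mul_le_of_le_one_right (sq_nonneg (q.u x)) (cos_half_sq_le_one (q.w x))
    linarith [sq_nonneg (q.w x)]
  set ℓd : X → ℝ → ℝ := fun η x => (2 * q.u x * Real.cos (q.w x / 2) ^ 2 * η.u x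
      + 1 / 2 * (1 - q.u x ^ 2) * Real.sin (q.w x) * η.w x) * q.v x
    + (q.u x ^ 2 * Real.cos (q.w x / 2) ^ 2 + Real.sin (q.w x / 2) ^ 2) * η.v x with hℓd
  have hmaj : ∀ η : X, Integrable (fun x => (2 * |q.u x * η.u x|
      + (1 + (2 * N) ^ 2) * |q.w x * η.w x|) * N + (q.u x ^ 2 + q.w x ^ 2) * ‖η‖) := fun η =>
    ((((qu.integrable_mul η.l2Le_u).abs.const_mul 2).add
      ((qw.integrable_mul η.l2Le_w).abs.const_mul _)).mul_const N).add
      ((qu.integrable_sq.add qw.integrable_sq).mul_const ‖η‖)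
  have hlini : ∀ η : X, Integrable fun x => 2 * |q.u x * η.u x|
      + (1 + (2 * N) ^ 2) * |q.w x * η.w x| := fun η =>
    ((qu.integrable_mul η.l2Le_u).abs.const_mul 2).add
      ((qw.integrable_mul η.l2Le_w).abs.const_mul _)
  have hlinI : ∀ η : X, ∫ x, (2 * |q.u x * η.u x| + (1 + (2 * N) ^ 2) * |q.w x * η.w x|)
      = 2 * (∫ x, |q.u x * η.u x|) + (1 + (2 * N) ^ 2) * ∫ x, |q.w x * η.w x| := fun η => by
    rw [integral_add ((qu.integrable_mul η.l2Le_u).abs.const_mul 2)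
      ((qw.integrable_mul η.l2Le_w).abs.const_mul _), integral_const_mul, integral_const_mul]
  have hle : ∀ η : X, ∀ᵐ x, |ℓd η x| ≤ (2 * |q.u x * η.u x|
      + (1 + (2 * N) ^ 2) * |q.w x * η.w x|) * N + (q.u x ^ 2 + q.w x ^ 2) * ‖η‖ := fun η => by
    filter_upwards [hlin η, q.ae_abs_v_le, η.ae_abs_v_le] with x h1 h2 h3
    rw [← hN] at h2
    refine (abs_add_le _ _).trans ?_
    rw [abs_mul, abs_mul _ (η.v x)]
    refine add_le_add (mul_le_mul h1 h2 (abs_nonneg _) (by positivity)) ?_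
    refine mul_le_mul ?_ h3 (abs_nonneg _) (by positivity)
    rw [abs_of_nonneg (by positivity)]
    exact hzero x
  have hℓi : ∀ η : X, Integrable (ℓd η) := fun η => by
    have := η.stronglyMeasurable_u.measurable
    have := η.stronglyMeasurable_w.measurable
    have := η.stronglyMeasurable_v.measurable
    exact (hmaj η).mono' (by fun_prop) (hle η)
  have hcs : ∀ η : X, (∫ x, |q.u x * η.u x|) ≤ N * ‖η‖ ∧ (∫ x, |q.w x * η.w x|) ≤ N * ‖η‖ :=
    fun η => ⟨qu.integral_mul_le η.l2Le_u, qw.integral_mul_le η.l2Le_w⟩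
  obtain ⟨C1, hC1⟩ : ∃ C, C = (2 * N + (1 + (2 * N) ^ 2) * N) * (N + 1) + 2 * N ^ 2 := ⟨_, rfl⟩
  obtain ⟨C2, hC2⟩ : ∃ C, C = (2 * N + 2) ^ 2 + 2 * N + 3 := ⟨_, rfl⟩
  have hC10 : 0 ≤ C1 := by rw [hC1]; positivity
  have hC20 : 0 ≤ C2 := by rw [hC2]; positivity
  refine hasDerivWithinAt_of_quadratic (J := X.energy) (ℓ := fun η => ∫ x, ℓd η x)
    (C := C1 + C2 * 2 * (N + 1)) ?_ ?_ ?_ ?_ hU hq.symm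
  · intro η θ
    rw [← integral_add (hℓi η) (hℓi θ)]
    refine integral_congr_ae ?_
    filter_upwards [X.u_add η θ, X.w_add η θ, X.v_add η θ] with x h1 h2 h3
    simp only [hℓd, h1, h2, h3]
    ring
  · intro k η
    rw [← integral_const_mul]
    refine integral_congr_ae ?_
    filter_upwards [X.u_smul η k, X.w_smul η k, X.v_smul η k] with x h1 h2 h3
    simp only [hℓd, h1, h2, h3]
    ring
  · intro η
    have h1 : |∫ x, ℓd η x| ≤ _ := abs_integral_le_integral_abs.trans
      (integral_mono_ae (hℓi η).abs (hmaj η) (hle η))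
    have i1 : Integrable fun x => (2 * |q.u x * η.u x|
        + (1 + (2 * N) ^ 2) * |q.w x * η.w x|) * N := (hlini η).mul_const N
    have i2 : Integrable fun x => (q.u x ^ 2 + q.w x ^ 2) * ‖η‖ :=
      (qu.integrable_sq.add qw.integrable_sq).mul_const ‖η‖
    rw [integral_add i1 i2, integral_mul_const, integral_mul_const, hlinI,
      integral_add qu.integrable_sq qw.integrable_sq] at h1
    obtain ⟨h2, h3⟩ := hcs η
    have h4 := qu.integral_sq_le
    have h5 := qw.integral_sq_le
    have hη := norm_nonneg η
    have e1 : (2 * (∫ x, |q.u x * η.u x|) + (1 + (2 * N) ^ 2) * ∫ x, |q.w x * η.w x|) * N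
        ≤ (2 * (N * ‖η‖) + (1 + (2 * N) ^ 2) * (N * ‖η‖)) * N := by gcongr
    have e2 : ((∫ x, q.u x ^ 2) + ∫ x, q.w x ^ 2) * ‖η‖ ≤ (N ^ 2 + N ^ 2) * ‖η‖ := by gcongr
    have e3 : 0 ≤ (2 * N + (1 + (2 * N) ^ 2) * N) * ‖η‖ := by positivity
    have e4 : 0 ≤ C2 * 2 * (N + 1) * ‖η‖ := by positivity
    rw [hC1]
    linarith
  · intro η hη1
    have hη := norm_nonneg η
    obtain ⟨h2, h3⟩ := hcs η
    have i0 : Integrable fun x => (q + η).energyDensity x - q.energyDensity x :=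
      (q + η).integrable_energyDensity.sub q.integrable_energyDensity
    rw [X.energy, X.energy, ← integral_sub (q + η).integrable_energyDensity
      q.integrable_energyDensity, ← integral_sub i0 (hℓi η)]
    have hr : ∀ᵐ x, |(q + η).energyDensity x - q.energyDensity x - ℓd η x|
        ≤ C2 * (N + 1) * (η.u x ^ 2 + η.w x ^ 2) + (2 * |q.u x * η.u x|
          + (1 + (2 * N) ^ 2) * |q.w x * η.w x|) * ‖η‖ := by
      filter_upwards [X.u_add q η, X.w_add q η, X.v_add q η, η.ae_abs_u_le, η.ae_abs_v_le,
        q.ae_abs_v_le, q.ae_abs_u_le, hlin η] with x k1 k2 k3 k4 k5 k6 k7 k8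
      rw [← hN] at k6 k7
      have k9 := abs_energy_taylor (w := q.w x) (b := η.w x) k7 (by linarith : |η.u x| ≤ 2)
      rw [← hC2] at k9
      simp only [X.energyDensity, hℓd, k1, k2, k3]
      set B1 := (q.u x + η.u x) ^ 2 * Real.cos ((q.w x + η.w x) / 2) ^ 2
        + Real.sin ((q.w x + η.w x) / 2) ^ 2
      set B0 := q.u x ^ 2 * Real.cos (q.w x / 2) ^ 2 + Real.sin (q.w x / 2) ^ 2
      set Λ := 2 * q.u x * Real.cos (q.w x / 2) ^ 2 * η.u x
        + 1 / 2 * (1 - q.u x ^ 2) * Real.sin (q.w x) * η.w x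
      have e : B1 * (q.v x + η.v x) - B0 * q.v x - (Λ * q.v x + B0 * η.v x)
          = (B1 - B0 - Λ) * (q.v x + η.v x) + Λ * η.v x := by ring
      rw [e]
      refine (abs_add_le _ _).trans ?_
      rw [abs_mul, abs_mul]
      have e1 : |q.v x + η.v x| ≤ N + 1 := (abs_add_le _ _).trans (by linarith)
      have e2 := mul_le_mul k9 e1 (abs_nonneg _) (by positivity)
      have e3 := mul_le_mul k8 k5 (abs_nonneg _) (by positivity)
      linarith
    have i1 : Integrable fun x => C2 * (N + 1) * (η.u x ^ 2 + η.w x ^ 2) :=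
      (η.l2Le_u.integrable_sq.add η.l2Le_w.integrable_sq).const_mul _
    have i2 : Integrable fun x => (2 * |q.u x * η.u x|
        + (1 + (2 * N) ^ 2) * |q.w x * η.w x|) * ‖η‖ := (hlini η).mul_const _
    have h1 : |∫ x, ((q + η).energyDensity x - q.energyDensity x - ℓd η x)|
        ≤ ∫ x, (C2 * (N + 1) * (η.u x ^ 2 + η.w x ^ 2)
          + (2 * |q.u x * η.u x| + (1 + (2 * N) ^ 2) * |q.w x * η.w x|) * ‖η‖) :=
      abs_integral_le_integral_abs.trans (integral_mono_ae (i0.sub (hℓi η)).abs (i1.add i2) hr)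
    refine h1.trans ?_
    rw [integral_add i1 i2, integral_const_mul, integral_mul_const, hlinI,
      integral_add η.l2Le_u.integrable_sq η.l2Le_w.integrable_sq]
    have h4 := η.l2Le_u.integral_sq_le
    have h5 := η.l2Le_w.integral_sq_le
    have e1 : (2 * (∫ x, |q.u x * η.u x|) + (1 + (2 * N) ^ 2) * ∫ x, |q.w x * η.w x|) * ‖η‖
        ≤ (2 * (N * ‖η‖) + (1 + (2 * N) ^ 2) * (N * ‖η‖)) * ‖η‖ := by gcongr
    have e2 : C2 * (N + 1) * ((∫ x, η.u x ^ 2) + ∫ x, η.w x ^ 2)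
        ≤ C2 * (N + 1) * (‖η‖ ^ 2 + ‖η‖ ^ 2) := by gcongr
    have e3 : 0 ≤ ((2 * N + (1 + (2 * N) ^ 2) * N) * N + 2 * N ^ 2) * ‖η‖ ^ 2 := by positivity
    rw [hC1]
    linarith

/-! ### Conservation laws and a priori bounds -/

section Algebra

variable {f g : ℝ → ℝ} {q d : X} {c M : ℝ}

/-- The relation `u_Z = (v sin w) / 2` is preserved by the equations: its time derivative vanishes,
whether or not the relation holds. -/
theorem IsWeight.ae_defect_deriv_eq_zero (ha : IsWeight c M q.weight)
    (hh : MemLp (q.density f g) 2 volume) (hd : IsRHS f g q d) :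
    ∀ᵐ x, d.p x - 1 / 2 * (d.v x * Real.sin (q.w x) + q.v x * Real.cos (q.w x) * d.w x) = 0 := by
  filter_upwards [ha.rhs_p_eq hh hd, hd.v_eq, hd.w_eq] with x h1 h2 h3
  rw [h1, h2, h3, X.density, X.weight]
  have e1 : Real.sin (q.w x) = 2 * Real.sin (q.w x / 2) * Real.cos (q.w x / 2) := by
    rw [← Real.sin_two_mul, mul_div_cancel₀ _ two_ne_zero]
  have e2 : Real.cos (q.w x) = Real.cos (q.w x / 2) ^ 2 - Real.sin (q.w x / 2) ^ 2 := by
    rw [← Real.cos_two_mul', mul_div_cancel₀ _ two_ne_zero]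
  have e3 := Real.sin_sq_add_cos_sq (q.w x / 2)
  rw [e1, e2]
  generalize Real.sin (q.w x / 2) = s at *
  generalize Real.cos (q.w x / 2) = k at *
  generalize deriv (deriv f) (q.u x) = F
  generalize nonlocalP f g q x = P
  linear_combination (-(q.v x * k ^ 2 * (g (q.u x) - P)) - 1 / 2 * F * q.v x * s ^ 2) * e3

/-- The primitive of `y² f''(y) + 2 g(y)`, the potential of the energy flux. -/
noncomputable def fluxPotential (f g : ℝ → ℝ) (x : ℝ) : ℝ :=
  ∫ y in (0 : ℝ)..x, (y ^ 2 * deriv (deriv f) y + 2 * g y)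

theorem hasDerivAt_fluxPotential (hf : ContDiff ℝ ∞ f) (hg : ContDiff ℝ ∞ g) (x : ℝ) :
    HasDerivAt (fluxPotential f g) (x ^ 2 * deriv (deriv f) x + 2 * g x) x := by
  have hc : Continuous fun y => y ^ 2 * deriv (deriv f) y + 2 * g y := by
    have h1 := (contDiff_deriv_deriv hf).continuous
    have h2 := hg.continuous
    fun_prop
  exact intervalIntegral.integral_hasDerivAt_right (hc.intervalIntegrable _ _)
    hc.stronglyMeasurable.stronglyMeasurableAtFilter hc.continuousAt

theorem contDiff_fluxPotential (hf : ContDiff ℝ ∞ f) (hg : ContDiff ℝ ∞ g) :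
    ContDiff ℝ 1 (fluxPotential f g) := by
  rw [contDiff_one_iff_deriv]
  refine ⟨fun x => (hasDerivAt_fluxPotential hf hg x).differentiableAt, ?_⟩
  rw [funext fun x => (hasDerivAt_fluxPotential hf hg x).deriv]
  have h1 := (contDiff_deriv_deriv hf).continuous
  have h2 := hg.continuous
  fun_prop

theorem NonlinBound.abs_flux_le {ρ K : ℝ} (hK : NonlinBound f g ρ K) {x : ℝ} (hx : |x| ≤ ρ) :
    |x ^ 2 * deriv (deriv f) x + 2 * g x| ≤ (ρ + 2) * K * |x| := by
  refine (abs_add_le _ _).trans ?_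
  rw [abs_mul, abs_mul, abs_two, abs_pow, sq]
  have h1 := mul_le_mul_of_nonneg_left (hK.F_le x hx) (mul_self_nonneg |x|)
  have h2 := mul_le_mul_of_nonneg_right hx (mul_nonneg (abs_nonneg x) hK.nonneg)
  have h3 := hK.g_le x hx
  linarith

theorem NonlinBound.abs_fluxPotential_le {ρ K : ℝ} (hK : NonlinBound f g ρ K) {x : ℝ}
    (hx : |x| ≤ ρ) : |fluxPotential f g x| ≤ (ρ + 2) * K * |x| * |x| := by
  have h := intervalIntegral.norm_integral_le_of_norm_le_const (a := 0) (b := x)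
    (C := (ρ + 2) * K * |x|) (f := fun y => y ^ 2 * deriv (deriv f) y + 2 * g y) fun y hy => ?_
  · simpa [fluxPotential] using h
  · have h1 : |y| ≤ |x| := by
      have := abs_sub_left_of_mem_uIcc (uIoc_subset_uIcc hy)
      simpa using this
    have hρ : 0 ≤ ρ := (abs_nonneg _).trans hx
    exact (hK.abs_flux_le (h1.trans hx)).trans
      (mul_le_mul_of_nonneg_left h1 (mul_nonneg (by linarith) hK.nonneg))

/-- The energy is conserved as long as `u_Z = (v sin w) / 2`: the time derivative of its density is
the `Z`-derivative of the flux `-2 u P + ∫_0^u (y² f''(y) + 2 g(y)) dy`, which is integrable. -/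
theorem IsWeight.integral_energy_deriv_eq_zero (hf : ContDiff ℝ ∞ f) (hg : ContDiff ℝ ∞ g)
    (hg0 : g 0 = 0) {N : ℝ} (ha : IsWeight c M q.weight) (hh : L2Le (q.density f g) N)
    (h0 : ∀ᵐ x, q.defect x = 0) (hd : IsRHS f g q d) :
    ∫ x, ((2 * q.u x * Real.cos (q.w x / 2) ^ 2 * d.u x
          + 1 / 2 * (1 - q.u x ^ 2) * Real.sin (q.w x) * d.w x) * q.v x
        + (q.u x ^ 2 * Real.cos (q.w x / 2) ^ 2 + Real.sin (q.w x / 2) ^ 2) * d.v x) = 0 := by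
  obtain ⟨ρ, hρ⟩ : ∃ ρ, ρ = 2 * ‖q‖ := ⟨_, rfl⟩
  obtain ⟨K, hK⟩ := exists_nonlinBound hf hg hg0 ρ (by rw [hρ]; positivity)
  obtain ⟨U, hU, hqU⟩ := q.exists_isPrimitive
  have hP := ha.isPrimitive_nonlocalP hh.memLp
  have hT := ha.l2Le_partsSum hh
  have hU2 : L2Le U ‖q‖ := q.l2Le_u.congr_ae hqU.symm
  have hP2 := hT.mono_ae hP.continuous.aestronglyMeasurable
    (ae_of_all _ fun Z => ha.abs_nonlocalP_le hh.memLp Z)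
  have hPx2 := hT.mono_ae (ha.continuous_nonlocalPx hh.memLp).aestronglyMeasurable
    (ae_of_all _ fun Z => abs_nonlocalPx_le f g q Z)
  have hUρ : ∀ᵐ x, |U x| ≤ ρ := by
    filter_upwards [q.ae_abs_u_le, hqU] with x h1 h2
    rwa [← h2, hρ]
  have hΨ := ((hU.mul hP).const_mul (-2)).add (hU.comp (contDiff_fluxPotential hf hg))
  have hwt : ∀ᵐ x, |q.weight x| ≤ ‖q‖ := by
    filter_upwards [q.ae_abs_v_le] with x h2
    rw [X.weight, abs_mul, abs_of_nonneg (sq_nonneg (Real.cos _))]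
    exact (mul_le_of_le_one_right (abs_nonneg _) (cos_half_sq_le_one _)).trans h2
  have hflux : L2Le (fun x => deriv (fluxPotential f g) (U x)) (|(ρ + 2) * K| * ‖q‖) := by
    refine (hU2.abs.const_mul ((ρ + 2) * K)).mono_ae ?_ ?_
    · exact (((contDiff_fluxPotential hf hg).continuous_deriv le_rfl).comp
        hU.continuous).aestronglyMeasurable
    · filter_upwards [hUρ] with x hx
      rw [(hasDerivAt_fluxPotential hf hg _).deriv]
      exact hK.abs_flux_le hx
  have hpot : Integrable fun x => fluxPotential f g (U x) := by
    refine (hU2.integrable_sq.const_mul ((ρ + 2) * K)).mono'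
      ((contDiff_fluxPotential hf hg).continuous.comp hU.continuous).aestronglyMeasurable ?_
    filter_upwards [hUρ] with x hx
    have := hK.abs_fluxPotential_le hx
    rwa [mul_assoc, ← sq, sq_abs] at this
  have hw2 := hPx2.bdd_mul q.measurable_weight.aestronglyMeasurable hwt
  have key := hΨ.integral_eq_zero (((hU2.integrable_mul hP2).const_mul (-2)).add hpot)
    ((((q.l2Le_p.integrable_mul hP2).add (hU2.integrable_mul hw2)).const_mul (-2)).add
      (hflux.integrable_mul q.l2Le_p))
  rw [← key]
  refine integral_congr_ae ?_
  filter_upwards [hqU, hd.u_eq, hd.v_eq, hd.w_eq, h0] with x h1 h2 h3 h4 h5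
  rw [(hasDerivAt_fluxPotential hf hg _).deriv, h2, h3, h4, ← h1, X.weight]
  rw [X.defect, sub_eq_zero] at h5
  rw [h5]
  have e3 := Real.sin_sq_add_cos_sq (q.w x / 2)
  generalize Real.sin (q.w x / 2) = s at *
  generalize Real.cos (q.w x / 2) = k at *
  generalize Real.sin (q.w x) = σ at *
  generalize deriv (deriv f) (q.u x) = F
  generalize nonlocalP f g q x = P
  generalize nonlocalPx f g q x = Px
  linear_combination (q.v x * σ * (g (q.u x) - P) + 1 / 2 * q.v x * σ * F * q.u x ^ 2) * e3

/-- The one-dimensional Sobolev inequality in the energy coordinate. -/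
theorem X.ae_abs_u_le_sqrt_energy (hv : ∀ᵐ x, 0 ≤ q.v x) (h0 : ∀ᵐ x, q.defect x = 0) :
    ∀ᵐ x, |q.u x| ≤ Real.sqrt q.energy := by
  obtain ⟨U, hU, hqU⟩ := q.exists_isPrimitive
  have hU2 : L2Le U ‖q‖ := q.l2Le_u.congr_ae hqU.symm
  have i1 : Integrable fun x => U x * U x := hU2.integrable_mul hU2
  have i2 : Integrable fun x => q.p x * U x + U x * q.p x :=
    (q.l2Le_p.integrable_mul hU2).add (hU2.integrable_mul q.l2Le_p)
  have h1 : ∫ x, |q.p x * U x + U x * q.p x| ≤ q.energy := by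
    refine integral_mono_ae i2.abs q.integrable_energyDensity ?_
    filter_upwards [hqU, hv, h0] with x h1 h2 h3
    rw [X.defect, sub_eq_zero] at h3
    have e1 : Real.sin (q.w x) = 2 * Real.sin (q.w x / 2) * Real.cos (q.w x / 2) := by
      rw [← Real.sin_two_mul, mul_div_cancel₀ _ two_ne_zero]
    have e2 : q.p x * U x + U x * q.p x
        = (2 * (q.u x * Real.cos (q.w x / 2)) * Real.sin (q.w x / 2)) * q.v x := by
      rw [h3, e1, ← h1]; ring
    rw [e2, abs_mul, abs_of_nonneg h2, X.energyDensity]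
    refine mul_le_mul_of_nonneg_right ?_ h2
    rw [← mul_pow, abs_le]
    constructor <;> nlinarith [sq_nonneg (q.u x * Real.cos (q.w x / 2) + Real.sin (q.w x / 2)),
      sq_nonneg (q.u x * Real.cos (q.w x / 2) - Real.sin (q.w x / 2))]
  filter_upwards [hqU] with x hx
  refine Real.abs_le_sqrt ?_
  have := ((le_abs_self _).trans ((hU.mul hU).abs_le_integral_abs i1 i2 x)).trans h1
  rwa [hx, sq]

end Algebra

theorem eq_of_hasDerivWithinAt_eq_zero {φ : ℝ → ℝ} {T : ℝ}
    (h : ∀ t ∈ Icc 0 T, HasDerivWithinAt φ 0 (Icc 0 T) t) {t : ℝ} (ht : t ∈ Icc 0 T) :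
    φ t = φ 0 := by
  have := (convex_Icc (0 : ℝ) T).norm_image_sub_le_of_norm_hasDerivWithin_le (f' := fun _ => 0)
    (C := 0) h (by simp) (left_mem_Icc.2 (ht.1.trans ht.2)) ht
  rwa [zero_mul, norm_le_zero_iff, sub_eq_zero] at this

/-- The lower and the upper Gronwall inequality. -/
theorem exp_bounds_of_abs_deriv_le {m m' : ℝ → ℝ} {T C : ℝ}
    (h : ∀ t ∈ Icc 0 T, HasDerivWithinAt m (m' t) (Icc 0 T) t)
    (hC : ∀ t ∈ Icc 0 T, |m' t| ≤ C * m t) {t : ℝ} (ht : t ∈ Icc 0 T) :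
    Real.exp (-(C * t)) * m 0 ≤ m t ∧ m t ≤ Real.exp (C * t) * m 0 := by
  have key : ∀ k : ℝ, ∀ s ∈ Icc 0 T, HasDerivWithinAt (fun s => Real.exp (k * s) * m s)
      (Real.exp (k * s) * (k * m s + m' s)) (Icc 0 T) s := fun k s hs => by
    have h1 : HasDerivWithinAt (fun s => Real.exp (k * s)) (Real.exp (k * s) * (k * 1)) (Icc 0 T) s :=
      (((hasDerivAt_id s).const_mul k).exp).hasDerivWithinAt
    refine (h1.mul (h s hs)).congr_deriv ?_
    ring
  have h0 : (0 : ℝ) ∈ Icc 0 T := left_mem_Icc.2 (ht.1.trans ht.2)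
  constructor
  · have h1 : MonotoneOn (fun s => Real.exp (C * s) * m s) (Icc 0 T) :=
      monotoneOn_of_hasDerivWithinAt_nonneg (convex_Icc 0 T)
        (fun s hs => (key C s hs).continuousWithinAt)
        (fun s hs => (key C s (interior_subset hs)).mono interior_subset) fun s hs => by
          have := (abs_le.1 (hC s (interior_subset hs))).1
          exact mul_nonneg (Real.exp_pos _).le (by linarith)
    have h2 := h1 h0 ht ht.1
    simp only [mul_zero, Real.exp_zero, one_mul] at h2
    calc _ ≤ Real.exp (-(C * t)) * (Real.exp (C * t) * m t) :=
          mul_le_mul_of_nonneg_left h2 (Real.exp_pos _).le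
      _ = m t := by rw [← mul_assoc, ← Real.exp_add]; simp
  · have h1 : MonotoneOn (fun s => -(Real.exp (-C * s) * m s)) (Icc 0 T) :=
      monotoneOn_of_hasDerivWithinAt_nonneg (convex_Icc 0 T)
        (fun s hs => (key (-C) s hs).neg.continuousWithinAt)
        (fun s hs => (key (-C) s (interior_subset hs)).neg.mono interior_subset) fun s hs => by
          have := (abs_le.1 (hC s (interior_subset hs))).2
          have := mul_nonneg (Real.exp_pos (-C * s)).le (by linarith : 0 ≤ C * m s - m' s)
          linarith
    have h2 := h1 h0 ht ht.1
    simp only [mul_zero, Real.exp_zero, one_mul, neg_le_neg_iff, neg_mul] at h2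
    calc m t = Real.exp (C * t) * (Real.exp (-(C * t)) * m t) := by
          rw [← mul_assoc, ← Real.exp_add]; simp
      _ ≤ _ := mul_le_mul_of_nonneg_left h2 (Real.exp_pos _).le

/-- A solution on `[0, T]` along which `v` stays bounded below by positive constants, that may
depend on time. -/
structure IsPositiveSolution (f g : ℝ → ℝ) (T : ℝ) (U : ℝ → X) : Prop where
  ode : ∀ t ∈ Icc 0 T, ∃ d, IsRHS f g (U t) d ∧ HasDerivWithinAt U d (Icc 0 T) t
  good : ∀ t ∈ Icc 0 T, ∃ c R, Good c R (U t)

namespace IsPositiveSolution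

variable {f g : ℝ → ℝ} {T : ℝ} {U : ℝ → X}

theorem exists_isWeight (hf : ContDiff ℝ ∞ f) (hg : ContDiff ℝ ∞ g) (hg0 : g 0 = 0)
    (h : IsPositiveSolution f g T U) {t : ℝ} (ht : t ∈ Icc 0 T) :
    ∃ c M N, IsWeight c M (U t).weight ∧ L2Le ((U t).density f g) N := by
  obtain ⟨c, R, hq⟩ := h.good t ht
  obtain ⟨K, hK⟩ := exists_nonlinBound hf hg hg0 (2 * R) (by linarith [hq.nonneg])
  exact ⟨_, _, _, hq.isWeight, hq.l2Le_density hf hg hK⟩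

theorem defect_eq_zero (hf : ContDiff ℝ ∞ f) (hg : ContDiff ℝ ∞ g) (hg0 : g 0 = 0)
    (h : IsPositiveSolution f g T U) (h0 : ∀ᵐ x, (U 0).defect x = 0) {t : ℝ} (ht : t ∈ Icc 0 T) :
    ∀ᵐ x, (U t).defect x = 0 := by
  refine ae_eq_zero_of_forall_setIntegral_eq_of_sigmaFinite
    (fun s _ hs => (U t).integrableOn_defect hs) fun s hsm hs => ?_
  have h1 := eq_of_hasDerivWithinAt_eq_zero (φ := fun τ => ∫ x in s, (U τ).defect x)
    (fun τ hτ => ?_) ht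
  · rw [h1, integral_congr_ae (g := 0) (ae_restrict_of_ae h0)]
    simp
  · obtain ⟨d, hd, hdU⟩ := h.ode τ hτ
    obtain ⟨c, M, N, ha, hh⟩ := h.exists_isWeight hf hg hg0 hτ
    refine (hasDerivWithinAt_integral_defect hsm hs hdU).congr_deriv ?_
    rw [integral_congr_ae (g := 0) (ae_restrict_of_ae (ha.ae_defect_deriv_eq_zero hh.memLp hd))]
    simp

theorem energy_eq (hf : ContDiff ℝ ∞ f) (hg : ContDiff ℝ ∞ g) (hg0 : g 0 = 0)
    (h : IsPositiveSolution f g T U) (h0 : ∀ᵐ x, (U 0).defect x = 0) {t : ℝ} (ht : t ∈ Icc 0 T) :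
    (U t).energy = (U 0).energy := by
  refine eq_of_hasDerivWithinAt_eq_zero (φ := fun τ => (U τ).energy) (fun τ hτ => ?_) ht
  obtain ⟨d, hd, hdU⟩ := h.ode τ hτ
  obtain ⟨c, M, N, ha, hh⟩ := h.exists_isWeight hf hg hg0 hτ
  exact (hasDerivWithinAt_energy hdU).congr_deriv
    (ha.integral_energy_deriv_eq_zero hf hg hg0 hh (h.defect_eq_zero hf hg hg0 h0 hτ) hd)

theorem exists_tame (hf : ContDiff ℝ ∞ f) (hg : ContDiff ℝ ∞ g) (hg0 : g 0 = 0)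
    (h : IsPositiveSolution f g T U) (h0 : ∀ᵐ x, (U 0).defect x = 0) {t : ℝ} (ht : t ∈ Icc 0 T) :
    ∃ c V, Tame c V (U 0).energy (Real.sqrt (U 0).energy) (U t) := by
  obtain ⟨c, R, hq⟩ := h.good t ht
  refine ⟨c, ‖U t‖, hq.pos, hq.le_v, (U t).ae_abs_v_le, (h.energy_eq hf hg hg0 h0 ht).le, ?_⟩
  have := X.ae_abs_u_le_sqrt_energy (hq.le_v.mono fun x hx => hq.pos.le.trans hx)
    (h.defect_eq_zero hf hg hg0 h0 ht)
  rwa [h.energy_eq hf hg hg0 h0 ht] at this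

/-- Since the energy bounds `u` and `P` uniformly, `v` grows and decays at most exponentially. -/
theorem ae_exp_bounds_v (hf : ContDiff ℝ ∞ f) (hg : ContDiff ℝ ∞ g) (hg0 : g 0 = 0)
    (h : IsPositiveSolution f g T U) (h0 : ∀ᵐ x, (U 0).defect x = 0)
    (hv : ∀ᵐ x, (U 0).v x = 1) {K C : ℝ} (hK : NonlinBound f g (Real.sqrt (U 0).energy) K)
    (hC : C = K * Real.sqrt (U 0).energy
      + (2 * (K * Real.sqrt (U 0).energy) + K * (U 0).energy) + K) {t : ℝ} (ht : t ∈ Icc 0 T) :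
    ∀ᵐ x, Real.exp (-(C * t)) ≤ (U t).v x ∧ (U t).v x ≤ Real.exp (C * t) := by
  have hi : ∀ (q : X) {s : Set ℝ}, volume s < ⊤ → IntegrableOn q.v s := fun q s hs =>
    integrableOn_of_ae_bound q.stronglyMeasurable_v.measurable hs q.ae_abs_v_le
  -- The values of `v` at a point are not continuous functions on `X`, so the differential
  -- inequality is integrated for the means of `v` over sets of finite measure.
  have key : ∀ s, MeasurableSet s → volume s < ⊤ →
      Real.exp (-(C * t)) * volume.real s ≤ ∫ x in s, (U t).v x ∧
      ∫ x in s, (U t).v x ≤ Real.exp (C * t) * volume.real s := fun s hsm hs => by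
    have e0 : ∫ x in s, (U 0).v x = volume.real s := by
      rw [integral_congr_ae (g := fun _ => (1 : ℝ)) (ae_restrict_of_ae hv)]
      simp
    choose! d hd hdU using h.ode
    have := exp_bounds_of_abs_deriv_le (m := fun τ => ∫ x in s, (U τ).v x)
      (m' := fun τ => ∫ x in s, (d τ).v x) (C := C)
      (fun τ hτ => hasDerivWithinAt_integral_v hs (hdU τ hτ)) (fun τ hτ => ?_) ht
    · rwa [e0] at this
    · obtain ⟨c, V, hq⟩ := h.exists_tame hf hg hg0 h0 hτ
      rw [← integral_const_mul]
      refine abs_integral_le_integral_abs.trans (integral_mono_ae (hi _ hs).abs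
        ((hi _ hs).const_mul C) (ae_restrict_of_ae ?_))
      filter_upwards [(hd τ hτ).v_eq, hq.le_v, hq.u_le] with x h1 h2 h3
      have hv0 := hq.pos.le.trans h2
      have h4 := hK.abs_vfactor_le h3 ((hq.isWeight.abs_nonlocalP_le
        (hq.l2Le_density hf hg hK).memLp x).trans (hq.partsSum_le hf hg hK x))
      rw [← hC] at h4
      rw [h1, abs_mul, abs_mul, abs_of_nonneg hv0]
      exact (mul_le_of_le_one_right (by positivity) (Real.abs_sin_le_one _)).trans
        (mul_le_mul_of_nonneg_right h4 hv0)
  have hconst : ∀ (k : ℝ) {s : Set ℝ}, volume s < ⊤ → IntegrableOn (fun _ => k) s :=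
    fun k s hs => integrableOn_const hs.ne
  have h1 := ae_nonneg_of_forall_setIntegral_nonneg_of_sigmaFinite (μ := volume)
    (f := fun x => (U t).v x - Real.exp (-(C * t))) (fun s _ hs => (hi _ hs).sub (hconst _ hs))
    fun s hsm hs => by
      rw [integral_sub (hi _ hs) (hconst _ hs), setIntegral_const, smul_eq_mul, mul_comm]
      exact sub_nonneg.2 (key s hsm hs).1
  have h2 := ae_nonneg_of_forall_setIntegral_nonneg_of_sigmaFinite (μ := volume)
    (f := fun x => Real.exp (C * t) - (U t).v x) (fun s _ hs => (hconst _ hs).sub (hi _ hs))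
    fun s hsm hs => by
      rw [integral_sub (hconst _ hs) (hi _ hs), setIntegral_const, smul_eq_mul, mul_comm]
      exact sub_nonneg.2 (key s hsm hs).2
  filter_upwards [h1, h2] with x e1 e2
  exact ⟨sub_nonneg.1 e1, sub_nonneg.1 e2⟩

end IsPositiveSolution

/-- The a priori bound: a solution from a datum with `u_Z = (v sin w) / 2` and `v = 1` cannot leave,
up to time `T`, a set that depends on the datum and on `T` only. -/
theorem exists_a_priori_bound {f g : ℝ → ℝ} (hf : ContDiff ℝ ∞ f) (hg : ContDiff ℝ ∞ g)
    (hg0 : g 0 = 0) {q : X} (h0 : ∀ᵐ x, q.defect x = 0) (hv : ∀ᵐ x, q.v x = 1) (T : ℝ) :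
    ∃ c R, 0 < c ∧ 0 ≤ R ∧ ∀ (T' : ℝ) (U : ℝ → X), T' ≤ T → U 0 = q →
      IsPositiveSolution f g T' U → ∀ t ∈ Icc 0 T', Good c R (U t) := by
  obtain ⟨K, hK⟩ := exists_nonlinBound hf hg hg0 (Real.sqrt q.energy) (Real.sqrt_nonneg _)
  obtain ⟨C, hC⟩ : ∃ C, C = K * Real.sqrt q.energy
      + (2 * (K * Real.sqrt q.energy) + K * q.energy) + K := ⟨_, rfl⟩
  have hE : 0 ≤ q.energy := integral_nonneg_of_ae <| by
    filter_upwards [hv] with x hx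
    have : 0 ≤ q.v x := hx ▸ zero_le_one
    exact mul_nonneg (by positivity) this
  have hC0 : 0 ≤ C := by
    have := hK.nonneg
    rw [hC]; positivity
  obtain ⟨S, hS⟩ := Tame.norm_rhs_le hf hg hK (Real.exp (-(C * T))) (Real.exp (C * T)) q.energy
  refine ⟨Real.exp (-(C * T)), ‖q‖ + |S| * |T|, Real.exp_pos _, by positivity,
    fun T' U hT hU h t ht => ?_⟩
  subst hU
  have hb : ∀ τ ∈ Icc 0 T', ∀ᵐ x, Real.exp (-(C * T)) ≤ (U τ).v x
      ∧ (U τ).v x ≤ Real.exp (C * T) := fun τ hτ => by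
    have hle : C * τ ≤ C * T := mul_le_mul_of_nonneg_left (hτ.2.trans hT) hC0
    filter_upwards [h.ae_exp_bounds_v hf hg hg0 h0 hv hK hC hτ] with x hx
    exact ⟨(Real.exp_le_exp.2 (neg_le_neg hle)).trans hx.1, hx.2.trans (Real.exp_le_exp.2 hle)⟩
  have htame : ∀ τ ∈ Icc 0 T', Tame (Real.exp (-(C * T))) (Real.exp (C * T)) (U 0).energy
      (Real.sqrt (U 0).energy) (U τ) := fun τ hτ => by
    obtain ⟨c, V, hq⟩ := h.exists_tame hf hg hg0 h0 hτ
    refine ⟨Real.exp_pos _, (hb τ hτ).mono fun x hx => hx.1, (hb τ hτ).mono fun x hx => ?_,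
      hq.energy_le, hq.u_le⟩
    rw [abs_of_nonneg ((Real.exp_pos _).le.trans hx.1)]
    exact hx.2
  refine ⟨Real.exp_pos _, (htame t ht).le_v, ?_⟩
  choose! d hd hdU using h.ode
  have h1 := (convex_Icc (0 : ℝ) T').norm_image_sub_le_of_norm_hasDerivWithin_le hdU
    (fun τ hτ => (hS _ _ (htame τ hτ) (hd τ hτ)).trans (le_abs_self S))
    (left_mem_Icc.2 (ht.1.trans ht.2)) ht
  rw [sub_zero, Real.norm_of_nonneg ht.1] at h1
  have h2 := norm_le_norm_add_norm_sub' (U t) (U 0)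
  have h3 := mul_le_mul_of_nonneg_left ((ht.2.trans hT).trans (le_abs_self T)) (abs_nonneg S)
  linarith

/-! ### Completeness of the phase space -/

theorem continuous_integral_mul_test {φ : ℝ → ℝ} (hφ : Continuous φ) (hc : HasCompactSupport φ) :
    Continuous fun u : Lp ℝ 2 (volume : Measure ℝ) => ∫ x, u x * φ x := by
  have hm : MemLp φ 2 volume := hφ.memLp_of_hasCompactSupport hc
  have h : (fun u : Lp ℝ 2 (volume : Measure ℝ) => ∫ x, u x * φ x)
      = fun u => inner ℝ u (hm.toLp φ) := by
    ext u
    rw [L2.inner_def]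
    refine integral_congr_ae ?_
    filter_upwards [hm.coeFn_toLp] with x hx
    rw [hx]
    simp [mul_comm]
  rw [h]
  exact continuous_id.inner continuous_const

theorem isClosed_H1 : IsClosed (SetLike.coe H1) := by
  have : SetLike.coe H1 =
      ⋂ (φ : ℝ → ℝ) (_ : ContDiff ℝ ∞ φ) (_ : HasCompactSupport φ),
        {q | ∫ x, q.1 x * deriv φ x = -∫ x, q.2 x * φ x} := by
    ext q
    simp only [mem_iInter]
    rfl
  rw [this]
  refine isClosed_iInter fun φ => isClosed_iInter fun hφ => isClosed_iInter fun hc => ?_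
  exact isClosed_eq ((continuous_integral_mul_test (hφ.continuous_deriv (by simp)) hc.deriv).comp
    continuous_fst) ((continuous_integral_mul_test hφ.continuous hc).comp continuous_snd).neg

/-- Convergence in `L²` and in `L^∞` both imply convergence in measure, whose limit is unique. -/
theorem isClosed_L2Linf : IsClosed (SetLike.coe L2Linf) := by
  refine IsSeqClosed.isClosed fun a q ha hq => ?_
  have h1 := tendstoInMeasure_of_tendsto_Lp ((continuous_fst.tendsto q).comp hq)
  have h2 := tendstoInMeasure_of_tendsto_Lp ((continuous_snd.tendsto q).comp hq)
  have h3 : ∀ n, ((a n).1 : ℝ → ℝ) =ᵐ[volume] ((a n).2 : ℝ → ℝ) := ha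
  exact tendstoInMeasure_ae_unique h1 (h2.congr_left fun n => (h3 n).symm)

instance : CompleteSpace H1 := isClosed_H1.completeSpace_coe

instance : CompleteSpace L2Linf := isClosed_L2Linf.completeSpace_coe

/-! ### Local solutions and uniqueness -/

/-- The right-hand side of the system as a vector field on the phase space, set to zero where it is
not defined. -/
noncomputable def rhs (f g : ℝ → ℝ) (q : X) : X :=
  open Classical in if h : ∃ d, IsRHS f g q d then h.choose else 0

theorem IsRHS.rhs_eq {f g : ℝ → ℝ} {q d : X} (h : IsRHS f g q d) : rhs f g q = d := by
  have h' : ∃ d, IsRHS f g q d := ⟨d, h⟩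
  rw [rhs, dif_pos h']
  exact h'.choose_spec.unique h

theorem Good.of_norm_sub_le {c R : ℝ} {q r : X} (h : Good c R q) (hr : ‖r - q‖ ≤ min (c / 2) 1) :
    Good (c / 2) (R + 1) r := by
  refine ⟨half_pos h.pos, ?_, ?_⟩
  · filter_upwards [h.le_v, (r - q).ae_abs_v_le, X.v_sub r q] with x h1 h2 h3
    rw [h3] at h2
    have := (abs_le.1 (h2.trans (hr.trans (min_le_left _ _)))).1
    linarith
  · have h1 := norm_le_norm_add_norm_sub' r q
    linarith [h.norm_le, hr.trans (min_le_right _ _)]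

section ODE

variable {f g : ℝ → ℝ}

theorem exists_lipschitzOnWith_rhs (hf : ContDiff ℝ ∞ f) (hg : ContDiff ℝ ∞ g) (hg0 : g 0 = 0)
    {c R : ℝ} (hc : 0 < c) (hR : 0 ≤ R) : ∃ L : NNReal, LipschitzOnWith L (rhs f g) {q | Good c R q} := by
  obtain ⟨L, hL0, hL⟩ := exists_lipschitz hf hg hg0 hc hR
  refine ⟨⟨L, hL0⟩, LipschitzOnWith.of_dist_le_mul fun q hq r hr => ?_⟩
  obtain ⟨d, hd⟩ := Good.exists_isRHS hf hg hg0 hq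
  obtain ⟨e, he⟩ := Good.exists_isRHS hf hg hg0 hr
  rw [hd.rhs_eq, he.rhs_eq, dist_eq_norm, dist_eq_norm]
  exact hL q r d e hq hr hd he

/-- The Picard-Lindelöf theorem, with a time of existence that is uniform on `Good c R`. -/
theorem exists_local_solution (hf : ContDiff ℝ ∞ f) (hg : ContDiff ℝ ∞ g) (hg0 : g 0 = 0)
    {c R : ℝ} (hc : 0 < c) (hR : 0 ≤ R) :
    ∃ τ, 0 < τ ∧ ∀ q, Good c R q → ∃ V : ℝ → X, V 0 = q ∧ IsPositiveSolution f g τ V := by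
  obtain ⟨L, hL⟩ := exists_lipschitzOnWith_rhs hf hg hg0 (half_pos hc) (by linarith : 0 ≤ R + 1)
  by_cases hne : ∃ q, Good c R q
  swap
  · exact ⟨1, one_pos, fun q hq => (hne ⟨q, hq⟩).elim⟩
  obtain ⟨q₁, hq₁⟩ := hne
  have hq₁' : Good (c / 2) (R + 1) q₁ := hq₁.weaken (half_pos hc) (by linarith) (by linarith)
  -- the Lipschitz bound makes the vector field bounded on the bounded set `Good`
  obtain ⟨S, hS⟩ : ∃ S : NNReal, (S : ℝ) = ‖rhs f g q₁‖ + L * (2 * (R + 1)) + 1 :=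
    ⟨⟨‖rhs f g q₁‖ + L * (2 * (R + 1)) + 1, by positivity⟩, rfl⟩
  have hSle : ∀ q, Good (c / 2) (R + 1) q → ‖rhs f g q‖ ≤ S := fun q hq => by
    have h1 := hL.dist_le_mul q hq q₁ hq₁'
    rw [dist_eq_norm, dist_eq_norm] at h1
    have h2 := norm_le_norm_add_norm_sub' (rhs f g q) (rhs f g q₁)
    have h3 : ‖q - q₁‖ ≤ 2 * (R + 1) :=
      (norm_sub_le _ _).trans (by linarith [hq.norm_le, hq₁'.norm_le])
    have h4 := mul_le_mul_of_nonneg_left h3 L.coe_nonneg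
    linarith
  have hS0 : (0 : ℝ) < S := by rw [hS]; positivity
  obtain ⟨a, ha⟩ : ∃ a : NNReal, (a : ℝ) = min (c / 2) 1 :=
    ⟨⟨min (c / 2) 1, by positivity⟩, rfl⟩
  have ha0 : (0 : ℝ) < a := by rw [ha]; positivity
  refine ⟨a / S, by positivity, fun q hq => ?_⟩
  have hball : ∀ r ∈ Metric.closedBall q a, Good (c / 2) (R + 1) r := fun r hr => by
    rw [Metric.mem_closedBall, dist_eq_norm, ha] at hr
    exact hq.of_norm_sub_le hr
  let t₀ : Icc (0 : ℝ) (a / S) := ⟨0, left_mem_Icc.2 (by positivity)⟩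
  have hPL : IsPicardLindelof (fun _ => rhs f g) t₀ q a 0 S L :=
    { lipschitzOnWith := fun _ _ => hL.mono hball
      continuousOn := fun _ _ => continuousOn_const
      norm_le := fun _ _ r hr => hSle r (hball r hr)
      mul_max_le := by
        have : (0 : ℝ) ≤ a / S := by positivity
        simp only [t₀, sub_zero, sub_self, NNReal.coe_zero]
        rw [max_eq_left this, mul_div_cancel₀ _ hS0.ne'] }
  have hq0 : q ∈ Metric.closedBall q ((0 : NNReal) : ℝ) := Metric.mem_closedBall_self le_rfl
  -- the fixed point of the Picard operator, rather than just a solution, since its values are known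
  -- to stay in the ball
  obtain ⟨α, hα⟩ := ODE.FunSpace.exists_isFixedPt_next hPL hq0
  have hmem : ∀ t, α.compProj t ∈ Metric.closedBall q a := fun t =>
    α.compProj_mem_closedBall hPL.mul_max_le
  refine ⟨α.compProj, ?_, fun t ht => ?_, fun t _ => ⟨_, _, hball _ (hmem t)⟩⟩
  · have : α.compProj (t₀ : ℝ) = q := by
      rw [ODE.FunSpace.compProj_val, ← hα, ODE.FunSpace.next_apply₀]
    exact this
  · obtain ⟨d, hd⟩ := (hball _ (hmem t)).exists_isRHS hf hg hg0
    refine ⟨d, hd, ?_⟩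
    rw [← hd.rhs_eq]
    refine (ODE.hasDerivWithinAt_picard_Icc t₀.2 hPL.continuousOn_uncurry
      α.continuous_compProj.continuousOn (fun _ _ => hmem _) q ht).congr_of_mem
      (fun s hs => ?_) ht
    nth_rw 1 [← hα]
    rw [ODE.FunSpace.compProj_of_mem hs, ODE.FunSpace.next_apply]

/-- A solution stays equal to a positive solution with the same initial value. -/
theorem IsPositiveSolution.eqOn (hf : ContDiff ℝ ∞ f) (hg : ContDiff ℝ ∞ g) (hg0 : g 0 = 0)
    {T : ℝ} {U V : ℝ → X} (hU : IsPositiveSolution f g T U)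
    (hV : ∀ t ∈ Icc 0 T, ∃ d, IsRHS f g (V t) d ∧ HasDerivWithinAt V d (Icc 0 T) t)
    (h0 : V 0 = U 0) : EqOn V U (Icc 0 T) := by
  have hU' : ∀ t ∈ Icc 0 T, HasDerivWithinAt U (rhs f g (U t)) (Icc 0 T) t := fun t ht => by
    obtain ⟨d, hd, hdU⟩ := hU.ode t ht
    rwa [hd.rhs_eq]
  have hV' : ∀ t ∈ Icc 0 T, HasDerivWithinAt V (rhs f g (V t)) (Icc 0 T) t := fun t ht => by
    obtain ⟨d, hd, hdV⟩ := hV t ht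
    rwa [hd.rhs_eq]
  have hUc : ContinuousOn U (Icc 0 T) := fun t ht => (hU' t ht).continuousWithinAt
  have hVc : ContinuousOn V (Icc 0 T) := fun t ht => (hV' t ht).continuousWithinAt
  have hcl : IsClosed ({t | V t = U t} ∩ Icc 0 T) := by
    have : {t | V t = U t} ∩ Icc 0 T = Icc 0 T ∩ (fun t => V t - U t) ⁻¹' {0} := by
      ext t
      simp [sub_eq_zero, and_comm]
    rw [this]
    exact (hVc.sub hUc).preimage_isClosed_of_isClosed isClosed_Icc isClosed_singleton
  refine hcl.Icc_subset_of_forall_mem_nhdsWithin h0 fun t₁ ⟨ht₁, ht₁'⟩ => ?_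
  have hmem : t₁ ∈ Icc 0 T := Ico_subset_Icc_self ht₁'
  obtain ⟨c, R, hq⟩ := hU.good t₁ hmem
  have hc := hq.pos
  obtain ⟨L, hL⟩ := exists_lipschitzOnWith_rhs hf hg hg0 (half_pos hc)
    (by linarith [hq.nonneg] : 0 ≤ R + 1)
  have hnear : ∀ W : ℝ → X, ContinuousOn W (Icc 0 T) → W t₁ = U t₁ →
      ∀ᶠ t in 𝓝[Icc 0 T] t₁, Good (c / 2) (R + 1) (W t) := fun W hW hWU => by
    have h1 := (hW t₁ hmem).eventually (Metric.closedBall_mem_nhds _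
      (by positivity : 0 < min (c / 2) 1))
    filter_upwards [h1] with t ht
    rw [dist_eq_norm, hWU] at ht
    exact hq.of_norm_sub_le ht
  have hle : 𝓝[≥] t₁ ≤ 𝓝[Icc 0 T] t₁ := nhdsWithin_le_iff.2 (Icc_mem_nhdsGE_of_mem ht₁')
  obtain ⟨t₂, ht₂, hsub⟩ := (mem_nhdsGE_iff_exists_mem_Ioc_Ico_subset ht₁'.2).1
    (((hnear U hUc rfl).and (hnear V hVc ht₁)).filter_mono hle)
  have hIcc : Icc t₁ t₂ ⊆ Icc 0 T := Icc_subset_Icc hmem.1 ht₂.2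
  have hIco : Ico t₁ t₂ ⊆ Ico 0 T := Ico_subset_Ico hmem.1 ht₂.2
  have key := ODE_solution_unique_of_mem_Icc_right (v := fun _ => rhs f g)
    (s := fun _ => {q | Good (c / 2) (R + 1) q}) (a := t₁) (b := t₂) (f := V) (g := U)
    (fun _ _ => hL) (hVc.mono hIcc)
    (fun t ht => (hV' t (Ico_subset_Icc_self (hIco ht))).mono_of_mem_nhdsWithin
      (Icc_mem_nhdsGE_of_mem (hIco ht)))
    (fun t ht => (hsub ht).2) (hUc.mono hIcc)
    (fun t ht => (hU' t (Ico_subset_Icc_self (hIco ht))).mono_of_mem_nhdsWithin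
      (Icc_mem_nhdsGE_of_mem (hIco ht)))
    (fun t ht => (hsub ht).1) ht₁
  exact mem_of_superset (Ioo_mem_nhdsGT ht₂.1) fun t ht => key (Ioo_subset_Icc_self ht)

theorem IsPositiveSolution.mono {T T' : ℝ} {U : ℝ → X} (h : IsPositiveSolution f g T U)
    (hT : T' ≤ T) : IsPositiveSolution f g T' U :=
  ⟨fun t ht => by
    obtain ⟨d, hd, hdU⟩ := h.ode t ⟨ht.1, ht.2.trans hT⟩
    exact ⟨d, hd, hdU.mono (Icc_subset_Icc_right hT)⟩,
   fun t ht => h.good t ⟨ht.1, ht.2.trans hT⟩⟩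

/-- Concatenation of solutions. -/
theorem IsPositiveSolution.concat {T τ : ℝ} {U V : ℝ → X} (hT : 0 ≤ T) (hτ : 0 ≤ τ)
    (hU : IsPositiveSolution f g T U) (hV : IsPositiveSolution f g τ V) (h0 : V 0 = U T) :
    IsPositiveSolution f g (T + τ) fun t => if t ≤ T then U t else V (t - T) := by
  set W : ℝ → X := fun t => if t ≤ T then U t else V (t - T) with hW
  have hWU : ∀ t ≤ T, W t = U t := fun t ht => if_pos ht
  have hWV : ∀ t, T ≤ t → W t = V (t - T) := fun t ht => by
    rcases ht.eq_or_lt with rfl | h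
    · rw [hWU _ le_rfl, sub_self, h0]
    · exact if_neg h.not_ge
  have hleft : ∀ t ∈ Icc 0 T, ∃ d, IsRHS f g (W t) d ∧ HasDerivWithinAt W d (Icc 0 T) t :=
    fun t ht => by
      obtain ⟨d, hd, hdU⟩ := hU.ode t ht
      refine ⟨d, by rwa [hWU t ht.2], hdU.congr (fun s hs => hWU s hs.2) (hWU t ht.2)⟩
  have hright : ∀ t ∈ Icc T (T + τ),
      ∃ d, IsRHS f g (W t) d ∧ HasDerivWithinAt W d (Icc T (T + τ)) t := fun t ht => by
    have ht' : t - T ∈ Icc 0 τ := ⟨by linarith [ht.1], by linarith [ht.2]⟩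
    obtain ⟨d, hd, hdV⟩ := hV.ode _ ht'
    refine ⟨d, by rwa [hWV t ht.1], ?_⟩
    have h1 : HasDerivWithinAt (fun t => t - T) 1 (Icc T (T + τ)) t :=
      ((hasDerivAt_id t).sub_const T).hasDerivWithinAt
    have hm : MapsTo (fun t => t - T) (Icc T (T + τ)) (Icc 0 τ) := fun s hs =>
      ⟨by linarith [hs.1], by linarith [hs.2]⟩
    have h2 := hdV.scomp t h1 hm
    rw [one_smul] at h2
    exact h2.congr (fun s hs => hWV s hs.1) (hWV t ht.1)
  refine ⟨fun t ht => ?_, fun t ht => ?_⟩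
  · rcases lt_trichotomy t T with h | h | h
    · obtain ⟨d, hd, hdW⟩ := hleft t ⟨ht.1, h.le⟩
      refine ⟨d, hd, hdW.mono_of_mem_nhdsWithin ?_⟩
      filter_upwards [self_mem_nhdsWithin, mem_nhdsWithin_of_mem_nhds (Iio_mem_nhds h)] with s h1 h2
      exact ⟨h1.1, le_of_lt h2⟩
    · obtain ⟨d, hd, hdW⟩ := hleft t ⟨ht.1, h.le⟩
      obtain ⟨e, he, heW⟩ := hright t ⟨h.ge, ht.2⟩
      rw [he.unique hd] at heW
      refine ⟨d, hd, (hdW.union heW).mono ?_⟩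
      rw [Icc_union_Icc_eq_Icc hT (by linarith)]
    · obtain ⟨d, hd, hdW⟩ := hright t ⟨h.le, ht.2⟩
      refine ⟨d, hd, hdW.mono_of_mem_nhdsWithin ?_⟩
      filter_upwards [self_mem_nhdsWithin, mem_nhdsWithin_of_mem_nhds (Ioi_mem_nhds h)] with s h1 h2
      exact ⟨le_of_lt h2, h1.2⟩
  · rcases le_total t T with h | h
    · rw [hWU t h]
      exact hU.good t ⟨ht.1, h⟩
    · rw [hWV t h]
      exact hV.good _ ⟨by linarith, by linarith [ht.2]⟩

/-- Global existence: by the a priori bound, local solutions extend by a fixed time step. -/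
theorem exists_positiveSolution (hf : ContDiff ℝ ∞ f) (hg : ContDiff ℝ ∞ g) (hg0 : g 0 = 0)
    {q : X} (h0 : ∀ᵐ x, q.defect x = 0) (hv : ∀ᵐ x, q.v x = 1) {T : ℝ} (hT : 0 ≤ T) :
    ∃ U : ℝ → X, U 0 = q ∧ IsPositiveSolution f g T U := by
  obtain ⟨c, R, hc, hR, hgood⟩ := exists_a_priori_bound hf hg hg0 h0 hv T
  obtain ⟨τ, hτ, hloc⟩ := exists_local_solution hf hg hg0 hc hR
  have hq : Good 1 ‖q‖ q := ⟨one_pos, hv.mono fun x hx => hx.ge, le_rfl⟩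
  have step : ∀ n : ℕ, ∃ U : ℝ → X, U 0 = q ∧ IsPositiveSolution f g (min T (n * τ)) U := by
    intro n
    induction n with
    | zero =>
      rw [Nat.cast_zero, zero_mul, min_eq_right hT]
      obtain ⟨d, hd⟩ := hq.exists_isRHS hf hg hg0
      refine ⟨fun _ => q, rfl, fun t ht => ⟨d, hd, ?_⟩, fun _ _ => ⟨_, _, hq⟩⟩
      rw [Icc_self] at ht ⊢
      rw [mem_singleton_iff] at ht
      rw [ht]
      exact HasFDerivWithinAt.singleton
    | succ n ih =>
      obtain ⟨U, hU0, hU⟩ := ih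
      have hTn : 0 ≤ min T (n * τ) := le_min hT (by positivity)
      obtain ⟨V, hV0, hV⟩ := hloc _ (hgood _ U (min_le_left _ _) hU0 hU _ (right_mem_Icc.2 hTn))
      refine ⟨_, ?_, (hU.concat hTn hτ.le hV hV0).mono ?_⟩
      · simp only [if_pos hTn, hU0]
      · rw [min_add]
        refine min_le_min (by linarith) ?_
        push_cast
        linarith
  obtain ⟨n, hn⟩ := exists_nat_ge (T / τ)
  obtain ⟨U, hU0, hU⟩ := step n
  rw [min_eq_left ((div_le_iff₀ hτ).1 hn)] at hU
  exact ⟨U, hU0, hU⟩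

/-- The solution on `[0, ∞)`. -/
theorem exists_global_positiveSolution (hf : ContDiff ℝ ∞ f) (hg : ContDiff ℝ ∞ g)
    (hg0 : g 0 = 0) {q : X} (h0 : ∀ᵐ x, q.defect x = 0) (hv : ∀ᵐ x, q.v x = 1) :
    ∃ U : ℝ → X, U 0 = q ∧ (∀ T, IsPositiveSolution f g T U) ∧
      ∀ t ∈ Ici (0 : ℝ), ∃ d, IsRHS f g (U t) d ∧ HasDerivWithinAt U d (Ici 0) t := by
  choose! W hW0 hW using fun (T : ℝ) (hT : 0 ≤ T) => exists_positiveSolution hf hg hg0 h0 hv hT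
  have hagree : ∀ {s T : ℝ}, 0 ≤ s → s ≤ T → W s s = W T s := fun {s T} hs hT =>
    (hW T (hs.trans hT)).mono hT |>.eqOn hf hg hg0 (hW s hs).ode
      ((hW0 s hs).trans (hW0 T (hs.trans hT)).symm) (right_mem_Icc.2 hs)
  have hpos : ∀ T, IsPositiveSolution f g T fun t => W t t := fun T => by
    refine ⟨fun t ht => ?_, fun t ht => ?_⟩
    · have hT : 0 ≤ T := ht.1.trans ht.2
      obtain ⟨d, hd, hdW⟩ := (hW T hT).ode t ht
      refine ⟨d, by rwa [hagree ht.1 ht.2], hdW.congr (fun s hs => hagree hs.1 hs.2)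
        (hagree ht.1 ht.2)⟩
    · exact (hW t ht.1).good t (right_mem_Icc.2 ht.1)
  refine ⟨fun t => W t t, hW0 0 le_rfl, hpos, fun t ht => ?_⟩
  have ht0 : 0 ≤ t := ht
  obtain ⟨d, hd, hdU⟩ := (hpos (t + 1)).ode t ⟨ht0, by linarith⟩
  refine ⟨d, hd, hdU.mono_of_mem_nhdsWithin ?_⟩
  filter_upwards [self_mem_nhdsWithin,
    mem_nhdsWithin_of_mem_nhds (Iio_mem_nhds (lt_add_one t))] with s h1 h2
  exact ⟨h1, le_of_lt h2⟩

end ODE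

/-! ### The initial datum in the energy coordinate -/

section InitialDatum

variable (ubar : H1)

theorem energyCoord_xbar (Z : ℝ) : energyCoord ubar (xbar ubar Z) = Z :=
  (Equiv.ofBijective _ (energyCoord_bijective ubar)).apply_symm_apply Z

theorem strictMono_energyCoord : StrictMono (energyCoord ubar) := fun x y h => by
  linarith [energyCoord_sub ubar h.le]

theorem xbar_le_iff {Z x : ℝ} : xbar ubar Z ≤ x ↔ Z ≤ energyCoord ubar x := by
  rw [← (strictMono_energyCoord ubar).le_iff_le, energyCoord_xbar]

theorem lt_xbar_iff {Z x : ℝ} : x < xbar ubar Z ↔ energyCoord ubar x < Z := by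
  rw [← (strictMono_energyCoord ubar).lt_iff_lt, energyCoord_xbar]

theorem xbar_preimage_Ioc (a b : ℝ) :
    xbar ubar ⁻¹' Ioc a b = Ioc (energyCoord ubar a) (energyCoord ubar b) := by
  ext Z
  exact and_congr (lt_xbar_iff ubar) (xbar_le_iff ubar)

theorem monotone_xbar : Monotone (xbar ubar) := fun Z Z' h => by
  rwa [xbar_le_iff, energyCoord_xbar]

theorem measurable_xbar : Measurable (xbar ubar) := (monotone_xbar ubar).measurable

theorem measurable_weakDeriv : Measurable (H1.weakDeriv ubar) :=
  (Lp.stronglyMeasurable ubar.1.2).measurable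

/-- The Jacobian `1 + ū_x²` of the energy coordinate. -/
noncomputable def energyJacobian (x : ℝ) : NNReal := 1 + ‖H1.weakDeriv ubar x‖₊ ^ 2

theorem coe_energyJacobian (x : ℝ) :
    (energyJacobian ubar x : ℝ) = 1 + H1.weakDeriv ubar x ^ 2 := by
  simp [energyJacobian]

theorem measurable_energyJacobian : Measurable (energyJacobian ubar) := by
  have := (measurable_weakDeriv ubar).nnnorm
  unfold energyJacobian
  fun_prop

/-- The change of variables `x = x̄(Z)`. -/
theorem map_xbar : (volume : Measure ℝ).map (xbar ubar)
    = volume.withDensity fun x => (energyJacobian ubar x : ℝ≥0∞) := by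
  have key : ∀ a b : ℝ, a < b → (volume : Measure ℝ).map (xbar ubar) (Ioc a b)
      = volume.withDensity (fun x => (energyJacobian ubar x : ℝ≥0∞)) (Ioc a b) := fun a b hab => by
    have hi := intervalIntegrable_energy ubar a b
    rw [intervalIntegrable_iff_integrableOn_Ioc_of_le hab.le] at hi
    rw [Measure.map_apply (measurable_xbar ubar) measurableSet_Ioc, xbar_preimage_Ioc,
      Real.volume_Ioc, withDensity_apply _ measurableSet_Ioc]
    have h1 : energyCoord ubar b - energyCoord ubar a
        = ∫ x in Ioc a b, (1 + H1.weakDeriv ubar x ^ 2) := by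
      rw [energyCoord, energyCoord, intervalIntegral.integral_interval_sub_left
        (intervalIntegrable_energy ubar _ _) (intervalIntegrable_energy ubar _ _),
        intervalIntegral.integral_of_le hab.le]
    rw [h1, ofReal_integral_eq_lintegral_ofReal hi (ae_of_all _ fun x => by positivity)]
    refine lintegral_congr fun x => ?_
    rw [← coe_energyJacobian, ENNReal.ofReal_coe_nnreal]
  have : IsLocallyFiniteMeasure ((volume : Measure ℝ).map (xbar ubar)) := by
    refine ⟨fun x => ⟨Ioc (x - 1) (x + 1), Ioc_mem_nhds (by linarith) (by linarith), ?_⟩⟩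
    rw [Measure.map_apply (measurable_xbar ubar) measurableSet_Ioc, xbar_preimage_Ioc,
      Real.volume_Ioc]
    exact ENNReal.ofReal_lt_top
  exact Measure.ext_of_Ioc _ _ key

theorem ae_comp_xbar {P : ℝ → Prop} (h : ∀ᵐ x, P x) : ∀ᵐ Z, P (xbar ubar Z) := by
  refine ae_of_ae_map (measurable_xbar ubar).aemeasurable ?_
  rw [map_xbar]
  exact (withDensity_absolutelyContinuous _ _).ae_le h

variable {ubar}

theorem integrable_comp_xbar {F : ℝ → ℝ} (hF : Measurable F)
    (h : Integrable fun x => (1 + H1.weakDeriv ubar x ^ 2) * F x) :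
    Integrable fun Z => F (xbar ubar Z) := by
  refine (integrable_map_measure (g := F) (f := xbar ubar) hF.aestronglyMeasurable
    (measurable_xbar ubar).aemeasurable).1 ?_
  rw [map_xbar, integrable_withDensity_iff_integrable_smul (measurable_energyJacobian ubar)]
  refine h.congr (ae_of_all _ fun x => ?_)
  simp only [NNReal.smul_def, coe_energyJacobian, smul_eq_mul]

theorem memLp_comp_xbar {F G : ℝ → ℝ} (hF : Measurable F) (hG : Integrable G)
    (hle : ∀ᵐ x, (1 + H1.weakDeriv ubar x ^ 2) * F x ^ 2 ≤ G x) :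
    MemLp (fun Z => F (xbar ubar Z)) 2 volume := by
  have hp := measurable_weakDeriv ubar
  refine (memLp_two_iff_integrable_sq
    (hF.comp (measurable_xbar ubar)).aestronglyMeasurable).2 ?_
  refine integrable_comp_xbar (F := fun x => F x ^ 2) (hF.pow_const 2)
    (hG.mono' (by fun_prop) (hle.mono fun x hx => ?_))
  rwa [Real.norm_of_nonneg (by positivity)]

/-- The chain rule for the change of variables: the derivative of `ū ∘ x̄` is
`(ū_x / (1 + ū_x²)) ∘ x̄`. -/
theorem IsPrimitive.comp_xbar {U : ℝ → ℝ} (hU : IsPrimitive U (H1.weakDeriv ubar)) :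
    IsPrimitive (fun Z => U (xbar ubar Z))
      (fun Z => H1.weakDeriv ubar (xbar ubar Z) / (1 + H1.weakDeriv ubar (xbar ubar Z) ^ 2)) := by
  have hp := measurable_weakDeriv ubar
  have hx := measurable_xbar ubar
  have hm : Measurable fun x => H1.weakDeriv ubar x / (1 + H1.weakDeriv ubar x ^ 2) := by fun_prop
  have hb : ∀ y : ℝ, ‖y / (1 + y ^ 2)‖ ≤ 1 := fun y => by
    rw [Real.norm_eq_abs, abs_div, abs_of_pos (by positivity : 0 < 1 + y ^ 2),
      div_le_one (by positivity)]
    nlinarith [sq_nonneg (|y| - 1), sq_abs y]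
  have hle : ∀ a b : ℝ, a ≤ b → U (xbar ubar b) - U (xbar ubar a) = ∫ Z in a..b,
      H1.weakDeriv ubar (xbar ubar Z) / (1 + H1.weakDeriv ubar (xbar ubar Z) ^ 2) :=
    fun a b hab => by
      have hx' := monotone_xbar ubar hab
      have hpre := xbar_preimage_Ioc ubar (xbar ubar a) (xbar ubar b)
      rw [energyCoord_xbar, energyCoord_xbar] at hpre
      rw [intervalIntegral.integral_of_le hab, ← hpre,
        ← setIntegral_map measurableSet_Ioc hm.aestronglyMeasurable hx.aemeasurable, map_xbar,
        setIntegral_withDensity_eq_setIntegral_smul (measurable_energyJacobian ubar) _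
          measurableSet_Ioc, hU.sub_eq, intervalIntegral.integral_of_le hx']
      refine integral_congr_ae (ae_of_all _ fun x => ?_)
      simp only [NNReal.smul_def, coe_energyJacobian, smul_eq_mul]
      rw [mul_div_cancel₀ _ (by positivity : (1 : ℝ) + H1.weakDeriv ubar x ^ 2 ≠ 0)]
  refine ⟨?_, fun a b => ?_⟩
  · exact (memLp_top_of_bound (hm.comp hx).aestronglyMeasurable 1
      (ae_of_all _ fun Z => hb _)).locallyIntegrable le_top
  · rcases le_total a b with h | h
    · exact hle a b h
    · rw [intervalIntegral.integral_symm, ← hle b a h, neg_sub]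

theorem abs_arctan_le (x : ℝ) : |Real.arctan x| ≤ |x| := by
  have h := convex_univ.norm_image_sub_le_of_norm_hasDerivWithin_le (f := Real.arctan)
    (C := 1) (fun y _ => (Real.hasDerivAt_arctan y).hasDerivWithinAt) (fun y _ => by
      rw [Real.norm_of_nonneg (by positivity), div_le_one (by positivity)]
      linarith [sq_nonneg y]) (mem_univ 0) (mem_univ x)
  simpa using h

theorem abs_two_mul_arctan_le (x : ℝ) : |2 * Real.arctan x| ≤ Real.pi := by
  rw [abs_le]
  constructor <;> linarith [Real.arctan_lt_pi_div_two x, Real.neg_pi_div_two_lt_arctan x]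

/-- This identity is the relation `u_Z = (v sin w) / 2` for the initial datum. -/
theorem half_sin_two_mul_arctan (x : ℝ) :
    1 / 2 * Real.sin (2 * Real.arctan x) = x / (1 + x ^ 2) := by
  have h : Real.sqrt (1 + x ^ 2) * Real.sqrt (1 + x ^ 2) = 1 + x ^ 2 :=
    Real.mul_self_sqrt (by positivity)
  rw [Real.sin_two_mul, Real.sin_arctan, Real.cos_arctan]
  calc _ = x / (Real.sqrt (1 + x ^ 2) * Real.sqrt (1 + x ^ 2)) := by ring
    _ = _ := by rw [h]

variable (ubar)

/-- The initial datum is a point of the phase space, where `u_Z = (v sin w) / 2`. -/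
theorem exists_initialDatum :
    ∃ q : X, IsInitialDatum ubar q ∧ (∀ᵐ x, q.defect x = 0) ∧ ∀ᵐ x, q.v x = 1 := by
  -- the bounds for points of `X` apply to `ū` through this point
  let r : X := (ubar, 0, 0)
  have hr2 : L2Le (H1.weakDeriv ubar) ‖r‖ := r.l2Le_p
  obtain ⟨U, hU, hrU⟩ : ∃ U, IsPrimitive U (H1.weakDeriv ubar) ∧ H1.fn ubar =ᵐ[volume] U :=
    r.exists_isPrimitive
  have hU2 : L2Le U ‖r‖ := r.l2Le_u.congr_ae hrU.symm
  have hUb : ∀ᵐ x, |U x| ≤ 2 * ‖r‖ := by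
    filter_upwards [r.ae_abs_u_le, hrU] with x h1 h2
    rwa [← h2]
  have hp := measurable_weakDeriv ubar
  have hp2 := hr2.integrable_sq
  have mU : MemLp (fun Z => U (xbar ubar Z)) 2 volume := by
    refine memLp_comp_xbar hU.continuous.measurable
      (hU2.integrable_sq.add (hp2.const_mul ((2 * ‖r‖) ^ 2))) ?_
    filter_upwards [hUb] with x hx
    have h1 : U x ^ 2 ≤ (2 * ‖r‖) ^ 2 := by
      rw [← sq_abs]
      exact pow_le_pow_left₀ (abs_nonneg _) hx 2
    have h2 := mul_le_mul_of_nonneg_right h1 (sq_nonneg (H1.weakDeriv ubar x))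
    simp only [Pi.add_apply]
    linarith
  have mp : MemLp (fun Z => H1.weakDeriv ubar (xbar ubar Z)
      / (1 + H1.weakDeriv ubar (xbar ubar Z) ^ 2)) 2 volume := by
    refine memLp_comp_xbar (F := fun x => H1.weakDeriv ubar x / (1 + H1.weakDeriv ubar x ^ 2))
      (by fun_prop) hp2 (ae_of_all _ fun x => ?_)
    have h1 : (1 + H1.weakDeriv ubar x ^ 2) * (H1.weakDeriv ubar x
        / (1 + H1.weakDeriv ubar x ^ 2)) ^ 2
        = H1.weakDeriv ubar x ^ 2 / (1 + H1.weakDeriv ubar x ^ 2) := by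
      field_simp
    rw [h1]
    exact div_le_self (sq_nonneg _) (by linarith [sq_nonneg (H1.weakDeriv ubar x)])
  have mw : MemLp (fun Z => 2 * Real.arctan (H1.weakDeriv ubar (xbar ubar Z))) 2 volume := by
    refine memLp_comp_xbar (F := fun x => 2 * Real.arctan (H1.weakDeriv ubar x))
      ((Real.measurable_arctan.comp hp).const_mul 2) (hp2.const_mul (4 + Real.pi ^ 2))
      (ae_of_all _ fun x => ?_)
    have h1 := pow_le_pow_left₀ (abs_nonneg _) (abs_arctan_le (H1.weakDeriv ubar x)) 2
    have h2 := pow_le_pow_left₀ (abs_nonneg _) (abs_two_mul_arctan_le (H1.weakDeriv ubar x)) 2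
    rw [sq_abs, sq_abs] at h1
    rw [sq_abs] at h2
    have h3 := mul_le_mul_of_nonneg_right h2 (sq_nonneg (H1.weakDeriv ubar x))
    linarith
  obtain ⟨q, hqu, hqp, hqw, hqv⟩ := X.exists_of_functions (v := fun _ => 1) (L := 1) hU.comp_xbar
    mU mp mw (ae_of_all _ fun Z => abs_two_mul_arctan_le _) aestronglyMeasurable_const
    (ae_of_all _ fun _ => abs_one.le)
  refine ⟨q, ⟨?_, hqw, hqv⟩, ?_, hqv⟩
  · filter_upwards [hqu, ae_comp_xbar ubar hrU] with Z h1 h2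
    rw [h1, h2]
  · filter_upwards [hqp, hqw, hqv] with Z h1 h2 h3
    rw [X.defect, h1, h2, h3, one_mul, half_sin_two_mul_arctan, sub_self]

end InitialDatum

end DispersiveWave

theorem lemma4p2 (f g : ℝ → ℝ) (hf : ContDiff ℝ ∞ f) (hg : ContDiff ℝ ∞ g) (hg0 : g 0 = 0)
    (ubar : DispersiveWave.H1) :
    ∃ U : ℝ → DispersiveWave.X,
      DispersiveWave.IsSolutionOn f g ubar (Ici 0) U ∧
      ∀ (I : Set ℝ) (V : ℝ → DispersiveWave.X), I.OrdConnected → I ⊆ Ici 0 → (0 : ℝ) ∈ I →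
        DispersiveWave.IsSolutionOn f g ubar I V → EqOn V U I := by
  obtain ⟨q, hq, h0, hv⟩ := DispersiveWave.exists_initialDatum ubar
  obtain ⟨U, hU0, hU, hode⟩ :=
    DispersiveWave.exists_global_positiveSolution hf hg hg0 h0 hv
  refine ⟨U, ⟨hU0 ▸ hq, hode⟩, fun I V hI hI0 h0I hV t ht => ?_⟩
  have hV0 : V 0 = U 0 := by
    rw [hU0]
    refine DispersiveWave.X.ext_ae ?_ ?_ ?_
    · filter_upwards [hV.initial.u_eq, hq.u_eq] with x h1 h2 using h1.trans h2.symm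
    · filter_upwards [hV.initial.w_eq, hq.w_eq] with x h1 h2 using h1.trans h2.symm
    · filter_upwards [hV.initial.v_eq, hq.v_eq] with x h1 h2 using h1.trans h2.symm
  have hsub : Icc 0 t ⊆ I := hI.out h0I ht
  refine (hU t).eqOn hf hg hg0 (fun s hs => ?_) hV0 (right_mem_Icc.2 (hI0 ht))
  obtain ⟨d, hd, hdV⟩ := hV.ode s (hsub hs)
  exact ⟨d, hd, hdV.mono hsub⟩
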